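/- Let $X$ be a complex Banach space and $A$ a closed, densely defined linear operator on $X$ with domain $D(A)$, resolvent set $\rho(A)$ and resolvent $R(\lambda,A)=(\lambda-A)^{-1}$. For $\theta,\omega\in\mathbb R$ put $A_\theta:=e^{-i\theta}A$ (with $D(A_\theta)=D(A)$) and $H_{\theta,\omega}:=\{e^{i\theta}\lambda:\operatorname{Re}\lambda>\omega\}$. Let $\rho_n(A)$ be the union of all half planes $H=H_{\theta,\omega}$ such that $H\subseteq\rho(A)$ and $\|R(\lambda,A)\|\le 1/d(\lambda,\partial H)$ for all $\lambda\in H$, and let $\sigma_n(A):=\mathbb C\setminus\rho_n(A)$ be the numerical spectrum of $A$. For $0<\delta<\pi/2$, $z\in\mathbb C$ and $\omega_1<\omega_2$ put $$\Sigma^\theta_\delta+z:=\{z+e^{-i\theta}\lambda:|\arg\lambda|\le\delta\}\quad(\text{vertex } z \text{ included}),\qquad \Pi^\theta_{\omega_1,\omega_2}:=\{e^{-i\theta}\lambda:\omega_1\le\operatorname{Re}\lambda\le\omega_2\}.$$ An operator generates an *$\omega$-contractive semigroup* if it generates a $C_0$-semigroup with $\|T(t)\|\le e^{\omega t}$ for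 $t\ge0$. It generates an *analytic $\omega$-contractive semigroup* if, for some $\delta\in(0,\pi/2]$, it generates an analytic semigroup of angle $\delta$ such that $\|T(z)\|\le e^{\omega\operatorname{Re}z}$ for all $z\neq0$ with $|\arg z|<\delta$. It generates a *norm continuous semigroup* if it generates a $C_0$-semigroup for which $t\mapsto T(t)$ is continuous on $[0,\infty)$ in the operator norm. It generates an *isometric group* if it generates a $C_0$-group $(U(t))_{t\in\mathbb R}$ with $\|U(t)x\|=\|x\|$ for all $t\in\mathbb R$, $x\in X$. **Classification.** At least one of the following holds: $\sigma_n(A)=\mathbb C$; $\sigma_n(A)$ is a closed half plane $\mathbb C\setminus H_{\theta,\omega}$; $\sigma_n(A)$ is contained in a sector $\Sigma^\theta_\delta+z$ with $0<\delta<\pi/2$; $\sigma_n(A)$ is contained in a strip $\Pi^\theta_{\omega_1,\omega_2}$ with $\omega_1<\omega_2$; $\sigma_n(A)$ is compact (with $\theta\in[0,2\pi)$ throughout). **Generator properties.** In (1)–(4), $\theta$ ranges over $[0,2\pi)$. 1. $\sigma_n(A)=\mathbb C$ if and only if there are no $\theta$ and $\omega\in\mathbb R$ such that $A_\theta$ generates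 an $\omega$-contractive semigroup. 2. $\sigma_n(A)\subseteq\mathbb C\setminus H_{\theta,\omega}$ for some $\theta,\omega$ if and only if there are $\theta,\omega$ such that $A_\theta$ generates an $\omega$-contractive semigroup. 3. $\sigma_n(A)\subseteq\Sigma^\theta_\delta+z$ for some $\theta$, some $0<\delta<\pi/2$ and some $z\in\mathbb C$ if and only if there are $\theta,\omega$ such that $A_\theta$ generates an analytic $\omega$-contractive semigroup. 4. $\sigma_n(A)\subseteq\Pi^\theta_{\omega_1,\omega_2}$ for some $\theta$ and $\omega_1<\omega_2$ if and only if there are $\theta$ and $\omega_1<\omega_2$ such that $A_\theta$ generates an $\omega_2$-contractive semigroup and $-A_\theta$ generates a $(-\omega_1)$-contractive semigroup. 5. $\sigma_n(A)$ is compact if and only if $A$ generates a norm continuous semigroup; equivalently, $\sigma_n(A)$ is contained in a compact set. The parameters correspond as follows. For all $\theta,\omega\in\mathbb R$, $\sigma_n(A)\subseteq\mathbb C\setminus H_{\theta,\omega}$ if and only if $A_\theta$ generates an $\omega$-contractive semigroup. For every $\theta\in\mathbb R$, $\sigma_n(A)\subseteq\Sigma^\theta_\delta+z$ for some $0<\delta<\pi/2$,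 $z\in\mathbb C$ if and only if $A_{\pi-\theta}$ generates an analytic $\omega$-contractive semigroup for some $\omega\in\mathbb R$. For all $\theta\in\mathbb R$ and $\omega_1<\omega_2$, $\sigma_n(A)\subseteq\Pi^\theta_{\omega_1,\omega_2}$ if and only if $A_{-\theta}$ generates an $\omega_2$-contractive semigroup and $-A_{-\theta}$ generates a $(-\omega_1)$-contractive semigroup. **Isometric groups.** $A$ generates an isometric group if and only if $\sigma_n(A)\subseteq i\mathbb R$. More generally, for every $\theta\in\mathbb R$, $A_\theta$ generates an isometric group if and only if $\sigma_n(A)\subseteq e^{i\theta}\,i\mathbb R$. -/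

import Mathlib

open Filter Topology Set
open scoped NNReal

namespace NumericalSpectrum

/-- The open half plane `H_{θ,ω} = {e^{iθ} λ : Re λ > ω}`. -/
def halfPlane (θ ω : ℝ) : Set ℂ :=
  {w | ω < (Complex.exp (-(Complex.I * θ)) * w).re}

/-- The closed sector `Σ^θ_δ + z = {z + e^{-iθ} λ : |arg λ| ≤ δ}` with vertex `z`
(the vertex is included, since `Complex.arg 0 = 0`). -/
def sector (θ δ : ℝ) (z : ℂ) : Set ℂ :=
  {w | |(Complex.exp (Complex.I * θ) * (w - z)).arg| ≤ δ}

/-- The closed strip `Π^θ_{ω₁,ω₂} = {e^{-iθ} λ : ω₁ ≤ Re λ ≤ ω₂}`. -/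
def strip (θ ω₁ ω₂ : ℝ) : Set ℂ :=
  {w | ω₁ ≤ (Complex.exp (Complex.I * θ) * w).re ∧ (Complex.exp (Complex.I * θ) * w).re ≤ ω₂}

/-- The open sector `{λ ≠ 0 : |arg λ| < δ}` around the positive half line. -/
def openSector (δ : ℝ) : Set ℂ :=
  {z | z ≠ 0 ∧ |z.arg| < δ}

section Operators

variable {X : Type*} [NormedAddCommGroup X] [NormedSpace ℂ X]

/-- The rotated operator `A_θ = e^{-iθ} A`, with the same domain as `A`. -/
noncomputable def rot (θ : ℝ) (A : X →ₗ.[ℂ] X) : X →ₗ.[ℂ] X :=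
  Complex.exp (-(Complex.I * θ)) • A

/-- `R` is the resolvent `R(μ, A) = (μ - A)⁻¹`: a bounded, everywhere defined two-sided inverse of
`μ - A : D(A) → X`. Such an `R` is unique if it exists. -/
def IsResolvent (A : X →ₗ.[ℂ] X) (μ : ℂ) (R : X →L[ℂ] X) : Prop :=
  (∀ x : X, ∃ h : R x ∈ A.domain, μ • R x - A ⟨R x, h⟩ = x) ∧
  ∀ x : A.domain, R (μ • (x : X) - A x) = x

/-- The resolvent set `ρ(A)`. -/
def resolventSet (A : X →ₗ.[ℂ] X) : Set ℂ :=
  {μ | ∃ R : X →L[ℂ] X, IsResolvent A μ R}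

/-- The numerical resolvent set `ρ_n(A)`: the union of all open half planes `H ⊆ ρ(A)` with
`‖R(μ, A)‖ ≤ 1 / d(μ, ∂H)` for all `μ ∈ H`. -/
def numericalResolventSet (A : X →ₗ.[ℂ] X) : Set ℂ :=
  {w | ∃ θ ∈ Ico (0 : ℝ) (2 * Real.pi), ∃ ω : ℝ, w ∈ halfPlane θ ω ∧
    halfPlane θ ω ⊆ resolventSet A ∧
    ∀ μ ∈ halfPlane θ ω, ∀ R : X →L[ℂ] X, IsResolvent A μ R →
      ‖R‖ ≤ 1 / Metric.infDist μ (frontier (halfPlane θ ω))}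

/-- The numerical spectrum `σ_n(A) = ℂ \ ρ_n(A)`. -/
def numericalSpectrum (A : X →ₗ.[ℂ] X) : Set ℂ :=
  (numericalResolventSet A)ᶜ

/-- A `C₀`-semigroup of bounded operators on `X`. -/
structure IsC0Semigroup (T : ℝ≥0 → X →L[ℂ] X) : Prop where
  map_zero : T 0 = ContinuousLinearMap.id ℂ X
  map_add : ∀ s t, T (s + t) = (T s).comp (T t)
  continuous_orbit : ∀ x, Continuous fun t => T t x

/-- `A` is the generator of `T`: the domain of `A` is the set of all `x` for which
`lim_{t ↓ 0} (T(t)x - x) / t` exists, and `A x` is that limit. -/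
def IsGenerator (A : X →ₗ.[ℂ] X) (T : ℝ≥0 → X →L[ℂ] X) : Prop :=
  ∀ x y : X, (x, y) ∈ A.graph ↔
    Tendsto (fun t : ℝ≥0 => (((t : ℝ) : ℂ)⁻¹) • (T t x - x)) (𝓝[>] 0) (𝓝 y)

/-- `A` generates an `ω`-contractive `C₀`-semigroup, i.e. one with `‖T(t)‖ ≤ e^{ωt}`. -/
def GeneratesContractive (A : X →ₗ.[ℂ] X) (ω : ℝ) : Prop :=
  ∃ T : ℝ≥0 → X →L[ℂ] X, IsC0Semigroup T ∧ IsGenerator A T ∧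
    ∀ t : ℝ≥0, ‖T t‖ ≤ Real.exp (ω * t)

/-- An analytic semigroup of angle `δ`. Only the values of `T` on `openSector δ ∪ {0}` matter. -/
structure IsAnalyticSemigroup (δ : ℝ) (T : ℂ → X →L[ℂ] X) : Prop where
  map_zero : T 0 = ContinuousLinearMap.id ℂ X
  map_add : ∀ z ∈ openSector δ, ∀ w ∈ openSector δ, T (z + w) = (T z).comp (T w)
  differentiableOn : DifferentiableOn ℂ T (openSector δ)
  tendsto_zero : ∀ δ' : ℝ, 0 < δ' → δ' < δ → ∀ x,
    Tendsto (fun z => T z x) (𝓝[openSector δ'] 0) (𝓝 x)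

/-- `A` generates an analytic `ω`-contractive semigroup: an analytic semigroup of some angle
`δ ∈ (0, π/2]` such that `e^{-ωz} T(z)` is a contraction for all `z` in its sector. -/
def GeneratesAnalyticContractive (A : X →ₗ.[ℂ] X) (ω : ℝ) : Prop :=
  ∃ δ : ℝ, 0 < δ ∧ δ ≤ Real.pi / 2 ∧ ∃ T : ℂ → X →L[ℂ] X, IsAnalyticSemigroup δ T ∧
    IsGenerator A (fun t : ℝ≥0 => T ((t : ℝ) : ℂ)) ∧
    ∀ z ∈ openSector δ, ‖T z‖ ≤ Real.exp (ω * z.re)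

/-- `A` generates a norm continuous semigroup: `t ↦ T(t)` is continuous on `[0, ∞)` for the
operator norm. -/
def GeneratesNormContinuous (A : X →ₗ.[ℂ] X) : Prop :=
  ∃ T : ℝ≥0 → X →L[ℂ] X, IsC0Semigroup T ∧ IsGenerator A T ∧ Continuous T

/-- `A` generates an isometric group: a strongly continuous group of isometries `(U(t))_{t ∈ ℝ}`
whose generator (given by the two-sided limit at `0`) is `A`. -/
def GeneratesIsometricGroup (A : X →ₗ.[ℂ] X) : Prop :=
  ∃ U : ℝ → X →L[ℂ] X, U 0 = ContinuousLinearMap.id ℂ X ∧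
    (∀ s t, U (s + t) = (U s).comp (U t)) ∧
    (∀ x, Continuous fun t => U t x) ∧
    (∀ x y : X, (x, y) ∈ A.graph ↔
      Tendsto (fun t : ℝ => ((t : ℂ)⁻¹) • (U t x - x)) (𝓝[≠] 0) (𝓝 y)) ∧
    ∀ t x, ‖U t x‖ = ‖x‖

end Operators

end NumericalSpectrum

/-! Everything passes through one notion. `MDissipative B ω` asks that Re f(Bx) ≤ ω‖x‖ for every
norming functional f of x in the domain, and that Re μ > ω lies in the resolvent set. For densely
defined A, the half plane H_{θ,ω} is admissible in the definition of ρ_n(A) exactly when A_θ is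
m-dissipative with bound ω (`mDissipative_rot_iff`). The first condition constrains the points
f(Ax)/‖x‖ of the numerical range and the second is pointwise in μ, so a half plane that is merely
covered by admissible ones is itself admissible (`numericalSpectrum_subset_compl_halfPlane_iff`). By
the Hille-Yosida theorem m-dissipativity is the same as generation of an ω-contractive semigroup.
This settles half planes, and strips as intersections of two closed half planes with opposite
directions.

A sector is the intersection of two closed half planes with a common boundary point z. With C
denoting the rotated operator shifted so that z becomes 0, both e^{-iα}C and e^{iα}C generate
contraction semigroups S₁ and S₂, which commute. For z = a e^{-iα} + b e^{iα} the product S₁(a)S₂(b)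
is holomorphic and extends the semigroup of C (`exists_analytic_contraction`). Conversely, each ray
of an analytic contractive semigroup yields an admissible half plane.

A numerical spectrum in a disc of radius r makes every A_θ m-dissipative with bound r. Then z ↦
R(1/z)Ax extends holomorphically by 0 at the origin, and the Schwarz lemma gives ‖Ax‖ ≤ 6r‖x‖
(`exists_bounded_of_mDissipative`). Norm continuous semigroups are exactly those with bounded
generator.

For isometric groups, the semigroups of B and −B are mutually inverse contractions. The
classification compares the directions of the admissible half planes: none, only one, two opposite
ones, or two that are not parallel. -/

namespace NumericalSpectrum

/-! ### Resolvents, rotations, m-dissipativity and admissible half planes -/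

section Basics

variable {X : Type*} [NormedAddCommGroup X] [NormedSpace ℂ X]

/-- The graph form removes the dependence on proofs of domain membership, so that scalings and
shifts of the operator become linear algebra in X × X. -/
theorem isResolvent_iff {A : X →ₗ.[ℂ] X} {μ : ℂ} {R : X →L[ℂ] X} :
    IsResolvent A μ R ↔ (∀ x, (R x, μ • R x - x) ∈ A.graph) ∧
      ∀ x y, (x, y) ∈ A.graph → R (μ • x - y) = x := by
  constructor
  · rintro ⟨h1, h2⟩
    refine ⟨fun x => ?_, fun x y hxy => ?_⟩
    · obtain ⟨h, hx⟩ := h1 x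
      rw [LinearPMap.mem_graph_iff]
      refine ⟨⟨R x, h⟩, rfl, ?_⟩
      change A ⟨R x, h⟩ = μ • R x - x
      rw [eq_sub_iff_add_eq, ← sub_eq_iff_eq_add'.mp hx]
    · rw [LinearPMap.mem_graph_iff] at hxy
      obtain ⟨x', rfl, rfl⟩ := hxy
      exact h2 x'
  · rintro ⟨h1, h2⟩
    refine ⟨fun x => ?_, fun x => h2 _ _ (A.mem_graph x)⟩
    obtain ⟨x', hx1, hx2⟩ := (LinearPMap.mem_graph_iff A).1 (h1 x)
    have h : R x ∈ A.domain := LinearPMap.mem_domain_of_mem_graph (h1 x)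
    refine ⟨h, ?_⟩
    have : x' = ⟨R x, h⟩ := Subtype.ext hx1
    rw [← this, hx2, sub_sub_cancel]

theorem IsResolvent.unique {A : X →ₗ.[ℂ] X} {μ : ℂ} {R R' : X →L[ℂ] X}
    (h : IsResolvent A μ R) (h' : IsResolvent A μ R') : R = R' := by
  rw [isResolvent_iff] at h h'
  ext x
  have := h.2 _ _ (h'.1 x)
  rwa [sub_sub_cancel] at this

/-- The resolvent identity comes from applying R to (μ − A)Sx = x − (ν − μ)Sx. -/
theorem IsResolvent.sub_eq {A : X →ₗ.[ℂ] X} {μ ν : ℂ} {R S : X →L[ℂ] X}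
    (hR : IsResolvent A μ R) (hS : IsResolvent A ν S) (x : X) :
    R x - S x = (ν - μ) • R (S x) := by
  rw [isResolvent_iff] at hR hS
  have h := hR.2 _ _ (hS.1 x)
  have e : μ • S x - (ν • S x - x) = x - (ν - μ) • S x := by rw [sub_smul]; abel
  rw [e, map_sub, map_smul] at h
  rw [sub_eq_iff_eq_add, ← sub_eq_iff_eq_add']
  exact h

theorem IsResolvent.commute {A : X →ₗ.[ℂ] X} {μ ν : ℂ} {R S : X →L[ℂ] X}
    (hR : IsResolvent A μ R) (hS : IsResolvent A ν S) : Commute R S := by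
  by_cases h : μ = ν
  · subst h
    rw [hR.unique hS]
  · ext x
    have h1 := hR.sub_eq hS x
    have h2 := hS.sub_eq hR x
    have h3 : (ν - μ) • R (S x) = (ν - μ) • S (R x) := by
      rw [← h1, ← neg_sub (S x), h2, ← neg_smul, neg_sub]
    exact smul_right_injective X (sub_ne_zero.2 (Ne.symm h)) h3

theorem mem_graph_smul {A : X →ₗ.[ℂ] X} {c : ℂ} (hc : c ≠ 0) {x y : X} :
    (x, y) ∈ (c • A).graph ↔ (x, c⁻¹ • y) ∈ A.graph := by
  simp only [LinearPMap.mem_graph_iff]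
  constructor
  · rintro ⟨x', rfl, h⟩
    refine ⟨x', rfl, ?_⟩
    rw [LinearPMap.smul_apply] at h
    rw [← h, inv_smul_smul₀ hc]
  · rintro ⟨x', rfl, h⟩
    refine ⟨x', rfl, ?_⟩
    rw [LinearPMap.smul_apply]
    rw [h, smul_inv_smul₀ hc]

theorem neg_eq_smul (A : X →ₗ.[ℂ] X) : -A = (-1 : ℂ) • A := by
  refine LinearPMap.ext rfl fun x hx hx' => ?_
  rw [LinearPMap.neg_apply, LinearPMap.smul_apply, neg_one_smul]

theorem isResolvent_smul {A : X →ₗ.[ℂ] X} {c : ℂ} (hc : c ≠ 0) {μ : ℂ} {R : X →L[ℂ] X}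
    (h : IsResolvent A μ R) : IsResolvent (c • A) (c * μ) (c⁻¹ • R) := by
  rw [isResolvent_iff] at h ⊢
  simp only [mem_graph_smul hc]
  refine ⟨fun x => ?_, fun x y hxy => ?_⟩
  · have := A.graph.smul_mem c⁻¹ (h.1 x)
    convert this using 1
    simp only [FunLike.coe_smul, Pi.smul_apply, Prod.smul_mk, Prod.mk.injEq, true_and, smul_sub,
      smul_smul]
    congr 2
    field_simp
  · have := h.2 _ _ hxy
    rw [FunLike.coe_smul, Pi.smul_apply, ← map_smul, smul_sub, smul_smul,
      inv_mul_cancel_left₀ hc, this]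

theorem exp_neg_I_ne_zero (θ : ℝ) : Complex.exp (-(Complex.I * θ)) ≠ 0 := Complex.exp_ne_zero _

theorem exp_neg_I_inv (θ : ℝ) :
    (Complex.exp (-(Complex.I * θ)))⁻¹ = Complex.exp (Complex.I * θ) := by
  rw [← Complex.exp_neg, neg_neg]

theorem norm_exp_neg_I (θ : ℝ) : ‖Complex.exp (-(Complex.I * θ))‖ = 1 := by
  rw [Complex.norm_exp]; simp

theorem mem_graph_rot {A : X →ₗ.[ℂ] X} {θ : ℝ} {x y : X} :
    (x, y) ∈ (rot θ A).graph ↔ (x, Complex.exp (Complex.I * θ) • y) ∈ A.graph := by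
  rw [rot, mem_graph_smul (exp_neg_I_ne_zero θ), exp_neg_I_inv]

theorem mem_graph_rot_of_mem {A : X →ₗ.[ℂ] X} {θ : ℝ} {x y : X} (h : (x, y) ∈ A.graph) :
    (x, Complex.exp (-(Complex.I * θ)) • y) ∈ (rot θ A).graph := by
  rw [mem_graph_rot, smul_smul, ← Complex.exp_add]
  simpa using h

theorem rot_rot (θ φ : ℝ) (A : X →ₗ.[ℂ] X) : rot θ (rot φ A) = rot (θ + φ) A := by
  refine LinearPMap.ext rfl fun x hx hx' => ?_
  simp only [rot, LinearPMap.smul_apply, smul_smul, ← Complex.exp_add]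
  congr 2
  push_cast
  ring

theorem rot_zero (A : X →ₗ.[ℂ] X) : rot 0 A = A := by
  refine LinearPMap.ext rfl fun x hx hx' => ?_
  simp [rot, LinearPMap.smul_apply]

theorem rot_pi (A : X →ₗ.[ℂ] X) : rot Real.pi A = -A := by
  rw [neg_eq_smul, rot, mul_comm, Complex.exp_neg, Complex.exp_pi_mul_I]
  norm_num

/-- Angles enter every definition only through e^{±iθ}, so any real angle may be replaced by its
representative in [0, 2π). -/
theorem exp_toIcoMod (θ : ℝ) :
    Complex.exp (Complex.I * (toIcoMod Real.two_pi_pos 0 θ : ℝ)) = Complex.exp (Complex.I * θ) := by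
  have h := self_sub_toIcoDiv_zsmul Real.two_pi_pos 0 θ
  rw [← h, Complex.exp_eq_exp_iff_exists_int]
  refine ⟨-toIcoDiv Real.two_pi_pos 0 θ, ?_⟩
  push_cast [zsmul_eq_mul]
  ring

theorem exp_neg_toIcoMod (θ : ℝ) :
    Complex.exp (-(Complex.I * (toIcoMod Real.two_pi_pos 0 θ : ℝ))) =
      Complex.exp (-(Complex.I * θ)) := by
  rw [Complex.exp_neg, exp_toIcoMod, ← Complex.exp_neg]

theorem toIcoMod_mem (θ : ℝ) : toIcoMod Real.two_pi_pos 0 θ ∈ Ico (0 : ℝ) (2 * Real.pi) := by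
  simpa using toIcoMod_mem_Ico Real.two_pi_pos 0 θ

theorem rot_toIcoMod (θ : ℝ) (A : X →ₗ.[ℂ] X) :
    rot (toIcoMod Real.two_pi_pos 0 θ) A = rot θ A := by
  rw [rot, rot, exp_neg_toIcoMod]

theorem halfPlane_toIcoMod (θ ω : ℝ) :
    halfPlane (toIcoMod Real.two_pi_pos 0 θ) ω = halfPlane θ ω := by
  rw [halfPlane, halfPlane, exp_neg_toIcoMod]

theorem sector_toIcoMod (θ δ : ℝ) (z : ℂ) :
    sector (toIcoMod Real.two_pi_pos 0 θ) δ z = sector θ δ z := by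
  rw [sector, sector, exp_toIcoMod]

theorem strip_toIcoMod (θ ω₁ ω₂ : ℝ) :
    strip (toIcoMod Real.two_pi_pos 0 θ) ω₁ ω₂ = strip θ ω₁ ω₂ := by
  rw [strip, strip, exp_toIcoMod]

/-- The operator `A - w` with domain `D(A)`. -/
noncomputable def shift (w : ℂ) (A : X →ₗ.[ℂ] X) : X →ₗ.[ℂ] X :=
  ⟨A.domain, A.toFun - w • A.domain.subtype⟩

theorem mem_graph_shift {w : ℂ} {A : X →ₗ.[ℂ] X} {x y : X} :
    (x, y) ∈ (shift w A).graph ↔ (x, y + w • x) ∈ A.graph := by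
  simp only [LinearPMap.mem_graph_iff]
  constructor
  · rintro ⟨x', rfl, h⟩
    refine ⟨x', rfl, ?_⟩
    rw [← h]
    change _ = (A x' - w • (x' : X)) + _
    rw [sub_add_cancel]
  · rintro ⟨x', rfl, h⟩
    refine ⟨x', rfl, ?_⟩
    change A x' - w • (x' : X) = _
    rw [h, add_sub_cancel_right]

theorem isResolvent_shift {w : ℂ} {A : X →ₗ.[ℂ] X} {μ : ℂ} {R : X →L[ℂ] X} :
    IsResolvent (shift w A) μ R ↔ IsResolvent A (μ + w) R := by
  simp only [isResolvent_iff, mem_graph_shift]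
  refine and_congr (forall_congr' fun x => ?_) ⟨fun h x y hxy => ?_, fun h x y hxy => ?_⟩
  · rw [add_smul]
    congr! 2
    abel
  · have := h x (y - w • x) (by simpa using hxy)
    convert this using 2
    rw [add_smul]; abel
  · have := h x _ hxy
    convert this using 2
    rw [add_smul]; abel

/-- `B - ω` is m-dissipative: the numerical range of `B` lies in `{Re ≤ ω}` and
`{Re > ω}` lies in the resolvent set. -/
def MDissipative (B : X →ₗ.[ℂ] X) (ω : ℝ) : Prop :=
  (∀ x y, (x, y) ∈ B.graph → ∀ f : X →L[ℂ] ℂ, ‖f‖ ≤ 1 → f x = ‖x‖ → (f y).re ≤ ω * ‖x‖) ∧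
    ∀ μ : ℂ, ω < μ.re → ∃ R, IsResolvent B μ R

/-- Test μx − y against a norming functional of x, which Hahn-Banach provides. -/
theorem MDissipative.le_norm {B : X →ₗ.[ℂ] X} {ω : ℝ} (h : MDissipative B ω) {x y : X}
    (hxy : (x, y) ∈ B.graph) (μ : ℂ) : (μ.re - ω) * ‖x‖ ≤ ‖μ • x - y‖ := by
  obtain ⟨f, hf1, hf2⟩ := exists_dual_vector'' ℂ x
  have h1 := h.1 x y hxy f hf1 hf2
  have h2 : (f (μ • x - y)).re ≤ ‖μ • x - y‖ :=
    (Complex.re_le_norm _).trans ((f.le_opNorm _).trans (mul_le_of_le_one_left (norm_nonneg _) hf1))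
  rw [map_sub, map_smul, hf2] at h2
  simp at h2
  linarith

theorem MDissipative.norm_le {B : X →ₗ.[ℂ] X} {ω : ℝ} (h : MDissipative B ω) {μ : ℂ}
    (hμ : ω < μ.re) {R : X →L[ℂ] X} (hR : IsResolvent B μ R) : ‖R‖ ≤ 1 / (μ.re - ω) := by
  have h0 : 0 < μ.re - ω := sub_pos.2 hμ
  refine R.opNorm_le_bound (by positivity) fun x => ?_
  have := h.le_norm ((isResolvent_iff.1 hR).1 x) μ
  rw [sub_sub_cancel] at this
  rw [one_div, inv_mul_eq_div, le_div_iff₀ h0]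
  linarith

theorem MDissipative.mono {B : X →ₗ.[ℂ] X} {ω ω' : ℝ} (h : MDissipative B ω) (hω : ω ≤ ω') :
    MDissipative B ω' :=
  ⟨fun x y hxy f hf1 hf2 => (h.1 x y hxy f hf1 hf2).trans
    (mul_le_mul_of_nonneg_right hω (norm_nonneg _)), fun μ hμ => h.2 μ (hω.trans_lt hμ)⟩

theorem mDissipative_shift {B : X →ₗ.[ℂ] X} {ω : ℝ} {w : ℂ} (h : MDissipative B ω) :
    MDissipative (shift w B) (ω - w.re) := by
  refine ⟨fun x y hxy f hf1 hf2 => ?_, fun μ hμ => ?_⟩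
  · have := h.1 _ _ (mem_graph_shift.1 hxy) f hf1 hf2
    rw [map_add, map_smul, hf2] at this
    simp at this
    linarith
  · simp only [isResolvent_shift]
    refine h.2 _ ?_
    rw [Complex.add_re]
    linarith

/-- If `R n` are resolvents at `λ n → ∞` with `‖λ n R n‖` bounded, then `λ n R n → 1` strongly. -/
theorem tendsto_smul_resolvent {B : X →ₗ.[ℂ] X} (hd : Dense (B.domain : Set X)) {l : ℕ → ℂ}
    {R : ℕ → X →L[ℂ] X} (hR : ∀ n, IsResolvent B (l n) (R n)) {C : ℝ}
    (hC : ∀ n, ‖l n • R n‖ ≤ C) (h0 : Tendsto (fun n => ‖R n‖) atTop (𝓝 0)) (x : X) :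
    Tendsto (fun n => l n • R n x) atTop (𝓝 x) := by
  have hC0 : 0 ≤ C := (norm_nonneg _).trans (hC 0)
  rw [Metric.tendsto_atTop]
  intro ε hε
  have hε' : 0 < ε / (C + 2) := by positivity
  obtain ⟨x', hx', hxx'⟩ := Metric.mem_closure_iff.1 (hd x) _ hε'
  obtain ⟨y, hy⟩ := LinearPMap.mem_domain_iff.1 hx'
  have h1 : Tendsto (fun n => ‖R n‖ * ‖y‖) atTop (𝓝 0) := by simpa using h0.mul_const ‖y‖
  obtain ⟨N, hN⟩ := (h1.eventually_lt_const hε').exists_forall_of_atTop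
  refine ⟨N, fun n hn => ?_⟩
  have e1 : l n • R n x' - x' = R n y := by
    have := (isResolvent_iff.1 (hR n)).2 _ _ hy
    rw [map_sub, map_smul] at this
    rw [sub_eq_iff_eq_add, ← sub_eq_iff_eq_add']
    exact this
  have e2 : l n • R n x - x = (l n • R n) (x - x') + R n y - (x - x') := by
    rw [← e1, FunLike.coe_smul, Pi.smul_apply, map_sub, smul_sub]
    abel
  rw [dist_eq_norm] at hxx' ⊢
  rw [e2]
  calc _ ≤ ‖(l n • R n) (x - x')‖ + ‖R n y‖ + ‖x - x'‖ :=
        (norm_sub_le _ _).trans (by gcongr; exact norm_add_le _ _)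
    _ ≤ C * ‖x - x'‖ + ‖R n‖ * ‖y‖ + ‖x - x'‖ := by
        gcongr
        · exact ContinuousLinearMap.le_of_opNorm_le _ (hC n) _
        · exact (R n).le_opNorm y
    _ < C * (ε / (C + 2)) + ε / (C + 2) + ε / (C + 2) := by
        have := hN n hn
        have : C * ‖x - x'‖ ≤ C * (ε / (C + 2)) := by gcongr
        linarith
    _ = ε := by field_simp; ring

/-- Take the resolvents R_n at ω + n + 1. Then R_n(y − ωx) = (n+1)R_n x − x, and Re f(R_n x) ≤
‖x‖/(n+1) makes its image under f have nonpositive real part. After multiplication by n + 1 it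
converges to y − ωx, by density of the domain. -/
theorem mDissipative_of_norm_le {B : X →ₗ.[ℂ] X} (hd : Dense (B.domain : Set X)) {ω : ℝ}
    (h1 : ∀ μ : ℂ, ω < μ.re → ∃ R, IsResolvent B μ R)
    (h2 : ∀ μ : ℂ, ω < μ.re → ∀ R, IsResolvent B μ R → ‖R‖ ≤ 1 / (μ.re - ω)) :
    MDissipative B ω := by
  refine ⟨fun x y hxy f hf1 hf2 => ?_, h1⟩
  have hl : ∀ n : ℕ, ω < ((ω + (n + 1) : ℝ) : ℂ).re := fun n => by
    rw [Complex.ofReal_re]; linarith [n.cast_nonneg (α := ℝ)]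
  choose R hR using fun n : ℕ => h1 _ (hl n)
  have hn : ∀ n : ℕ, ‖R n‖ ≤ 1 / (n + 1) := fun n => by
    have := h2 _ (hl n) _ (hR n)
    rwa [Complex.ofReal_re, add_sub_cancel_left] at this
  have h0 : Tendsto (fun n => ‖R n‖) atTop (𝓝 0) :=
    squeeze_zero (fun _ => norm_nonneg _) hn tendsto_one_div_add_atTop_nhds_zero_nat
  have hC : ∀ n : ℕ, ‖((ω + (n + 1) : ℝ) : ℂ) • R n‖ ≤ |ω| + 1 := fun n => by
    rw [norm_smul, Complex.norm_real, Real.norm_eq_abs]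
    have hn0 : (0 : ℝ) ≤ n := n.cast_nonneg
    calc |ω + (n + 1)| * ‖R n‖ ≤ (|ω| + (n + 1)) * (1 / (n + 1)) := by
          gcongr
          · exact (abs_add_le _ _).trans (by rw [abs_of_nonneg (by positivity : (0:ℝ) ≤ n + 1)])
          · exact hn n
      _ ≤ |ω| + 1 := by
          rw [mul_one_div, add_div, div_self (by positivity)]
          gcongr
          exact div_le_self (abs_nonneg _) (by linarith)
  have hlim := tendsto_smul_resolvent hd hR hC h0 (y - (ω : ℂ) • x)
  have hlim0 : Tendsto (fun n => (ω : ℂ) • R n (y - (ω : ℂ) • x)) atTop (𝓝 0) := by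
    rw [tendsto_zero_iff_norm_tendsto_zero]
    refine squeeze_zero (fun _ => norm_nonneg _) (fun n => ?_)
      (by simpa only [zero_mul, mul_zero] using
        (h0.mul_const ‖y - (ω : ℂ) • x‖).const_mul ‖(ω : ℂ)‖)
    rw [norm_smul]
    exact mul_le_mul_of_nonneg_left ((R n).le_opNorm _) (norm_nonneg (ω : ℂ))
  have key : ∀ n : ℕ, (f (((ω + (n + 1) : ℝ) : ℂ) • R n (y - (ω : ℂ) • x) -
      (ω : ℂ) • R n (y - (ω : ℂ) • x))).re ≤ 0 := fun n => by
    have hp : (0 : ℝ) < n + 1 := by positivity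
    have e := (isResolvent_iff.1 (hR n)).2 _ _ hxy
    have e' : R n (y - (ω : ℂ) • x) = ((n + 1 : ℝ) : ℂ) • R n x - x := by
      rw [eq_sub_iff_add_eq, ← eq_sub_iff_add_eq', ← map_smul, ← map_sub, ← e]
      congr 1
      rw [e]
      push_cast
      module
    rw [← sub_smul, e']
    have b1 : (f (R n x)).re * (n + 1) ≤ ‖x‖ := by
      have : ‖f (R n x)‖ ≤ 1 * (1 / (n + 1) * ‖x‖) :=
        f.le_of_opNorm_le_of_le hf1 ((R n).le_of_opNorm_le (hn n) x)
      have h3 := (Complex.re_le_norm _).trans this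
      rw [one_mul, one_div, inv_mul_eq_div, le_div_iff₀ hp] at h3
      exact h3
    rw [← Complex.ofReal_sub, add_sub_cancel_left]
    simp only [map_smul, map_sub, hf2, smul_eq_mul, Complex.re_ofReal_mul, Complex.sub_re,
      Complex.ofReal_re]
    exact mul_nonpos_of_nonneg_of_nonpos hp.le (by linarith)
  have hlim' := ((Complex.continuous_re.comp f.continuous).tendsto _).comp (hlim.sub hlim0)
  have := le_of_tendsto' hlim' key
  simp only [Function.comp, sub_zero, map_sub, map_smul, hf2, smul_eq_mul, Complex.sub_re,
    Complex.re_ofReal_mul, Complex.ofReal_re] at this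
  linarith

theorem frontier_halfPlane (θ ω : ℝ) :
    frontier (halfPlane θ ω) = {w | (Complex.exp (-(Complex.I * θ)) * w).re = ω} := by
  have h := (Homeomorph.mulLeft₀ _ (exp_neg_I_ne_zero θ)).preimage_frontier {z : ℂ | ω < z.re}
  rw [Complex.frontier_setOfPred_lt_re] at h
  exact h.symm

/-- The foot of the perpendicular, μ − d e^{iθ}, realises the distance d. No boundary point is
closer, since rotation is isometric and Re z ≤ |z|. -/
theorem infDist_frontier_halfPlane {θ ω : ℝ} {μ : ℂ} (hμ : μ ∈ halfPlane θ ω) :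
    Metric.infDist μ (frontier (halfPlane θ ω)) =
      (Complex.exp (-(Complex.I * θ)) * μ).re - ω := by
  have hμ' : ω < (Complex.exp (-(Complex.I * θ)) * μ).re := hμ
  rw [frontier_halfPlane]
  set d := (Complex.exp (-(Complex.I * θ)) * μ).re - ω with hd
  have hd0 : 0 < d := sub_pos.2 hμ'
  have hp : μ - d * Complex.exp (Complex.I * θ) ∈
      {w : ℂ | (Complex.exp (-(Complex.I * θ)) * w).re = ω} := by
    rw [mem_ofPred_eq, mul_sub, mul_left_comm, ← Complex.exp_add, neg_add_cancel, Complex.exp_zero,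
      mul_one, Complex.sub_re, Complex.ofReal_re, hd]
    ring
  refine le_antisymm ?_ ?_
  · refine (Metric.infDist_le_dist_of_mem hp).trans (le_of_eq ?_)
    rw [dist_eq_norm, sub_sub_cancel, norm_mul, Complex.norm_real, Complex.norm_exp]
    simp [abs_of_pos hd0]
  · rw [Metric.le_infDist ⟨_, hp⟩]
    intro w hw
    rw [mem_ofPred_eq] at hw
    calc d = (Complex.exp (-(Complex.I * θ)) * (μ - w)).re := by
          rw [mul_sub, Complex.sub_re, hw, hd]
      _ ≤ ‖Complex.exp (-(Complex.I * θ)) * (μ - w)‖ := Complex.re_le_norm _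
      _ = dist μ w := by rw [norm_mul, norm_exp_neg_I, one_mul, dist_eq_norm]

theorem isResolvent_rot {A : X →ₗ.[ℂ] X} {μ : ℂ} {R : X →L[ℂ] X} (θ : ℝ)
    (h : IsResolvent A μ R) :
    IsResolvent (rot θ A) (Complex.exp (-(Complex.I * θ)) * μ)
      (Complex.exp (Complex.I * θ) • R) := by
  rw [← exp_neg_I_inv]
  exact isResolvent_smul (exp_neg_I_ne_zero θ) h

theorem isResolvent_of_rot {A : X →ₗ.[ℂ] X} {μ : ℂ} {R : X →L[ℂ] X} (θ : ℝ)
    (h : IsResolvent (rot θ A) μ R) :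
    IsResolvent A (Complex.exp (Complex.I * θ) * μ) (Complex.exp (-(Complex.I * θ)) • R) := by
  have := isResolvent_rot (-θ) h
  rw [rot_rot, neg_add_cancel, rot_zero] at this
  simpa using this

theorem exp_I_mul_cancel (θ : ℝ) (μ : ℂ) :
    Complex.exp (Complex.I * θ) * (Complex.exp (-(Complex.I * θ)) * μ) = μ := by
  rw [← mul_assoc, ← Complex.exp_add, add_neg_cancel, Complex.exp_zero, one_mul]

theorem exp_neg_I_mul_cancel (θ : ℝ) (μ : ℂ) :
    Complex.exp (-(Complex.I * θ)) * (Complex.exp (Complex.I * θ) * μ) = μ := by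
  rw [← mul_assoc, ← Complex.exp_add, neg_add_cancel, Complex.exp_zero, one_mul]

theorem mem_halfPlane {θ ω : ℝ} {w : ℂ} :
    w ∈ halfPlane θ ω ↔ ω < (Complex.exp (-(Complex.I * θ)) * w).re := Iff.rfl

theorem dense_domain_rot {A : X →ₗ.[ℂ] X} (hd : Dense (A.domain : Set X)) (θ : ℝ) :
    Dense ((rot θ A).domain : Set X) := hd

/-- The admissible half planes in the definition of `ρ_n(A)` are those for which the rotated
operator is m-dissipative. -/
theorem mDissipative_rot_iff {A : X →ₗ.[ℂ] X} (hd : Dense (A.domain : Set X)) {θ ω : ℝ} :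
    MDissipative (rot θ A) ω ↔ halfPlane θ ω ⊆ resolventSet A ∧
      ∀ μ ∈ halfPlane θ ω, ∀ R : X →L[ℂ] X, IsResolvent A μ R →
        ‖R‖ ≤ 1 / Metric.infDist μ (frontier (halfPlane θ ω)) := by
  have e1 : ∀ R : X →L[ℂ] X, ‖Complex.exp (-(Complex.I * θ)) • R‖ = ‖R‖ := fun R => by
    rw [norm_smul, norm_exp_neg_I, one_mul]
  have e2 : ∀ R : X →L[ℂ] X, ‖Complex.exp (Complex.I * θ) • R‖ = ‖R‖ := fun R => by
    rw [norm_smul, Complex.norm_exp]; simp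
  constructor
  · intro h
    refine ⟨fun μ hμ => ?_, fun μ hμ R hR => ?_⟩
    · obtain ⟨R, hR⟩ := h.2 _ hμ
      have := isResolvent_of_rot θ hR
      rw [exp_I_mul_cancel] at this
      exact ⟨_, this⟩
    · rw [infDist_frontier_halfPlane hμ, ← e2]
      exact h.norm_le hμ (isResolvent_rot θ hR)
  · rintro ⟨h1, h2⟩
    refine mDissipative_of_norm_le (dense_domain_rot hd θ) (fun μ hμ => ?_) (fun μ hμ R hR => ?_)
    · obtain ⟨R, hR⟩ := h1 (show Complex.exp (Complex.I * θ) * μ ∈ halfPlane θ ω by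
        rwa [mem_halfPlane, exp_neg_I_mul_cancel])
      have := isResolvent_rot θ hR
      rw [exp_neg_I_mul_cancel] at this
      exact ⟨_, this⟩
    · have hμ' : Complex.exp (Complex.I * θ) * μ ∈ halfPlane θ ω := by
        rwa [mem_halfPlane, exp_neg_I_mul_cancel]
      have := h2 _ hμ' _ (isResolvent_of_rot θ hR)
      rwa [infDist_frontier_halfPlane hμ', exp_neg_I_mul_cancel, e1] at this

theorem mem_numericalResolventSet_iff {A : X →ₗ.[ℂ] X} (hd : Dense (A.domain : Set X)) {w : ℂ} :
    w ∈ numericalResolventSet A ↔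
      ∃ θ ω : ℝ, w ∈ halfPlane θ ω ∧ MDissipative (rot θ A) ω := by
  constructor
  · rintro ⟨θ, -, ω, hw, h⟩
    exact ⟨θ, ω, hw, (mDissipative_rot_iff hd).2 h⟩
  · rintro ⟨θ, ω, hw, h⟩
    rw [← rot_toIcoMod] at h
    rw [← halfPlane_toIcoMod] at hw
    exact ⟨_, toIcoMod_mem θ, ω, hw, (mDissipative_rot_iff hd).1 h⟩

/-- A half plane avoids the numerical spectrum iff it is admissible. -/
theorem numericalSpectrum_subset_compl_halfPlane_iff {A : X →ₗ.[ℂ] X}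
    (hd : Dense (A.domain : Set X)) {θ ω : ℝ} :
    numericalSpectrum A ⊆ (halfPlane θ ω)ᶜ ↔ MDissipative (rot θ A) ω := by
  rw [numericalSpectrum, compl_subset_compl]
  constructor
  · intro h
    refine ⟨fun x y hxy f hf1 hf2 => ?_, fun μ hμ => ?_⟩
    -- The point f(y')/‖x‖ lies in the half plane, hence in some admissible half plane, possibly of
    -- another angle. Dissipativity at that angle, tested with the same f, excludes it.
    · by_contra! hlt
      have hx : x ≠ 0 := by
        rintro rfl
        have := LinearPMap.graph_fst_eq_zero_snd _ hxy rfl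
        simp [this] at hlt
      have hx0 : 0 < ‖x‖ := norm_pos_iff.2 hx
      have hxy' := mem_graph_rot.1 hxy
      set y' := Complex.exp (Complex.I * θ) • y with hy'
      have hy : y = Complex.exp (-(Complex.I * θ)) • y' := by
        rw [hy', smul_smul, ← Complex.exp_add, neg_add_cancel, Complex.exp_zero, one_smul]
      have e : ∀ φ : ℝ, (Complex.exp (-(Complex.I * φ)) * (((‖x‖⁻¹ : ℝ) : ℂ) * f y')).re =
          ‖x‖⁻¹ * (f (Complex.exp (-(Complex.I * φ)) • y')).re := fun φ => by
        rw [mul_left_comm, Complex.re_ofReal_mul, map_smul f _ y', smul_eq_mul]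
      have hw : ((‖x‖⁻¹ : ℝ) : ℂ) * f y' ∈ halfPlane θ ω := by
        rw [mem_halfPlane, e, ← hy, inv_mul_eq_div, lt_div_iff₀ hx0]
        exact hlt
      obtain ⟨θ', ω', hw', h'⟩ := (mem_numericalResolventSet_iff hd).1 (h hw)
      rw [mem_halfPlane, e, inv_mul_eq_div, lt_div_iff₀ hx0] at hw'
      exact hw'.not_ge (h'.1 _ _ (mem_graph_rot_of_mem hxy') f hf1 hf2)
    -- Membership in the resolvent set is a pointwise condition, so whichever admissible half plane
    -- contains e^{iθ}μ will do.
    · obtain ⟨θ', -, ω', hw, h', -⟩ := h (show Complex.exp (Complex.I * θ) * μ ∈ halfPlane θ ω by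
        rwa [mem_halfPlane, exp_neg_I_mul_cancel])
      obtain ⟨R, hR⟩ := h' hw
      have := isResolvent_rot θ hR
      rw [exp_neg_I_mul_cancel] at this
      exact ⟨_, this⟩
  · exact fun h w hw => (mem_numericalResolventSet_iff hd).2 ⟨θ, ω, hw, h⟩

theorem isClosed_numericalSpectrum {A : X →ₗ.[ℂ] X} (hd : Dense (A.domain : Set X)) :
    IsClosed (numericalSpectrum A) := by
  rw [numericalSpectrum, isClosed_compl_iff]
  have : numericalResolventSet A =
      ⋃ (p : ℝ × ℝ) (_ : MDissipative (rot p.1 A) p.2), halfPlane p.1 p.2 := by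
    ext w
    rw [mem_numericalResolventSet_iff hd]
    simp only [mem_iUnion, Prod.exists, exists_prop]
    exact exists_congr fun θ => exists_congr fun ω => and_comm
  rw [this]
  refine isOpen_biUnion fun p _ => ?_
  exact isOpen_lt continuous_const (Complex.continuous_re.comp (continuous_const.mul continuous_id))

end Basics

/-! ### Generators of semigroups and the necessity half of Hille-Yosida -/

section Semigroups

variable {X : Type*} [NormedAddCommGroup X] [NormedSpace ℂ X]

theorem map_coe_nhdsGT_zero : map ((↑) : ℝ≥0 → ℝ) (𝓝[>] 0) = 𝓝[>] (0 : ℝ) := by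
  have h : 𝓝[>] (0 : ℝ≥0) = comap ((↑) : ℝ≥0 → ℝ) (𝓝[>] (0 : ℝ)) := by
    rw [nhdsWithin, nhdsWithin, comap_inf, comap_principal, ← NNReal.coe_zero,
      ← NNReal.isEmbedding_coe.nhds_eq_comap]
    rfl
  rw [h, map_comap_of_mem]
  filter_upwards [self_mem_nhdsWithin] with t ht
  exact ⟨⟨t, le_of_lt ht⟩, rfl⟩

theorem tendsto_nhdsGT_coe_iff {α : Type*} {g : ℝ → α} {l : Filter α} :
    Tendsto (fun t : ℝ≥0 => g t) (𝓝[>] 0) l ↔ Tendsto g (𝓝[>] (0 : ℝ)) l := by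
  rw [← map_coe_nhdsGT_zero, tendsto_map'_iff]; rfl

theorem tendsto_slope_nnreal_iff {u : ℝ → X} {y : X} :
    Tendsto (fun t : ℝ≥0 => (((t : ℝ) : ℂ)⁻¹) • (u t - u 0)) (𝓝[>] 0) (𝓝 y) ↔
      HasDerivWithinAt u y (Ioi 0) 0 := by
  rw [hasDerivWithinAt_iff_tendsto_slope' self_notMem_Ioi,
    tendsto_nhdsGT_coe_iff (g := fun t : ℝ => ((t : ℂ)⁻¹) • (u t - u 0))]
  refine tendsto_congr fun t => ?_
  rw [slope_def_module, sub_zero, ← Complex.ofReal_inv, Complex.coe_smul]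

/-- Extending orbits to ℝ by t ↦ T(t⁺)x turns the generator into a right derivative at 0, for which
real calculus is available. -/
theorem isGenerator_iff {A : X →ₗ.[ℂ] X} {T : ℝ≥0 → X →L[ℂ] X}
    (h0 : T 0 = ContinuousLinearMap.id ℂ X) : IsGenerator A T ↔ ∀ x y, (x, y) ∈ A.graph ↔
      HasDerivWithinAt (fun t : ℝ => T t.toNNReal x) y (Ioi 0) 0 := by
  refine forall_congr' fun x => forall_congr' fun y => iff_congr Iff.rfl ?_
  rw [← tendsto_slope_nnreal_iff]
  refine tendsto_congr fun t => ?_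
  simp [h0]

theorem IsC0Semigroup.apply_add {T : ℝ≥0 → X →L[ℂ] X} (hT : IsC0Semigroup T) (s t : ℝ≥0) (x : X) :
    T (s + t) x = T s (T t x) := by
  rw [hT.map_add]; rfl

theorem IsC0Semigroup.apply_comm {T : ℝ≥0 → X →L[ℂ] X} (hT : IsC0Semigroup T) (s t : ℝ≥0) (x : X) :
    T s (T t x) = T t (T s x) := by
  rw [← hT.apply_add, ← hT.apply_add, add_comm]

theorem IsC0Semigroup.continuous_real {T : ℝ≥0 → X →L[ℂ] X} (hT : IsC0Semigroup T) (x : X) :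
    Continuous fun t : ℝ => T t.toNNReal x :=
  (hT.continuous_orbit x).comp continuous_real_toNNReal

/-- For s ≥ t, the law T(s) = T(t)T(s − t) transports the right derivative from 0 to t. -/
theorem IsC0Semigroup.hasDerivWithinAt {T : ℝ≥0 → X →L[ℂ] X} (hT : IsC0Semigroup T) {x y : X}
    (h : HasDerivWithinAt (fun t : ℝ => T t.toNNReal x) y (Ioi 0) 0) {t : ℝ} (ht : 0 ≤ t) :
    HasDerivWithinAt (fun t : ℝ => T t.toNNReal x) (T t.toNNReal y) (Ioi t) t := by
  have h1 : HasDerivWithinAt (fun s : ℝ => T (s - t).toNNReal x) y (Ioi t) t := by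
    have := HasDerivWithinAt.scomp (h := fun s : ℝ => s - t) (h' := 1) (s := Ioi t) (t' := Ioi 0)
      (g₁ := fun s : ℝ => T s.toNNReal x) (g₁' := y) t (by simpa using h)
      ((hasDerivAt_id t).sub_const t).hasDerivWithinAt (fun s hs => mem_Ioi.2 (sub_pos.2 (mem_Ioi.1 hs)))
    rw [one_smul] at this
    exact this
  have h2 := ((T t.toNNReal).restrictScalars ℝ).hasFDerivAt.comp_hasDerivWithinAt t h1
  refine h2.congr (fun s hs => ?_) ?_
  · have hs' : t < s := hs
    change _ = T t.toNNReal (T (s - t).toNNReal x)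
    rw [← hT.apply_add, ← Real.toNNReal_add ht (by linarith), add_sub_cancel]
  · change _ = T t.toNNReal (T (t - t).toNNReal x)
    simp [hT.map_zero]

/-- A continuous orbit with a continuous right derivative is the integral of that derivative, hence
differentiable from both sides. -/
theorem IsC0Semigroup.hasDerivAt [CompleteSpace X] {T : ℝ≥0 → X →L[ℂ] X} (hT : IsC0Semigroup T)
    {x y : X} (h : HasDerivWithinAt (fun t : ℝ => T t.toNNReal x) y (Ioi 0) 0) {t : ℝ}
    (ht : 0 < t) : HasDerivAt (fun t : ℝ => T t.toNNReal x) (T t.toNNReal y) t := by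
  have h1 : ∀ s : ℝ, 0 ≤ s → T s.toNNReal x = x + ∫ r in (0 : ℝ)..s, T r.toNNReal y := by
    intro s hs
    rw [intervalIntegral.integral_eq_sub_of_hasDeriv_right (hT.continuous_real x).continuousOn
      (fun r hr => hT.hasDerivWithinAt h ?_) ((hT.continuous_real y).intervalIntegrable _ _)]
    · simp [hT.map_zero]
    · rw [min_eq_left hs] at hr
      exact hr.1.le
  have h2 := ((hT.continuous_real y).integral_hasStrictDerivAt 0 t).hasDerivAt.const_add x
  refine h2.congr_of_eventuallyEq ?_
  filter_upwards [lt_mem_nhds ht] with s hs using h1 s hs.le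

theorem IsC0Semigroup.mem_graph {A : X →ₗ.[ℂ] X} {T : ℝ≥0 → X →L[ℂ] X} (hT : IsC0Semigroup T)
    (hA : IsGenerator A T) {x y : X} (h : (x, y) ∈ A.graph) (t : ℝ≥0) :
    (T t x, T t y) ∈ A.graph := by
  rw [isGenerator_iff hT.map_zero] at hA
  rw [hA] at h ⊢
  have h2 := ((T t).restrictScalars ℝ).hasFDerivAt.comp_hasDerivWithinAt 0 h
  refine h2.congr (fun s _ => hT.apply_comm _ _ _) (hT.apply_comm _ _ _)

/-- The growth bound of a semigroup bounds the numerical range of its generator. -/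
theorem re_le_of_hasDerivWithinAt {T : ℝ≥0 → X →L[ℂ] X} {ω : ℝ}
    (h0 : T 0 = ContinuousLinearMap.id ℂ X) (hω : ∀ t : ℝ≥0, ‖T t‖ ≤ Real.exp (ω * t)) {x y : X}
    (h : HasDerivWithinAt (fun t : ℝ => T t.toNNReal x) y (Ioi 0) 0) {f : X →L[ℂ] ℂ}
    (hf1 : ‖f‖ ≤ 1) (hf2 : f x = ‖x‖) : (f y).re ≤ ω * ‖x‖ := by
  have h1 := ((Complex.reCLM.comp (f.restrictScalars ℝ))).hasFDerivAt.comp_hasDerivWithinAt 0 h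
  have h2 : HasDerivWithinAt (fun t : ℝ => Real.exp (ω * t) * ‖x‖) (ω * ‖x‖) (Ioi 0) 0 := by
    have := (((hasDerivAt_id (0 : ℝ)).const_mul ω).exp.mul_const ‖x‖).hasDerivWithinAt (s := Ioi 0)
    simpa using this
  rw [hasDerivWithinAt_iff_tendsto_slope' self_notMem_Ioi] at h1 h2
  refine le_of_tendsto_of_tendsto h1 h2 ?_
  filter_upwards [self_mem_nhdsWithin] with t ht
  have ht' : (0 : ℝ) < t := ht
  rw [slope_def_field, slope_def_field]
  have e : (f (T t.toNNReal x)).re ≤ Real.exp (ω * t) * ‖x‖ := by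
    refine (Complex.re_le_norm _).trans ?_
    have := f.le_of_opNorm_le_of_le hf1 ((T t.toNNReal).le_of_opNorm_le (hω _) x)
    rwa [one_mul, Real.coe_toNNReal _ ht'.le] at this
  have : (f (T (0 : ℝ).toNNReal x)).re = ‖x‖ := by simp [h0, hf2]
  change ((f (T t.toNNReal x)).re - (f (T (0 : ℝ).toNNReal x)).re) / _ ≤ _
  rw [this]
  simp only [mul_zero, Real.exp_zero, one_mul]
  gcongr

/-- An operator contained in the generator of a semigroup is the generator if its resolvent set
meets the half plane of the growth bound. -/
theorem isGenerator_of_forall_mem_graph {B : X →ₗ.[ℂ] X} {T : ℝ≥0 → X →L[ℂ] X} {ω : ℝ}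
    (h0 : T 0 = ContinuousLinearMap.id ℂ X) (hω : ∀ t : ℝ≥0, ‖T t‖ ≤ Real.exp (ω * t))
    (h : ∀ x y, (x, y) ∈ B.graph → HasDerivWithinAt (fun t : ℝ => T t.toNNReal x) y (Ioi 0) 0)
    {μ : ℂ} (hμ : ω < μ.re) {R : X →L[ℂ] X} (hR : IsResolvent B μ R) : IsGenerator B T := by
  rw [isGenerator_iff h0]
  refine fun x y => ⟨h x y, fun hxy => ?_⟩
  have hR1 := (isResolvent_iff.1 hR).1 (μ • x - y)
  set x' := R (μ • x - y) with hx'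
  have h1 := hxy.sub (h _ _ hR1)
  have e : y - (μ • x' - (μ • x - y)) = μ • (x - x') := by module
  -- The difference x − x' is an eigenvector of the generator of T for the eigenvalue μ. As Re μ
  -- exceeds the growth bound ω, it must vanish.
  rw [e] at h1
  have h2 : HasDerivWithinAt (fun t : ℝ => T t.toNNReal (x - x')) (μ • (x - x')) (Ioi 0) 0 := by
    refine h1.congr (fun s _ => ?_) ?_ <;> simp
  obtain ⟨f, hf1, hf2⟩ := exists_dual_vector'' ℂ (x - x')
  have h3 := re_le_of_hasDerivWithinAt h0 hω h2 hf1 hf2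
  rw [map_smul, hf2] at h3
  simp at h3
  have h4 : ‖x - x'‖ = 0 := by
    by_contra hne
    have : 0 < ‖x - x'‖ := lt_of_le_of_ne (norm_nonneg _) (Ne.symm hne)
    nlinarith
  have h5 : x = x' := sub_eq_zero.1 (norm_eq_zero.1 h4)
  rw [← h5] at hR1
  simpa using hR1

/-- The lower bound makes preimages unique, so the chosen ones depend linearly on the point, and it
bounds the inverse by `c⁻¹`. -/
theorem exists_isResolvent_of_surjective {B : X →ₗ.[ℂ] X} {μ : ℂ} {c : ℝ} (hc : 0 < c)
    (h1 : ∀ x y, (x, y) ∈ B.graph → c * ‖x‖ ≤ ‖μ • x - y‖)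
    (h2 : ∀ z, ∃ x y, (x, y) ∈ B.graph ∧ μ • x - y = z) : ∃ R, IsResolvent B μ R := by
  have hinj : ∀ x y x' y', (x, y) ∈ B.graph → (x', y') ∈ B.graph → μ • x - y = μ • x' - y' →
      x = x' := by
    intro x y x' y' h h' e
    have := h1 (x - x') (y - y') (B.graph.sub_mem h h')
    rw [show μ • (x - x') - (y - y') = (μ • x - y) - (μ • x' - y') by module, e, sub_self,
      norm_zero] at this
    have h3 : ‖x - x'‖ ≤ 0 := by
      by_contra! hlt
      nlinarith
    exact sub_eq_zero.1 (norm_le_zero_iff.1 h3)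
  choose r s hrs hr using h2
  let L : X →ₗ[ℂ] X :=
    { toFun := r
      map_add' := fun x y => hinj _ _ _ _ (hrs _) (B.graph.add_mem (hrs x) (hrs y)) (by
        rw [hr]
        nth_rw 1 [← hr x, ← hr y]
        simp only
        module)
      map_smul' := fun a x => hinj _ _ _ _ (hrs _) (B.graph.smul_mem a (hrs x)) (by
        rw [hr]
        nth_rw 1 [← hr x]
        simp only [RingHom.id_apply]
        module) }
  refine ⟨L.mkContinuous c⁻¹ fun x => ?_, isResolvent_iff.2 ⟨fun x => ?_, fun x y hxy => ?_⟩⟩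
  · have := h1 _ _ (hrs x)
    rw [hr] at this
    rw [inv_mul_eq_div, le_div_iff₀ hc, mul_comm]
    exact this
  · change (r x, μ • r x - x) ∈ B.graph
    have e : μ • r x - x = s x := by
      nth_rw 2 [← hr x]
      abel
    rw [e]
    exact hrs x
  · exact hinj _ _ _ _ (hrs _) hxy (hr _)

/-- On the complete graph the map (x, y) ↦ μx − y is bounded below: it controls x by hypothesis and
then y = μx − (μx − y). The constant `K` adds the two bounds. -/
theorem isClosed_range_smul_sub [CompleteSpace X] {B : X →ₗ.[ℂ] X} (hB : B.IsClosed) {μ : ℂ}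
    {c : ℝ} (hc : 0 < c) (h1 : ∀ x y, (x, y) ∈ B.graph → c * ‖x‖ ≤ ‖μ • x - y‖) :
    IsClosed {z | ∃ x y, (x, y) ∈ B.graph ∧ μ • x - y = z} := by
  have : CompleteSpace B.graph := hB.completeSpace_coe
  let g : B.graph →L[ℂ] X :=
    (μ • ContinuousLinearMap.fst ℂ X X - ContinuousLinearMap.snd ℂ X X).comp B.graph.subtypeL
  have hg : ∀ p : B.graph, g p = μ • (p : X × X).1 - (p : X × X).2 := fun p => rfl
  let K : ℝ≥0 := ⟨c⁻¹ + (‖μ‖ * c⁻¹ + 1), by positivity⟩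
  have hK : AntilipschitzWith K g := by
    refine ContinuousLinearMap.antilipschitz_of_bound g fun p => ?_
    have h2 := h1 _ _ p.2
    rw [← hg] at h2
    have h3 : ‖(p : X × X).1‖ ≤ c⁻¹ * ‖g p‖ := by
      rw [inv_mul_eq_div, le_div_iff₀ hc, mul_comm]; exact h2
    have h4 : ‖(p : X × X).2‖ ≤ ‖μ‖ * ‖(p : X × X).1‖ + ‖g p‖ := by
      have : (p : X × X).2 = μ • (p : X × X).1 - g p := by rw [hg]; abel
      nth_rw 1 [this]
      rw [← norm_smul]
      exact norm_sub_le _ _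
    have h5 : 0 ≤ ‖g p‖ := norm_nonneg _
    have h6 : ‖(p : X × X).2‖ ≤ (‖μ‖ * c⁻¹ + 1) * ‖g p‖ := by
      refine h4.trans ?_
      rw [add_mul, one_mul, mul_assoc]
      gcongr
    have h7 : 0 ≤ c⁻¹ * ‖g p‖ := by positivity
    have h8 : 0 ≤ (‖μ‖ * c⁻¹ + 1) * ‖g p‖ := by positivity
    change ‖(p : X × X)‖ ≤ (c⁻¹ + (‖μ‖ * c⁻¹ + 1)) * ‖g p‖
    rw [Prod.norm_def, add_mul]
    exact max_le (by linarith) (by linarith)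
  have := hK.isClosed_range g.uniformContinuous
  convert this using 1
  ext z
  simp only [mem_ofPred_eq, mem_range, Subtype.exists, Prod.exists, hg, exists_prop]

/-- The easy half of the Hille-Yosida theorem. -/
theorem GeneratesContractive.mDissipative [CompleteSpace X] {A : X →ₗ.[ℂ] X} (hA : A.IsClosed)
    (hd : Dense (A.domain : Set X)) {ω : ℝ} (h : GeneratesContractive A ω) : MDissipative A ω := by
  obtain ⟨T, hT, hG, hω⟩ := h
  have hG' := (isGenerator_iff hT.map_zero).1 hG
  have hdiss : ∀ x y, (x, y) ∈ A.graph → ∀ f : X →L[ℂ] ℂ, ‖f‖ ≤ 1 → f x = ‖x‖ →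
      (f y).re ≤ ω * ‖x‖ := fun x y hxy f hf1 hf2 =>
    re_le_of_hasDerivWithinAt hT.map_zero hω ((hG' x y).1 hxy) hf1 hf2
  refine ⟨hdiss, fun μ hμ => ?_⟩
  have hc : 0 < μ.re - ω := sub_pos.2 hμ
  have hbd : ∀ x y, (x, y) ∈ A.graph → (μ.re - ω) * ‖x‖ ≤ ‖μ • x - y‖ := by
    intro x y hxy
    obtain ⟨f, hf1, hf2⟩ := exists_dual_vector'' ℂ x
    have h1 := hdiss x y hxy f hf1 hf2
    have h2 : (f (μ • x - y)).re ≤ ‖μ • x - y‖ :=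
      (Complex.re_le_norm _).trans
        ((f.le_opNorm _).trans (mul_le_of_le_one_left (norm_nonneg _) hf1))
    rw [map_sub, map_smul, hf2] at h2
    simp at h2
    linarith
  refine exists_isResolvent_of_surjective hc hbd ?_
  let M : Submodule ℂ X := A.graph.map (μ • LinearMap.fst ℂ X X - LinearMap.snd ℂ X X)
  have hM : ∀ z, z ∈ M ↔ ∃ x y, (x, y) ∈ A.graph ∧ μ • x - y = z := fun z => by
    simp only [M, Submodule.mem_map, Prod.exists]
    rfl
  have hMc : IsClosed (M : Set X) := by
    convert isClosed_range_smul_sub hA hc hbd using 1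
    ext z
    exact hM z
  intro z
  rw [← hM]
  by_contra hz
  -- If the closed range of μ − A misses z, a functional f separates them. It vanishes on the range,
  -- because a multiple of any m with f(m) ≠ 0 would take the forbidden value u.
  obtain ⟨f, u, hfz, hfM⟩ := RCLike.geometric_hahn_banach_point_closed (𝕜 := ℂ)
    (M.restrictScalars ℝ).convex hMc hz
  have hf0 : ∀ m ∈ M, f m = 0 := by
    intro m hm
    by_contra hne
    have := hfM _ (M.smul_mem ((u : ℂ) * (f m)⁻¹) hm)
    rw [map_smul, smul_eq_mul, mul_assoc, inv_mul_cancel₀ hne, mul_one] at this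
    simp at this
  -- Since f(T(s)Ax) = μ f(T(s)x), the function e^{-μs}f(T(s)x) is constant. It is also dominated by
  -- e^{-(Re μ − ω)s}, which tends to 0. So f vanishes on the domain, and by density everywhere.
  have hzero : ∀ x y, (x, y) ∈ A.graph → f x = 0 := by
    intro x y hxy
    have hconst : ∀ t : ℝ, 0 ≤ t → Complex.exp (-μ * t) * f (T t.toNNReal x) = f x := by
      intro t ht
      have hder : ∀ s ∈ Ico 0 t, HasDerivWithinAt
          (fun s : ℝ => Complex.exp (-μ * s) * f (T s.toNNReal x)) 0 (Ici s) s := by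
        intro s hs
        have d1 : HasDerivWithinAt (fun s : ℝ => f (T s.toNNReal x)) (f (T s.toNNReal y))
            (Ioi s) s := (f.restrictScalars ℝ).hasFDerivAt.comp_hasDerivWithinAt s
              (hT.hasDerivWithinAt ((hG' x y).1 hxy) hs.1)
        have d2 : HasDerivAt (fun s : ℝ => Complex.exp (-μ * s)) (Complex.exp (-μ * s) * -μ) s := by
          have := ((hasDerivAt_id (s : ℂ)).const_mul (-μ)).cexp.comp_ofReal
          simpa using this
        have d3 := d2.hasDerivWithinAt.mul d1
        rw [hasDerivWithinAt_Ioi_iff_Ici] at d3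
        refine d3.congr_deriv ?_
        have := hf0 _ ((hM _).2 ⟨_, _, hT.mem_graph hG hxy s.toNNReal, rfl⟩)
        rw [map_sub, map_smul, smul_eq_mul, sub_eq_zero] at this
        rw [← this]
        ring
      have hcont : Continuous fun s : ℝ => Complex.exp (-μ * s) * f (T s.toNNReal x) :=
        (by fun_prop : Continuous fun s : ℝ => Complex.exp (-μ * s)).mul
          (f.continuous.comp (hT.continuous_real x))
      rw [constant_of_has_deriv_right_zero hcont.continuousOn hder t ⟨ht, le_rfl⟩]
      simp [hT.map_zero]
    have hbound : ∀ t : ℝ, 0 ≤ t →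
        ‖f x‖ ≤ Real.exp (-((μ.re - ω) * t)) * (‖f‖ * ‖x‖) := by
      intro t ht
      rw [← hconst t ht, norm_mul, Complex.norm_exp]
      have h1 : ‖f (T t.toNNReal x)‖ ≤ ‖f‖ * (Real.exp (ω * t) * ‖x‖) := by
        have := f.le_opNorm_of_le ((T t.toNNReal).le_of_opNorm_le (hω _) x)
        rwa [Real.coe_toNNReal _ ht] at this
      calc _ ≤ Real.exp ((-μ * t).re) * (‖f‖ * (Real.exp (ω * t) * ‖x‖)) := by gcongr
        _ = (Real.exp ((-μ * t).re) * Real.exp (ω * t)) * (‖f‖ * ‖x‖) := by ring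
        _ = _ := by
          rw [← Real.exp_add]
          congr 2
          simp
          ring
    have hlim : Tendsto (fun t : ℝ => Real.exp (-((μ.re - ω) * t)) * (‖f‖ * ‖x‖)) atTop (𝓝 0) := by
      have := (Real.tendsto_exp_neg_atTop_nhds_zero.comp
        (tendsto_id.const_mul_atTop hc)).mul_const (‖f‖ * ‖x‖)
      simpa using this
    refine norm_le_zero_iff.1 (ge_of_tendsto hlim ?_)
    filter_upwards [eventually_ge_atTop 0] with t ht using hbound t ht
  have hfz0 : f z = 0 := by
    have : (f : X → ℂ) = 0 := by
      refine Continuous.ext_on hd f.continuous continuous_zero fun x hx => ?_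
      obtain ⟨y, hy⟩ := LinearPMap.mem_domain_iff.1 hx
      exact hzero x y hy
    exact congrFun this z
  have := hfM 0 M.zero_mem
  rw [hfz0] at hfz
  simp at this hfz
  linarith

end Semigroups

/-! ### Yosida approximation and the generation of contraction semigroups -/

section HilleYosida

variable {X : Type*} [NormedAddCommGroup X] [NormedSpace ℂ X]

/-- The identity has norm 0 on the trivial space, so the case n = 0 relies on the inequality ‖1‖ ≤ 1
only. -/
theorem norm_pow_clm_le (P : X →L[ℂ] X) (n : ℕ) : ‖P ^ n‖ ≤ ‖P‖ ^ n := by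
  induction n with
  | zero =>
    rw [pow_zero, pow_zero]
    exact ContinuousLinearMap.norm_id_le (𝕜 := ℂ) (E := X)
  | succ n ih =>
    rw [pow_succ, pow_succ]
    exact (norm_mul_le _ _).trans (by gcongr)

/-- Strong convergence on a dense subset for uniformly bounded operators. -/
theorem cauchySeq_of_dense {E : ℕ → X →L[ℂ] X} {C : ℝ} (hC : ∀ n, ‖E n‖ ≤ C) {D : Set X}
    (hD : Dense D) (h : ∀ x ∈ D, CauchySeq fun n => E n x) (x : X) : CauchySeq fun n => E n x := by
  have hC0 : 0 ≤ C := (norm_nonneg _).trans (hC 0)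
  rw [Metric.cauchySeq_iff]
  intro ε hε
  have hε' : 0 < ε / (2 * C + 1) := by positivity
  obtain ⟨x', hx', hxx'⟩ := Metric.mem_closure_iff.1 (hD x) _ hε'
  obtain ⟨N, hN⟩ := Metric.cauchySeq_iff.1 (h x' hx') _ hε'
  refine ⟨N, fun m hm n hn => ?_⟩
  have h1 := hN m hm n hn
  rw [dist_eq_norm] at h1 hxx' ⊢
  have e : E m x - E n x = E m (x - x') + (E m x' - E n x') - E n (x - x') := by
    simp only [map_sub]; abel
  rw [e]
  calc _ ≤ ‖E m (x - x')‖ + ‖E m x' - E n x'‖ + ‖E n (x - x')‖ :=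
        (norm_sub_le _ _).trans (by gcongr; exact norm_add_le _ _)
    _ ≤ C * ‖x - x'‖ + ‖E m x' - E n x'‖ + C * ‖x - x'‖ := by
        gcongr
        · exact (E m).le_of_opNorm_le (hC m) _
        · exact (E n).le_of_opNorm_le (hC n) _
    _ < C * (ε / (2 * C + 1)) + ε / (2 * C + 1) + C * (ε / (2 * C + 1)) := by
        have : C * ‖x - x'‖ ≤ C * (ε / (2 * C + 1)) := by gcongr
        linarith
    _ = ε := by field_simp; ring

/-- Orbits that are continuous on a dense set are continuous, for contractions. -/
theorem continuous_orbit_of_dense {α : Type*} [TopologicalSpace α] {T : α → X →L[ℂ] X}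
    (hT : ∀ t, ‖T t‖ ≤ 1) {D : Set X} (hD : Dense D) (h : ∀ x ∈ D, Continuous fun t => T t x)
    (x : X) : Continuous fun t => T t x := by
  refine continuous_iff_continuousAt.2 fun t₀ => ?_
  refine Metric.tendsto_nhds.2 fun ε hε => ?_
  obtain ⟨x', hx', hxx'⟩ := Metric.mem_closure_iff.1 (hD x) (ε / 3) (by positivity)
  have h1 := Metric.tendsto_nhds.1 ((h x' hx').tendsto t₀) (ε / 3) (by positivity)
  filter_upwards [h1] with t ht
  have hb : ∀ s, dist (T s x) (T s x') < ε / 3 := fun s => by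
    rw [dist_eq_norm, ← map_sub]
    refine lt_of_le_of_lt ?_ hxx'
    have := (T s).le_of_opNorm_le (hT s) (x - x')
    rwa [one_mul, ← dist_eq_norm x] at this
  calc dist (T t x) (T t₀ x) ≤ dist (T t x) (T t x') + dist (T t x') (T t₀ x') +
        dist (T t₀ x') (T t₀ x) := dist_triangle4 _ _ _ _
    _ < ε / 3 + ε / 3 + ε / 3 := by
        have := hb t₀
        rw [dist_comm] at this
        gcongr
        exact hb t
    _ = ε := by ring

variable [CompleteSpace X]

theorem norm_exp_clm_le (P : X →L[ℂ] X) : ‖NormedSpace.exp P‖ ≤ Real.exp ‖P‖ := by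
  have h1 := NormedSpace.exp_series_hasSum_exp' (𝕂 := ℝ) P
  have h2 := NormedSpace.exp_series_hasSum_exp' (𝕂 := ℝ) (‖P‖ : ℝ)
  rw [← Real.exp_eq_exp_ℝ] at h2
  refine h1.norm_le_of_bounded h2 fun n => ?_
  rw [norm_smul, smul_eq_mul, Real.norm_of_nonneg (by positivity)]
  gcongr
  exact norm_pow_clm_le P n

theorem clm_exp_add {P Q : X →L[ℂ] X} (h : Commute P Q) :
    NormedSpace.exp (P + Q) = NormedSpace.exp P * NormedSpace.exp Q := by
  let _ : NormedAlgebra ℚ (X →L[ℂ] X) := NormedAlgebra.restrictScalars ℚ ℝ _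
  exact NormedSpace.exp_add_of_commute h

/-- Split e^{tl(J−1)} = e^{-tl}e^{tlJ}; the second factor has norm at most e^{tl}. With J = λR(λ)
this makes the Yosida approximants generate contractions. -/
theorem norm_exp_smul_sub_one_le {J : X →L[ℂ] X} (hJ : ‖J‖ ≤ 1) {l t : ℝ} (hl : 0 ≤ l)
    (ht : 0 ≤ t) : ‖NormedSpace.exp (t • l • (J - 1))‖ ≤ 1 := by
  have e : t • l • (J - 1) = (t * l) • J + algebraMap ℝ (X →L[ℂ] X) (-(t * l)) := by
    rw [Algebra.algebraMap_eq_smul_one]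
    module
  rw [e, clm_exp_add (Algebra.commute_algebraMap_right _ _), ← NormedSpace.algebraMap_exp_comm,
    ← Real.exp_eq_exp_ℝ, Algebra.algebraMap_eq_smul_one, mul_smul_comm, mul_one, norm_smul,
    Real.norm_of_nonneg (Real.exp_pos _).le]
  have h0 : 0 ≤ t * l := by positivity
  calc _ ≤ Real.exp (-(t * l)) * Real.exp ‖(t * l) • J‖ := by gcongr; exact norm_exp_clm_le _
    _ ≤ Real.exp (-(t * l)) * Real.exp (t * l) := by
      gcongr
      rw [norm_smul, Real.norm_of_nonneg h0]
      exact mul_le_of_le_one_right h0 hJ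
    _ = 1 := by rw [← Real.exp_add]; simp

theorem hasDerivAt_exp_smul_apply (P : X →L[ℂ] X) (x : X) (t : ℝ) :
    HasDerivAt (fun s : ℝ => NormedSpace.exp (s • P) x) (NormedSpace.exp (t • P) (P x)) t := by
  have := hasDerivAt_exp_smul_const (𝕂 := ℝ) P t
  exact ((ContinuousLinearMap.apply ℂ X x).restrictScalars ℝ).hasFDerivAt.comp_hasDerivAt t this

/-- Differentiate e^{tQ}e^{s(P−Q)}x in s over [0, t]. By commutation the operator e^{tQ}e^{s(P−Q)}
equals e^{(t−s)Q}e^{sP}, a product of contractions, so the derivative is at most ‖Px − Qx‖. -/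
theorem norm_exp_sub_exp_apply_le {P Q : X →L[ℂ] X} (h : Commute P Q)
    (hP : ∀ t : ℝ, 0 ≤ t → ‖NormedSpace.exp (t • P)‖ ≤ 1)
    (hQ : ∀ t : ℝ, 0 ≤ t → ‖NormedSpace.exp (t • Q)‖ ≤ 1) (x : X) {t : ℝ} (ht : 0 ≤ t) :
    ‖NormedSpace.exp (t • P) x - NormedSpace.exp (t • Q) x‖ ≤ t * ‖P x - Q x‖ := by
  have hD : Commute Q (P - Q) := h.symm.sub_right (Commute.refl Q)
  have key : ∀ s : ℝ, NormedSpace.exp (t • Q) * NormedSpace.exp (s • (P - Q)) =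
      NormedSpace.exp ((t - s) • Q) * NormedSpace.exp (s • P) := fun s => by
    rw [← clm_exp_add ((hD.smul_left t).smul_right s),
      ← clm_exp_add ((h.symm.smul_left (t - s)).smul_right s)]
    congr 1
    module
  have hder : ∀ s ∈ Icc 0 t, HasDerivWithinAt
      (fun s : ℝ => NormedSpace.exp (t • Q) (NormedSpace.exp (s • (P - Q)) x))
      (NormedSpace.exp (t • Q) (NormedSpace.exp (s • (P - Q)) ((P - Q) x))) (Icc 0 t) s :=
    fun s _ => (((NormedSpace.exp (t • Q)).restrictScalars ℝ).hasFDerivAt.comp_hasDerivAt s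
      (hasDerivAt_exp_smul_apply (P - Q) x s)).hasDerivWithinAt
  have := norm_image_sub_le_of_norm_deriv_le_segment' hder (C := ‖P x - Q x‖) (fun s hs => ?_) t
    ⟨ht, le_rfl⟩
  · have e0 : NormedSpace.exp (t • Q) (NormedSpace.exp (t • (P - Q)) x) =
        NormedSpace.exp (t • P) x := by
      have := congrArg (fun L : X →L[ℂ] X => L x) (key t)
      simpa using this
    rw [e0] at this
    simpa [mul_comm] using this
  · have := congrArg (fun L : X →L[ℂ] X => L ((P - Q) x)) (key s)
    simp only [mul_apply_eq_comp] at this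
    rw [this]
    have h1 := (NormedSpace.exp ((t - s) • Q)).le_of_opNorm_le_of_le (hQ _ (sub_nonneg.2 hs.2.le))
      ((NormedSpace.exp (s • P)).le_of_opNorm_le (hP _ hs.1) ((P - Q) x))
    simpa using h1

/-- The Hille-Yosida theorem for contraction semigroups. The semigroup commutes with every
operator that commutes with the resolvents. -/
theorem hille_yosida {B : X →ₗ.[ℂ] X} (hd : Dense (B.domain : Set X)) (h : MDissipative B 0) :
    ∃ T : ℝ≥0 → X →L[ℂ] X, IsC0Semigroup T ∧ IsGenerator B T ∧ (∀ t, ‖T t‖ ≤ 1) ∧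
      ∀ Q : X →L[ℂ] X, (∀ (μ : ℂ) (R : X →L[ℂ] X), 0 < μ.re → IsResolvent B μ R → Commute Q R) →
        ∀ t, Commute Q (T t) := by
  have hl : ∀ n : ℕ, (0 : ℝ) < (((n + 1 : ℝ) : ℝ) : ℂ).re := fun n => by
    rw [Complex.ofReal_re]; positivity
  choose R hR using fun n : ℕ => h.2 _ (hl n)
  have hRn : ∀ n, ‖R n‖ ≤ 1 / (n + 1) := fun n => by
    have := h.norm_le (hl n) (hR n)
    rwa [Complex.ofReal_re, sub_zero] at this
  have hJ : ∀ n : ℕ, ‖((n + 1 : ℝ) : ℂ) • R n‖ ≤ 1 := fun n => by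
    have hn : (0 : ℝ) < n + 1 := by positivity
    rw [norm_smul, Complex.norm_of_nonneg hn.le]
    calc ((n : ℝ) + 1) * ‖R n‖ ≤ (n + 1) * (1 / (n + 1)) := by gcongr; exact hRn n
      _ = 1 := by field_simp
  have hJlim := tendsto_smul_resolvent hd hR hJ
    (squeeze_zero (fun _ => norm_nonneg _) hRn tendsto_one_div_add_atTop_nhds_zero_nat)
  -- With λ = n + 1, the bounded operator λ(λR_n − 1) acts on the domain as λR_n B. Since λR_n → 1
  -- strongly, it converges to B there.
  set Y : ℕ → X →L[ℂ] X := fun n => (n + 1 : ℝ) • (((n + 1 : ℝ) : ℂ) • R n - 1) with hY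
  have hcomm : ∀ m n, Commute (Y m) (Y n) := fun m n =>
    ((((((hR m).commute (hR n)).smul_left _).smul_right _).sub_left
      (Commute.one_left _)).sub_right (Commute.one_right _)).smul_left _ |>.smul_right _
  have hYx : ∀ x y, (x, y) ∈ B.graph → Tendsto (fun n => Y n x) atTop (𝓝 y) := by
    intro x y hxy
    refine (hJlim y).congr fun n => ?_
    have e := (isResolvent_iff.1 (hR n)).2 _ _ hxy
    rw [map_sub, map_smul, sub_eq_iff_eq_add', ← sub_eq_iff_eq_add] at e
    simp only [hY, FunLike.coe_smul, Pi.smul_apply, FunLike.coe_sub, Pi.sub_apply,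
      one_apply_eq_self]
    rw [← e, Complex.coe_smul]
  set E : ℕ → ℝ → X →L[ℂ] X := fun n t => NormedSpace.exp (t • Y n) with hE
  have hE1 : ∀ n t, 0 ≤ t → ‖E n t‖ ≤ 1 := fun n t ht =>
    norm_exp_smul_sub_one_le (hJ n) (by positivity) ht
  have hEsub : ∀ m n t x, 0 ≤ t → ‖E m t x - E n t x‖ ≤ t * ‖Y m x - Y n x‖ :=
    fun m n t x ht => norm_exp_sub_exp_apply_le (hcomm m n) (hE1 m) (hE1 n) x ht
  have hcau : ∀ (t : ℝ≥0) x, CauchySeq fun n => E n t x := by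
    intro t
    refine cauchySeq_of_dense (fun n => hE1 n t t.2) hd fun x hx => ?_
    obtain ⟨y, hy⟩ := LinearPMap.mem_domain_iff.1 hx
    have h1 := (hYx x y hy).cauchySeq
    rw [Metric.cauchySeq_iff] at h1 ⊢
    intro ε hε
    obtain ⟨N, hN⟩ := h1 (ε / (t + 1)) (by positivity)
    refine ⟨N, fun m hm n hn => ?_⟩
    have h2 := hN m hm n hn
    rw [dist_eq_norm] at h2 ⊢
    refine (hEsub m n t x t.2).trans_lt ?_
    rw [lt_div_iff₀ (by positivity)] at h2
    nlinarith [norm_nonneg (Y m x - Y n x)]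
  choose F hF using fun (t : ℝ≥0) (x : X) => cauchySeq_tendsto_of_complete (hcau t x)
  let T : ℝ≥0 → X →L[ℂ] X := fun t =>
    continuousLinearMapOfTendsto (fun n => E n t) (tendsto_pi_nhds.2 (hF t))
  have hT : ∀ (t : ℝ≥0) x, Tendsto (fun n => E n t x) atTop (𝓝 (T t x)) := hF
  have hT1 : ∀ t, ‖T t‖ ≤ 1 := fun t =>
    (T t).opNorm_le_bound zero_le_one fun x => le_of_tendsto' (hT t x).norm fun n =>
      (E n t).le_of_opNorm_le (hE1 n t t.2) x
  have hT0 : T 0 = ContinuousLinearMap.id ℂ X := by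
    ext x
    refine tendsto_nhds_unique (hT 0 x) (tendsto_const_nhds.congr fun n => ?_)
    simp [hE]
  -- Letting m → ∞ in `hEsub` gives an error linear in t. It yields both the derivative at 0 and
  -- locally uniform convergence of orbits.
  have hTE : ∀ x y, (x, y) ∈ B.graph → ∀ (t : ℝ≥0) n, ‖T t x - E n t x‖ ≤ t * ‖y - Y n x‖ := by
    intro x y hxy t n
    refine le_of_tendsto_of_tendsto' ((hT t x).sub_const _).norm
      (((hYx x y hxy).sub_const _).norm.const_mul (t : ℝ)) fun m => hEsub m n t x t.2
  have hadd : ∀ s t, T (s + t) = (T s).comp (T t) := by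
    intro s t
    ext x
    have h1 : Tendsto (fun n => E n s (E n t x)) atTop (𝓝 (T s (T t x))) := by
      rw [tendsto_iff_norm_sub_tendsto_zero]
      have h2 := (tendsto_iff_norm_sub_tendsto_zero.1 (hT t x)).add
        (tendsto_iff_norm_sub_tendsto_zero.1 (hT s (T t x)))
      rw [add_zero] at h2
      refine squeeze_zero (fun _ => norm_nonneg _) (fun n => ?_) h2
      have e : E n s (E n t x) - T s (T t x) =
          E n s (E n t x - T t x) + (E n s (T t x) - T s (T t x)) := by rw [map_sub]; abel
      rw [e]
      refine (norm_add_le _ _).trans ?_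
      gcongr
      simpa using (E n s).le_of_opNorm_le (hE1 n s s.2) (E n t x - T t x)
    refine tendsto_nhds_unique (hT (s + t) x) (h1.congr fun n => ?_)
    simp only [hE, NNReal.coe_add, add_smul]
    rw [clm_exp_add (((Commute.refl (Y n)).smul_left _).smul_right _)]
    rfl
  have hder : ∀ x y, (x, y) ∈ B.graph →
      HasDerivWithinAt (fun t : ℝ => T t.toNNReal x) y (Ioi 0) 0 := by
    intro x y hxy
    rw [hasDerivWithinAt_iff_tendsto_slope' self_notMem_Ioi, Metric.tendsto_nhds]
    intro ε hε
    obtain ⟨N, hN⟩ := Metric.tendsto_atTop.1 (hYx x y hxy) (ε / 3) (by positivity)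
    have hn := hN N le_rfl
    have h1 := (hasDerivAt_exp_smul_apply (Y N) x 0).hasDerivWithinAt (s := Ioi 0)
    rw [hasDerivWithinAt_iff_tendsto_slope' self_notMem_Ioi, Metric.tendsto_nhds] at h1
    filter_upwards [h1 (ε / 3) (by positivity), self_mem_nhdsWithin] with t ht ht0
    have ht0' : (0 : ℝ) < t := ht0
    have h2 : dist (slope (fun t : ℝ => T t.toNNReal x) 0 t)
        (slope (fun t : ℝ => NormedSpace.exp (t • Y N) x) 0 t) < ε / 3 := by
      have h3 := hTE x y hxy t.toNNReal N
      rw [Real.coe_toNNReal _ ht0'.le] at h3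
      rw [dist_eq_norm, slope_def_module, slope_def_module, ← smul_sub, norm_smul]
      rw [dist_comm, dist_eq_norm] at hn
      simp only [Real.toNNReal_zero, hT0, zero_smul, NormedSpace.exp_zero, sub_zero,
        ContinuousLinearMap.id_apply, one_apply_eq_self, sub_sub_sub_cancel_right]
      rw [norm_inv, Real.norm_of_nonneg ht0'.le, inv_mul_eq_div, div_lt_iff₀ ht0']
      refine h3.trans_lt ?_
      rw [mul_comm]
      gcongr
    have h4 : dist (NormedSpace.exp ((0 : ℝ) • Y N) (Y N x)) y < ε / 3 := by
      simpa using hn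
    calc _ ≤ _ := dist_triangle4 _ _ _ _
      _ < ε / 3 + ε / 3 + ε / 3 := by gcongr
      _ = ε := by ring
  have hcont : ∀ x, Continuous fun t => T t x := by
    refine continuous_orbit_of_dense hT1 hd fun x hx => ?_
    obtain ⟨y, hy⟩ := LinearPMap.mem_domain_iff.1 hx
    have hlu : TendstoLocallyUniformly (fun n (t : ℝ≥0) => E n t x) (fun t => T t x) atTop := by
      rw [Metric.tendstoLocallyUniformly_iff]
      intro ε hε t₀
      refine ⟨Iio (t₀ + 1), Iio_mem_nhds (by simp), ?_⟩
      obtain ⟨N, hN⟩ := Metric.tendsto_atTop.1 (hYx x y hy) (ε / (t₀ + 1)) (by positivity)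
      filter_upwards [eventually_ge_atTop N] with n hn t ht
      have h2 := hN n hn
      rw [dist_comm, dist_eq_norm, lt_div_iff₀ (by positivity)] at h2
      rw [dist_eq_norm]
      refine (hTE x y hy t n).trans_lt (lt_of_le_of_lt ?_ h2)
      rw [mul_comm]
      gcongr
      exact_mod_cast (le_of_lt ht : t ≤ t₀ + 1)
    refine hlu.continuous (Eventually.of_forall fun n => ?_).frequently
    have h1 : Continuous fun s : ℝ => NormedSpace.exp (s • Y n) x :=
      continuous_iff_continuousAt.2 fun s => (hasDerivAt_exp_smul_apply (Y n) x s).continuousAt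
    exact h1.comp NNReal.continuous_coe
  refine ⟨T, ⟨hT0, hadd, hcont⟩, ?_, hT1, fun Q hQ t => ?_⟩
  -- The generator of T extends B by `hder`; the resolvent at 1 rules out a proper extension.
  · exact isGenerator_of_forall_mem_graph (ω := 0) hT0 (fun t => by simpa using hT1 t) hder (hl 0)
      (hR 0)
  · ext x
    -- Each approximant is the exponential of an affine function of a resolvent, so it commutes with
    -- Q, and this survives the strong limit.
    have hQE : ∀ n, Commute Q (E n t) := fun n => by
      refine Commute.exp_right (((Commute.smul_right ?_ _)).smul_right _)
      exact ((hQ _ _ (hl n) (hR n)).smul_right _).sub_right (Commute.one_right _)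
    refine tendsto_nhds_unique ((Q.continuous.tendsto _).comp (hT t x))
      ((hT t (Q x)).congr fun n => ?_)
    exact congrArg (fun L : X →L[ℂ] X => L x) (hQE n).eq.symm

end HilleYosida

/-! ### Rescaling, commuting pairs of semigroups and isometric groups -/

section Groups

variable {X : Type*} [NormedAddCommGroup X] [NormedSpace ℂ X]

theorem isClosed_rot {A : X →ₗ.[ℂ] X} (hA : A.IsClosed) (θ : ℝ) : (rot θ A).IsClosed := by
  have hc : Continuous fun p : X × X => (p.1, Complex.exp (Complex.I * θ) • p.2) := by fun_prop
  have h2 : _root_.IsClosed ((fun p : X × X => (p.1, Complex.exp (Complex.I * θ) • p.2)) ⁻¹'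
    (A.graph : Set (X × X))) := IsClosed.preimage hc hA
  have e : ((rot θ A).graph : Set (X × X)) =
      (fun p : X × X => (p.1, Complex.exp (Complex.I * θ) • p.2)) ⁻¹' (A.graph : Set (X × X)) := by
    ext ⟨x, y⟩
    exact mem_graph_rot
  rw [LinearPMap.IsClosed, e]
  exact h2

theorem hasDerivWithinAt_exp_smul {u : ℝ → X} {v : X} {s : Set ℝ}
    (h : HasDerivWithinAt u v s 0) (w : ℂ) :
    HasDerivWithinAt (fun t : ℝ => Complex.exp (w * t) • u t) (v + w • u 0) s 0 := by
  have h1 : HasDerivAt (fun t : ℝ => Complex.exp (w * t)) w 0 := by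
    have := ((hasDerivAt_id ((0 : ℝ) : ℂ)).const_mul w).cexp.comp_ofReal
    simpa using this
  have := h1.hasDerivWithinAt.smul h
  rw [Complex.ofReal_zero, mul_zero, Complex.exp_zero, one_smul] at this
  exact this

/-- The semigroup is e^{ωt}S(t), with S the contraction semigroup generated by B − ω. -/
theorem generatesContractive_of_mDissipative [CompleteSpace X] {B : X →ₗ.[ℂ] X}
    (hd : Dense (B.domain : Set X)) {ω : ℝ} (h : MDissipative B ω) : GeneratesContractive B ω := by
  have hs := mDissipative_shift (w := (ω : ℂ)) h
  rw [Complex.ofReal_re, sub_self] at hs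
  obtain ⟨S, hS, hG, hS1, -⟩ := hille_yosida (B := shift ω B) hd hs
  rw [isGenerator_iff hS.map_zero] at hG
  have hb : ∀ t : ℝ≥0, ‖Complex.exp (ω * (t : ℝ)) • S t‖ ≤ Real.exp (ω * t) := fun t => by
    rw [norm_smul, Complex.norm_exp, ← Complex.ofReal_mul, Complex.ofReal_re]
    exact mul_le_of_le_one_right (Real.exp_pos _).le (hS1 t)
  have h0 : Complex.exp (ω * ((0 : ℝ≥0) : ℝ)) • S 0 = ContinuousLinearMap.id ℂ X := by
    simp [hS.map_zero]
  refine ⟨fun t => Complex.exp (ω * (t : ℝ)) • S t, ⟨h0, fun s t => ?_, fun x => ?_⟩, ?_, hb⟩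
  · ext x
    simp only [NNReal.coe_add, Complex.ofReal_add, mul_add, Complex.exp_add, FunLike.coe_smul,
      Pi.smul_apply, ContinuousLinearMap.comp_apply, map_smul, hS.apply_add, smul_smul]
    rw [mul_comm]
  · exact (by fun_prop : Continuous fun t : ℝ≥0 => Complex.exp (ω * (t : ℝ))).smul
      (hS.continuous_orbit x)
  · obtain ⟨R, hR⟩ := h.2 ((ω + 1 : ℝ) : ℂ) (by rw [Complex.ofReal_re]; linarith)
    refine isGenerator_of_forall_mem_graph h0 hb (fun x y hxy => ?_)
      (by rw [Complex.ofReal_re]; linarith) hR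
    have h1 := (hG x (y - (ω : ℂ) • x)).1 (mem_graph_shift.2 (by simpa using hxy))
    have h2 := hasDerivWithinAt_exp_smul h1 ω
    simp only [Real.toNNReal_zero, hS.map_zero, ContinuousLinearMap.id_apply,
      sub_add_cancel] at h2
    refine h2.congr (fun t ht => ?_) (by simp [hS.map_zero])
    rw [FunLike.coe_smul, Pi.smul_apply, Real.coe_toNNReal _ (le_of_lt ht)]

theorem generatesContractive_iff_mDissipative [CompleteSpace X] {B : X →ₗ.[ℂ] X}
    (hB : B.IsClosed) (hd : Dense (B.domain : Set X)) {ω : ℝ} :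
    GeneratesContractive B ω ↔ MDissipative B ω :=
  ⟨fun h => h.mDissipative hB hd, generatesContractive_of_mDissipative hd⟩

/-- The error T_a v_a − T_a x is bounded by ‖v_a − x‖, uniformly over the operators. -/
theorem tendsto_apply_of_contraction {α : Type*} {l : Filter α} {T : α → X →L[ℂ] X}
    (hT : ∀ a, ‖T a‖ ≤ 1) {v : α → X} {x y : X} (hv : Tendsto v l (𝓝 x))
    (h : Tendsto (fun a => T a x) l (𝓝 y)) : Tendsto (fun a => T a (v a)) l (𝓝 y) := by
  rw [tendsto_iff_norm_sub_tendsto_zero] at hv h ⊢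
  have h2 := hv.add h
  rw [add_zero] at h2
  refine squeeze_zero (fun _ => norm_nonneg _) (fun a => ?_) h2
  have e : T a (v a) - y = T a (v a - x) + (T a x - y) := by rw [map_sub]; abel
  rw [e]
  refine (norm_add_le _ _).trans ?_
  gcongr
  simpa using (T a).le_of_opNorm_le (hT a) (v a - x)

theorem continuous_apply_pair {S₁ S₂ : ℝ≥0 → X →L[ℂ] X} (h1 : IsC0Semigroup S₁)
    (hb : ∀ t, ‖S₁ t‖ ≤ 1) (h2 : IsC0Semigroup S₂) (x : X) :
    Continuous fun p : ℝ × ℝ => S₁ p.1.toNNReal (S₂ p.2.toNNReal x) :=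
  continuous_iff_continuousAt.2 fun p =>
    tendsto_apply_of_contraction (T := fun p : ℝ × ℝ => S₁ p.1.toNNReal) (fun _ => hb _)
      (((h2.continuous_real x).comp continuous_snd).tendsto p)
      (((h1.continuous_real (S₂ p.2.toNNReal x)).comp continuous_fst).tendsto p)

theorem inv_smul_smul_pmap {C : X →ₗ.[ℂ] X} {c : ℂ} (hc : c ≠ 0) : c⁻¹ • c • C = C := by
  refine LinearPMap.ext rfl fun x hx hx' => ?_
  simp only [LinearPMap.smul_apply]
  exact inv_smul_smul₀ hc _

theorem IsResolvent.commute_smul {C : X →ₗ.[ℂ] X} {c₁ c₂ : ℂ} (h1 : c₁ ≠ 0) (h2 : c₂ ≠ 0)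
    {μ ν : ℂ} {R S : X →L[ℂ] X} (hR : IsResolvent (c₁ • C) μ R) (hS : IsResolvent (c₂ • C) ν S) :
    Commute R S := by
  have hR' := isResolvent_smul (inv_ne_zero h1) hR
  have hS' := isResolvent_smul (inv_ne_zero h2) hS
  rw [inv_smul_smul_pmap h1, inv_inv] at hR'
  rw [inv_smul_smul_pmap h2, inv_inv] at hS'
  have := ((hR'.commute hS').smul_left c₁⁻¹).smul_right c₂⁻¹
  rwa [inv_smul_smul₀ h1, inv_smul_smul₀ h2] at this

/-- Resolvents of c₁C and c₂C are scalar multiples of resolvents of C and therefore commute. The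
commutation clause of `hille_yosida`, used once for each semigroup, lifts this to the semigroups. -/
theorem exists_commuting_semigroups [CompleteSpace X] {C : X →ₗ.[ℂ] X}
    (hd : Dense (C.domain : Set X)) {c₁ c₂ : ℂ} (hc₁ : c₁ ≠ 0) (hc₂ : c₂ ≠ 0)
    (h1 : MDissipative (c₁ • C) 0) (h2 : MDissipative (c₂ • C) 0) :
    ∃ S₁ S₂ : ℝ≥0 → X →L[ℂ] X, IsC0Semigroup S₁ ∧ IsC0Semigroup S₂ ∧
      IsGenerator (c₁ • C) S₁ ∧ IsGenerator (c₂ • C) S₂ ∧ (∀ t, ‖S₁ t‖ ≤ 1) ∧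
      (∀ t, ‖S₂ t‖ ≤ 1) ∧ ∀ s t x, S₁ s (S₂ t x) = S₂ t (S₁ s x) := by
  obtain ⟨S₁, hS₁, hG₁, hb₁, hQ₁⟩ := hille_yosida (B := c₁ • C) hd h1
  obtain ⟨S₂, hS₂, hG₂, hb₂, hQ₂⟩ := hille_yosida (B := c₂ • C) hd h2
  refine ⟨S₁, S₂, hS₁, hS₂, hG₁, hG₂, hb₁, hb₂, fun s t x => ?_⟩
  have h : Commute (S₂ t) (S₁ s) := hQ₁ _ (fun μ R _ hR => (hQ₂ R
    (fun ν R' _ hR' => hR.commute_smul hc₁ hc₂ hR') t).symm) s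
  exact congrArg (fun L : X →L[ℂ] X => L x) h.eq.symm

/-- The product of two commuting contraction semigroups is differentiable on common vectors. -/
theorem hasFDerivAt_apply_pair [CompleteSpace X] {S₁ S₂ : ℝ≥0 → X →L[ℂ] X}
    (h1 : IsC0Semigroup S₁) (h2 : IsC0Semigroup S₂) (hb : ∀ t, ‖S₁ t‖ ≤ 1)
    (hcomm : ∀ s t x, S₁ s (S₂ t x) = S₂ t (S₁ s x)) {x y₁ y₂ : X}
    (hx₁ : HasDerivWithinAt (fun t : ℝ => S₁ t.toNNReal x) y₁ (Ioi 0) 0)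
    (hx₂ : HasDerivWithinAt (fun t : ℝ => S₂ t.toNNReal x) y₂ (Ioi 0) 0) {t s : ℝ} (ht : 0 < t)
    (hs : 0 < s) :
    HasFDerivAt (fun p : ℝ × ℝ => S₁ p.1.toNNReal (S₂ p.2.toNNReal x))
      ((ContinuousLinearMap.toSpanSingleton ℝ (S₁ t.toNNReal (S₂ s.toNNReal y₁))).coprod
        (ContinuousLinearMap.toSpanSingleton ℝ (S₁ t.toNNReal (S₂ s.toNNReal y₂)))) (t, s) := by
  have hpos : ∀ᶠ v : ℝ × ℝ in 𝓝 (t, s), 0 < v.1 ∧ 0 < v.2 := by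
    rw [nhds_prod_eq]
    exact (lt_mem_nhds ht).prod_mk (lt_mem_nhds hs)
  have hcont : ∀ y, ContinuousAt (fun v : ℝ × ℝ =>
      ContinuousLinearMap.toSpanSingleton ℝ (S₁ v.1.toNNReal (S₂ v.2.toNNReal y))) (t, s) :=
    fun y => ((ContinuousLinearMap.toSpanSingletonCLE (𝕜 := ℝ) (E := X)).continuous.comp
      (continuous_apply_pair h1 hb h2 y)).continuousAt
  -- Both partial derivatives exist near (t, s) and are jointly continuous. The one in the first
  -- variable is computed after swapping the two commuting factors.
  have := hasStrictFDerivAt_uncurry_coprod (𝕜 := ℝ) (u := (t, s))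
    (f := fun a b => S₁ a.toNNReal (S₂ b.toNNReal x))
    (f₁ := fun a b => ContinuousLinearMap.toSpanSingleton ℝ (S₁ a.toNNReal (S₂ b.toNNReal y₁)))
    (f₂ := fun a b => ContinuousLinearMap.toSpanSingleton ℝ (S₁ a.toNNReal (S₂ b.toNNReal y₂)))
    ?_ ?_ (hcont y₁) (hcont y₂)
  · exact this.hasFDerivAt
  · filter_upwards [hpos] with v hv
    have h3 := ((S₂ v.2.toNNReal).restrictScalars ℝ).hasFDerivAt.comp_hasDerivAt v.1
      (h1.hasDerivAt hx₁ hv.1)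
    refine (h3.congr_deriv (hcomm _ _ _).symm).hasFDerivAt.congr_of_eventuallyEq ?_
    exact Eventually.of_forall fun a => hcomm _ _ _
  · filter_upwards [hpos] with v hv
    exact (((S₁ v.1.toNNReal).restrictScalars ℝ).hasFDerivAt.comp_hasDerivAt v.2
      (h2.hasDerivAt hx₂ hv.2)).hasFDerivAt

theorem tendsto_slope_iff_hasDerivAt {U : ℝ → X →L[ℂ] X} (h0 : U 0 = ContinuousLinearMap.id ℂ X)
    {x y : X} : Tendsto (fun t : ℝ => ((t : ℂ)⁻¹) • (U t x - x)) (𝓝[≠] 0) (𝓝 y) ↔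
      HasDerivAt (fun t => U t x) y 0 := by
  rw [hasDerivAt_iff_tendsto_slope]
  refine tendsto_congr fun t => ?_
  rw [slope_def_module, sub_zero, ← Complex.ofReal_inv, Complex.coe_smul]
  simp [h0]

theorem hasDerivAt_of_Iio_Ioi {u : ℝ → X} {y : X} {a : ℝ} (h1 : HasDerivWithinAt u y (Iio a) a)
    (h2 : HasDerivWithinAt u y (Ioi a) a) : HasDerivAt u y a := by
  rw [hasDerivAt_iff_tendsto_slope, ← Iio_union_Ioi, nhdsWithin_union]
  exact ((hasDerivWithinAt_iff_tendsto_slope' self_notMem_Iio).1 h1).sup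
    ((hasDerivWithinAt_iff_tendsto_slope' self_notMem_Ioi).1 h2)

theorem hasDerivWithinAt_comp_neg {u : ℝ → X} {y : X} (h : HasDerivWithinAt u y (Ioi 0) 0) :
    HasDerivWithinAt (fun t => u (-t)) (-y) (Iio 0) 0 := by
  have := HasDerivWithinAt.scomp (h := fun s : ℝ => -s) (h' := -1) (s := Iio 0) (t' := Ioi 0)
    (g₁ := u) (g₁' := y) 0 (by simpa using h) ((hasDerivAt_id (0 : ℝ)).neg).hasDerivWithinAt
    (fun s hs => mem_Ioi.2 (neg_pos.2 (mem_Iio.1 hs)))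
  rw [neg_one_smul] at this
  exact this

theorem mem_graph_neg {A : X →ₗ.[ℂ] X} {x y : X} : (x, y) ∈ (-A).graph ↔ (x, -y) ∈ A.graph := by
  rw [neg_eq_smul, mem_graph_smul (neg_ne_zero.2 one_ne_zero), inv_neg, inv_one, neg_one_smul]

/-- Let S₁ and S₂ be the contraction semigroups of B and −B. On the domain S₁(t)S₂(t)x has
derivative zero, so they are mutually inverse and U(t) = S₁(t⁺)S₂(t⁻) is a group. Each U(t) is a
contraction with contractive inverse U(−t), hence isometric. -/
theorem generatesIsometricGroup_of_mDissipative [CompleteSpace X] {B : X →ₗ.[ℂ] X}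
    (hd : Dense (B.domain : Set X)) (h1 : MDissipative B 0) (h2 : MDissipative (-B) 0) :
    GeneratesIsometricGroup B := by
  obtain ⟨S₁, S₂, hS₁, hS₂, hG₁, hG₂, hb₁, hb₂, hcomm⟩ := exists_commuting_semigroups hd
    (c₁ := 1) (c₂ := -1) one_ne_zero (neg_ne_zero.2 one_ne_zero)
    (by
      have e : (1 : ℂ) • B = B := by
        refine LinearPMap.ext rfl fun x hx hx' => ?_
        simp [LinearPMap.smul_apply]
      rwa [e]) (by rwa [← neg_eq_smul])
  rw [isGenerator_iff hS₁.map_zero] at hG₁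
  rw [isGenerator_iff hS₂.map_zero] at hG₂
  have hG₁' : ∀ x y, (x, y) ∈ B.graph ↔
      HasDerivWithinAt (fun t : ℝ => S₁ t.toNNReal x) y (Ioi 0) 0 := fun x y => by
    rw [← hG₁, mem_graph_smul one_ne_zero, inv_one, one_smul]
  have hG₂' : ∀ x y, (x, y) ∈ B.graph →
      HasDerivWithinAt (fun t : ℝ => S₂ t.toNNReal x) (-y) (Ioi 0) 0 := fun x y hxy => by
    rw [← hG₂, ← neg_eq_smul, mem_graph_neg, neg_neg]
    exact hxy
  have hconst : ∀ x y, (x, y) ∈ B.graph → ∀ t : ℝ, 0 < t →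
      S₁ t.toNNReal (S₂ t.toNNReal x) = x := by
    intro x y hxy t ht
    have hcont : Continuous fun a : ℝ => S₁ a.toNNReal (S₂ a.toNNReal x) :=
      (continuous_apply_pair hS₁ hb₁ hS₂ x).comp (by fun_prop : Continuous fun a : ℝ => (a, a))
    have hder : ∀ a : ℝ, 0 < a →
        HasDerivAt (fun a : ℝ => S₁ a.toNNReal (S₂ a.toNNReal x)) 0 a := by
      intro a ha
      have h3 := (hasFDerivAt_apply_pair hS₁ hS₂ hb₁ hcomm ((hG₁' x y).1 hxy) (hG₂' x y hxy) ha
        ha).comp_hasDerivAt (f := fun a : ℝ => (a, a)) a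
        ((hasDerivAt_id a).prodMk (hasDerivAt_id a))
      refine h3.congr_deriv ?_
      simp
    -- The derivative is known only at positive times, so constancy is shown on [a, t] and then a
    -- tends to 0.
    have heq : ∀ a ∈ Ioo 0 t, S₁ t.toNNReal (S₂ t.toNNReal x) =
        S₁ a.toNNReal (S₂ a.toNNReal x) := fun a ha =>
      constant_of_has_deriv_right_zero (a := a) (b := t) hcont.continuousOn
        (fun b hb => (hder b (ha.1.trans_le hb.1)).hasDerivWithinAt) t ⟨ha.2.le, le_rfl⟩
    have hlim : Tendsto (fun a : ℝ => S₁ a.toNNReal (S₂ a.toNNReal x)) (𝓝[>] 0) (𝓝 x) := by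
      have := (hcont.tendsto 0).mono_left (nhdsWithin_le_nhds (s := Ioi 0))
      simpa [hS₁.map_zero, hS₂.map_zero] using this
    refine tendsto_nhds_unique (tendsto_const_nhds.congr' ?_) hlim
    filter_upwards [Ioo_mem_nhdsGT ht] with a ha using heq a ha
  have hinv : ∀ (t : ℝ≥0) x, S₁ t (S₂ t x) = x := by
    intro t x
    rcases eq_or_lt_of_le (zero_le : 0 ≤ t) with rfl | ht
    · simp [hS₁.map_zero, hS₂.map_zero]
    · have : (fun x => S₁ t (S₂ t x)) = id := by
        refine Continuous.ext_on hd (by fun_prop) continuous_id fun x hx => ?_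
        obtain ⟨y, hy⟩ := LinearPMap.mem_domain_iff.1 hx
        simpa using hconst x y hy t ht
      exact congrFun this x
  -- The product S₁(a)S₂(b) depends only on the net time a − b. This gives the group law without a
  -- case split on signs.
  have key : ∀ (a b a' b' : ℝ≥0) x, a + b' = a' + b → S₁ a (S₂ b x) = S₁ a' (S₂ b' x) := by
    intro a b a' b' x hab
    calc S₁ a (S₂ b x) = S₁ a (S₂ b (S₁ b' (S₂ b' x))) := by rw [hinv]
      _ = S₁ (a + b') (S₂ (b + b') x) := by
        rw [← hcomm, ← hS₁.apply_add, ← hS₂.apply_add]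
      _ = S₁ (a' + b) (S₂ (b' + b) x) := by rw [hab, add_comm b]
      _ = S₁ a' (S₂ b' (S₁ b (S₂ b x))) := by
        rw [← hcomm, ← hS₁.apply_add, ← hS₂.apply_add]
      _ = S₁ a' (S₂ b' x) := by rw [hinv]
  have hU0 : (S₁ (0 : ℝ).toNNReal).comp (S₂ (-(0 : ℝ)).toNNReal) = ContinuousLinearMap.id ℂ X := by
    simp [hS₁.map_zero, hS₂.map_zero]
  have hUadd : ∀ s t : ℝ, (S₁ (s + t).toNNReal).comp (S₂ (-(s + t)).toNNReal) =
      ((S₁ s.toNNReal).comp (S₂ (-s).toNNReal)).comp ((S₁ t.toNNReal).comp (S₂ (-t).toNNReal)) := by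
    intro s t
    ext x
    simp only [ContinuousLinearMap.comp_apply]
    rw [← hcomm, ← hS₁.apply_add, ← hS₂.apply_add]
    refine key _ _ _ _ x ?_
    rw [← NNReal.coe_inj]
    push_cast [Real.coe_toNNReal']
    have e := fun r : ℝ => max_zero_sub_eq_self r
    linarith [e s, e t, e (s + t)]
  have hUle : ∀ (t : ℝ) x, ‖S₁ t.toNNReal (S₂ (-t).toNNReal x)‖ ≤ ‖x‖ := fun t x => by
    simpa using (S₁ t.toNNReal).le_of_opNorm_le_of_le (hb₁ _)
      ((S₂ (-t).toNNReal).le_of_opNorm_le (hb₂ _) x)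
  refine ⟨fun t => (S₁ t.toNNReal).comp (S₂ (-t).toNNReal), hU0, hUadd, fun x => ?_, fun x y => ?_,
    fun t x => le_antisymm (hUle t x) ?_⟩
  · exact (continuous_apply_pair hS₁ hb₁ hS₂ x).comp (by fun_prop : Continuous fun a : ℝ => (a, -a))
  · rw [tendsto_slope_iff_hasDerivAt hU0]
    have epos : ∀ t : ℝ, 0 ≤ t → (S₁ t.toNNReal).comp (S₂ (-t).toNNReal) x = S₁ t.toNNReal x := by
      intro t ht
      simp [Real.toNNReal_of_nonpos (neg_nonpos.2 ht), hS₂.map_zero]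
    have eneg : ∀ t : ℝ, t ≤ 0 → (S₁ t.toNNReal).comp (S₂ (-t).toNNReal) x =
        S₂ (-t).toNNReal x := by
      intro t ht
      simp [Real.toNNReal_of_nonpos ht, hS₁.map_zero]
    constructor
    · intro hxy
      refine hasDerivAt_of_Iio_Ioi ?_ ?_
      · have := hasDerivWithinAt_comp_neg (hG₂' x y hxy)
        rw [neg_neg] at this
        exact this.congr (fun t ht => eneg t (le_of_lt ht)) (eneg 0 le_rfl)
      · exact ((hG₁' x y).1 hxy).congr (fun t ht => epos t (le_of_lt ht)) (epos 0 le_rfl)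
    · intro h
      rw [hG₁']
      exact h.hasDerivWithinAt.congr (fun t ht => (epos t (le_of_lt ht)).symm) (epos 0 le_rfl).symm
  · have h3 := congrArg (fun L : X →L[ℂ] X => L x) (hUadd (-t) t)
    simp only [neg_add_cancel] at h3
    rw [hU0] at h3
    have h4 : x = S₁ (-t).toNNReal (S₂ (-(-t)).toNNReal (S₁ t.toNNReal (S₂ (-t).toNNReal x))) := h3
    calc ‖x‖ = _ := congrArg norm h4
      _ ≤ _ := hUle _ _

/-- The group generator is a two-sided limit and the semigroup generator a right limit. They agree
because, for t < 0, the quotient at t is U(t) applied to the quotient at −t, and the contractions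
U(t) converge strongly to 1. -/
theorem GeneratesIsometricGroup.generatesContractive {B : X →ₗ.[ℂ] X}
    (h : GeneratesIsometricGroup B) : GeneratesContractive B 0 := by
  obtain ⟨U, h0, hadd, hcont, hG, hiso⟩ := h
  have hb : ∀ t, ‖U t‖ ≤ 1 := fun t =>
    (U t).opNorm_le_bound zero_le_one fun x => by rw [hiso, one_mul]
  have hT0 : U ((0 : ℝ≥0) : ℝ) = ContinuousLinearMap.id ℂ X := h0
  refine ⟨fun t => U t, ⟨hT0, fun s t => by rw [NNReal.coe_add, hadd], fun x =>
    (hcont x).comp NNReal.continuous_coe⟩, ?_, fun t => by simpa using hb t⟩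
  rw [isGenerator_iff hT0]
  intro x y
  rw [hG, tendsto_slope_iff_hasDerivAt h0]
  have e : ∀ t : ℝ, 0 ≤ t → U (t.toNNReal : ℝ) x = U t x := fun t ht => by
    rw [Real.coe_toNNReal _ ht]
  constructor
  · exact fun h => h.hasDerivWithinAt.congr (fun t ht => e t (le_of_lt ht)) (e 0 le_rfl)
  · intro h
    have h' : HasDerivWithinAt (fun t => U t x) y (Ioi 0) 0 :=
      h.congr (fun t ht => (e t (le_of_lt ht)).symm) (e 0 le_rfl).symm
    refine hasDerivAt_of_Iio_Ioi ?_ h'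
    rw [hasDerivWithinAt_iff_tendsto_slope' self_notMem_Iio]
    rw [hasDerivWithinAt_iff_tendsto_slope' self_notMem_Ioi] at h'
    have hneg : Tendsto (fun t : ℝ => -t) (𝓝[<] 0) (𝓝[>] 0) := by
      simpa using tendsto_neg_nhdsLT (a := (0 : ℝ))
    have h1 := tendsto_apply_of_contraction (T := U) hb (h'.comp hneg)
      (((hcont y).tendsto 0).mono_left nhdsWithin_le_nhds)
    rw [h0] at h1
    refine h1.congr fun t => ?_
    have e1 : U t (U (-t) x) = x := by
      have := congrArg (fun L : X →L[ℂ] X => L x) (hadd t (-t))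
      simp only [add_neg_cancel, h0] at this
      exact this.symm
    simp only [Function.comp, slope_def_module, sub_zero, h0, ContinuousLinearMap.id_apply]
    rw [← Complex.coe_smul, map_smul, map_sub, e1, Complex.coe_smul, inv_neg, neg_smul, ← smul_neg,
      neg_sub]

theorem GeneratesIsometricGroup.neg {B : X →ₗ.[ℂ] X} (h : GeneratesIsometricGroup B) :
    GeneratesIsometricGroup (-B) := by
  obtain ⟨U, h0, hadd, hcont, hG, hiso⟩ := h
  have h0' : U (-0) = ContinuousLinearMap.id ℂ X := by rw [neg_zero, h0]
  refine ⟨fun t => U (-t), h0', fun s t => by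
    change U (-(s + t)) = _
    rw [neg_add, hadd], fun x =>
    (hcont x).comp continuous_neg, fun x y => ?_, fun t => hiso _⟩
  have key : ∀ (u : ℝ → X) (v : X), HasDerivAt u v 0 → HasDerivAt (fun t => u (-t)) (-v) 0 := by
    intro u v h
    have := HasDerivAt.scomp (h := fun s : ℝ => -s) (h' := -1) (g₁ := u) (g₁' := v) 0
      (by simpa using h) ((hasDerivAt_id (0 : ℝ)).neg)
    rw [neg_one_smul] at this
    exact this
  rw [mem_graph_neg, hG, tendsto_slope_iff_hasDerivAt h0,
    tendsto_slope_iff_hasDerivAt (U := fun t => U (-t)) h0']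
  constructor
  · intro h
    simpa using key _ _ h
  · intro h
    simpa using key _ _ h

end Groups

/-! ### Rays of analytic semigroups, and strong versus norm holomorphy -/

section Analytic

variable {X : Type*} [NormedAddCommGroup X] [NormedSpace ℂ X]

theorem mul_mem_openSector {φ δ : ℝ} (hφ : |φ| < δ) (hδ : δ ≤ Real.pi / 2) {t : ℝ} (ht : 0 < t) :
    Complex.exp (-(Complex.I * φ)) * t ∈ openSector δ := by
  have hpi := Real.pi_pos
  have h := abs_lt.1 hφ
  refine ⟨mul_ne_zero (Complex.exp_ne_zero _) (by exact_mod_cast ht.ne'), ?_⟩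
  have e : Complex.exp (-(Complex.I * φ)) =
      Complex.cos ((-φ : ℝ) : ℂ) + Complex.sin ((-φ : ℝ) : ℂ) * Complex.I := by
    rw [← Complex.exp_mul_I]
    congr 1
    push_cast
    ring
  rw [mul_comm, Complex.arg_real_mul _ ht, e, Complex.arg_cos_add_sin_mul_I ⟨by linarith, by linarith⟩,
    abs_neg]
  exact hφ

theorem isOpen_openSector {δ : ℝ} (hδ : δ ≤ Real.pi / 2) : IsOpen (openSector δ) := by
  have hpi := Real.pi_pos
  rw [isOpen_iff_mem_nhds]
  rintro z ⟨hz0, hz⟩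
  have hs : z ∈ Complex.slitPlane := by
    refine Complex.mem_slitPlane_iff_arg.2 ⟨fun h => ?_, hz0⟩
    rw [h, abs_of_pos hpi] at hz
    linarith
  have h1 := (Complex.continuousAt_arg hs).abs.eventually_lt_const hz
  filter_upwards [h1, isOpen_ne.mem_nhds hz0] with w hw hw0 using ⟨hw0, hw⟩

/-- Along the open ray the derivative c T(ct)y tends to c y, and the orbit is continuous at the
vertex; the limit is then the one-sided derivative there. -/
theorem hasDerivWithinAt_ray {T : ℂ → X →L[ℂ] X} (h0 : T 0 = ContinuousLinearMap.id ℂ X) {c : ℂ}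
    {x y : X} (h : ∀ t : ℝ, 0 < t → HasDerivAt (fun z => T z x) (T (c * t) y) (c * t))
    (hx : Tendsto (fun t : ℝ => T (c * t) x) (𝓝[>] 0) (𝓝 x))
    (hy : Tendsto (fun t : ℝ => T (c * t) y) (𝓝[>] 0) (𝓝 y)) :
    HasDerivWithinAt (fun t : ℝ => T (c * t) x) (c • y) (Ioi 0) 0 := by
  have hd : ∀ t : ℝ, 0 < t → HasDerivAt (fun t : ℝ => T (c * t) x) (c • T (c * t) y) t := by
    intro t ht
    have h1 : HasDerivAt (fun t : ℝ => c * (t : ℂ)) c t := by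
      simpa using ((hasDerivAt_id (t : ℂ)).const_mul c).comp_ofReal
    exact HasDerivAt.scomp t (h t ht) h1
  refine (hasDerivWithinAt_Ici_of_tendsto_deriv (s := Ioi 0)
    (fun t ht => (hd t ht).differentiableAt.differentiableWithinAt) ?_ self_mem_nhdsWithin
    ((hy.const_smul c).congr' ?_)).mono Ioi_subset_Ici_self
  · rw [ContinuousWithinAt]
    simpa [h0] using hx
  · filter_upwards [self_mem_nhdsWithin] with t ht using (hd t ht).deriv.symm

section OfAnalytic

variable {δ : ℝ} {T : ℂ → X →L[ℂ] X}

theorem IsAnalyticSemigroup.tendsto_ray (hT : IsAnalyticSemigroup δ T) (hδ : δ ≤ Real.pi / 2)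
    {φ : ℝ} (hφ : |φ| < δ) (x : X) :
    Tendsto (fun t : ℝ => T (Complex.exp (-(Complex.I * φ)) * t) x) (𝓝[>] 0) (𝓝 x) := by
  obtain ⟨δ', h1, h2⟩ := exists_between hφ
  refine (hT.tendsto_zero δ' ((abs_nonneg φ).trans_lt h1) h2 x).comp
    (tendsto_nhdsWithin_iff.2 ⟨?_, ?_⟩)
  · have : Continuous fun t : ℝ => Complex.exp (-(Complex.I * φ)) * t := by fun_prop
    have h3 := (this.tendsto 0).mono_left (nhdsWithin_le_nhds (s := Ioi 0))
    simpa using h3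
  · filter_upwards [self_mem_nhdsWithin] with t ht using mul_mem_openSector h1 (h2.le.trans hδ) ht

theorem IsAnalyticSemigroup.isC0Semigroup_ray (hT : IsAnalyticSemigroup δ T)
    (hδ : δ ≤ Real.pi / 2) {φ : ℝ} (hφ : |φ| < δ) :
    IsC0Semigroup fun t : ℝ≥0 => T (Complex.exp (-(Complex.I * φ)) * (t : ℝ)) := by
  refine ⟨by simp [hT.map_zero], fun s t => ?_, fun x => ?_⟩
  · rcases eq_or_lt_of_le (zero_le : 0 ≤ s) with rfl | hs
    · ext x; simp [hT.map_zero]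
    rcases eq_or_lt_of_le (zero_le : 0 ≤ t) with rfl | ht
    · ext x; simp [hT.map_zero]
    · rw [← hT.map_add _ (mul_mem_openSector hφ hδ (NNReal.coe_pos.2 hs)) _
        (mul_mem_openSector hφ hδ (NNReal.coe_pos.2 ht))]
      push_cast
      rw [mul_add]
  · refine continuous_iff_continuousAt.2 fun t => ?_
    rcases eq_or_lt_of_le (zero_le : 0 ≤ t) with rfl | ht
    · have h1 := tendsto_nhdsGT_coe_iff.2 (hT.tendsto_ray hδ hφ x)
      refine continuousWithinAt_Ioi_iff_Ici.1 ?_ |>.continuousAt (by simp)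
      rw [ContinuousWithinAt]
      simpa [hT.map_zero] using h1
    · have h1 := (hT.differentiableOn.differentiableAt ((isOpen_openSector hδ).mem_nhds
        (mul_mem_openSector hφ hδ (NNReal.coe_pos.2 ht)))).continuousAt
      have h2 : Continuous fun t : ℝ≥0 => Complex.exp (-(Complex.I * φ)) * ((t : ℝ) : ℂ) := by
        fun_prop
      exact (ContinuousAt.comp (f := fun t : ℝ≥0 => Complex.exp (-(Complex.I * φ)) * ((t : ℝ) : ℂ))
        h1 h2.continuousAt).clm_apply continuousAt_const

/-- As T(z + ct)x = T(z)T(ct)x, the hypothesis on one ray computes the derivative at z in the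
direction c. Holomorphy at z is already known, so a single direction determines the complex
derivative. -/
theorem IsAnalyticSemigroup.hasDerivAt (hT : IsAnalyticSemigroup δ T) (hδ : δ ≤ Real.pi / 2)
    {φ : ℝ} (hφ : |φ| < δ) {x v : X}
    (h : HasDerivWithinAt (fun t : ℝ => T (Complex.exp (-(Complex.I * φ)) * t) x)
      (Complex.exp (-(Complex.I * φ)) • v) (Ioi 0) 0) {z : ℂ} (hz : z ∈ openSector δ) :
    HasDerivAt (fun z => T z x) (T z v) z := by
  set c := Complex.exp (-(Complex.I * φ)) with hc
  have h1 := (hT.differentiableOn.differentiableAt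
    ((isOpen_openSector hδ).mem_nhds hz)).hasDerivAt.clm_apply (hasDerivAt_const z x)
  rw [_root_.map_zero, add_zero] at h1
  have h2 : HasDerivAt (fun t : ℝ => z + c * (t : ℂ)) c 0 := by
    simpa using (((hasDerivAt_id ((0 : ℝ) : ℂ)).const_mul c).const_add z).comp_ofReal
  have h3 : HasDerivAt (fun t : ℝ => T (z + c * t) x) (c • deriv T z x) 0 :=
    HasDerivAt.scomp (g₁ := fun z => T z x) (0 : ℝ) (by simpa using h1) h2
  have h4 : HasDerivWithinAt (fun t : ℝ => T (z + c * t) x) (T z (c • v)) (Ioi 0) 0 := by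
    have h5 := ((T z).restrictScalars ℝ).hasFDerivAt.comp_hasDerivWithinAt 0 h
    refine h5.congr (fun t ht => ?_) ?_
    · rw [hT.map_add z hz _ (mul_mem_openSector hφ hδ ht)]; rfl
    · simp [hT.map_zero]
  have h6 := (uniqueDiffWithinAt_Ioi (0 : ℝ)).eq_deriv _ h3.hasDerivWithinAt h4
  rw [map_smul] at h6
  rw [smul_right_injective X (exp_neg_I_ne_zero φ) h6] at h1
  exact h1

/-- Going from one ray to another through the interior of the sector shows that the generators along
all rays are rotations of one operator. -/
theorem IsAnalyticSemigroup.ray_of_ray (hT : IsAnalyticSemigroup δ T) (hδ : δ ≤ Real.pi / 2)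
    {φ ψ : ℝ} (hφ : |φ| < δ) (hψ : |ψ| < δ) {x v : X}
    (h : HasDerivWithinAt (fun t : ℝ => T (Complex.exp (-(Complex.I * φ)) * t) x)
      (Complex.exp (-(Complex.I * φ)) • v) (Ioi 0) 0) :
    HasDerivWithinAt (fun t : ℝ => T (Complex.exp (-(Complex.I * ψ)) * t) x)
      (Complex.exp (-(Complex.I * ψ)) • v) (Ioi 0) 0 :=
  hasDerivWithinAt_ray hT.map_zero
    (fun _ ht => hT.hasDerivAt hδ hφ h (mul_mem_openSector hψ hδ ht))
    (hT.tendsto_ray hδ hψ x) (hT.tendsto_ray hδ hψ v)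

/-- The rays of an analytic contractive semigroup are contractive semigroups. -/
theorem GeneratesAnalyticContractive.exists_rot {B : X →ₗ.[ℂ] X} {ω : ℝ}
    (h : GeneratesAnalyticContractive B ω) : ∃ δ : ℝ, 0 < δ ∧ δ ≤ Real.pi / 2 ∧
      ∀ φ : ℝ, |φ| < δ → GeneratesContractive (rot φ B) (ω * Real.cos φ) := by
  obtain ⟨δ, hδ0, hδ, T, hT, hG, hb⟩ := h
  refine ⟨δ, hδ0, hδ, fun φ hφ => ⟨fun t => T (Complex.exp (-(Complex.I * φ)) * (t : ℝ)),
    hT.isC0Semigroup_ray hδ hφ, ?_, fun t => ?_⟩⟩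
  · rw [isGenerator_iff (by simp [hT.map_zero])] at hG ⊢
    intro x y
    rw [mem_graph_rot, hG]
    have e : ∀ (c : ℂ) (y : X), HasDerivWithinAt (fun t : ℝ => T (c * (t.toNNReal : ℝ)) x) y
        (Ioi 0) 0 ↔ HasDerivWithinAt (fun t : ℝ => T (c * t) x) y (Ioi 0) 0 := fun c y => by
      have e0 : ∀ t : ℝ, 0 ≤ t → T (c * (t.toNNReal : ℝ)) x = T (c * t) x := fun t ht => by
        rw [Real.coe_toNNReal _ ht]
      exact ⟨fun h => h.congr (fun t ht => (e0 t (le_of_lt ht)).symm) (e0 0 le_rfl).symm,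
        fun h => h.congr (fun t ht => e0 t (le_of_lt ht)) (e0 0 le_rfl)⟩
    have e1 := e 1 (Complex.exp (Complex.I * φ) • y)
    simp only [one_mul] at e1
    have e2 : Complex.exp (-(Complex.I * φ)) • Complex.exp (Complex.I * φ) • y = y := by
      rw [smul_smul, ← Complex.exp_add]; simp
    have hδ0' : |(0 : ℝ)| < δ := by simpa using hδ0
    rw [e1, e]
    constructor
    · intro h
      have := hT.ray_of_ray hδ hδ0' hφ (x := x) (v := Complex.exp (Complex.I * φ) • y)
        (by simpa using h)
      rwa [e2] at this
    · intro h
      have := hT.ray_of_ray hδ hφ hδ0' (x := x) (v := Complex.exp (Complex.I * φ) • y)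
        (by rwa [e2])
      simpa using this
  · rcases eq_or_lt_of_le (zero_le : 0 ≤ t) with rfl | ht
    · simpa [hT.map_zero] using ContinuousLinearMap.norm_id_le (𝕜 := ℂ) (E := X)
    · refine (hb _ (mul_mem_openSector hφ hδ (NNReal.coe_pos.2 ht))).trans (le_of_eq ?_)
      rw [mul_comm (Complex.exp _), Complex.re_ofReal_mul, Complex.exp_re]
      simp
      ring

end OfAnalytic

variable [CompleteSpace X]

/-- A bounded, strongly holomorphic family of operators is holomorphic in operator norm. -/
theorem differentiableOn_of_strong {U : Set ℂ} (hU : IsOpen U) {T : ℂ → X →L[ℂ] X} {C : ℝ}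
    (hC : ∀ z, ‖T z‖ ≤ C) (h : ∀ x, DifferentiableOn ℂ (fun z => T z x) U) :
    DifferentiableOn ℂ T U := by
  intro z hz
  obtain ⟨ρ, hρ, hball⟩ := Metric.isOpen_iff.1 hU z hz
  have hC0 : 0 ≤ C := (norm_nonneg _).trans (hC 0)
  -- A disc of radius r about a point of the closed r-disc around z stays within 2ρ/3 of z, so
  -- Cauchy estimates hold on the whole closed r-disc.
  obtain ⟨r, hr⟩ : ∃ r : ℝ≥0, (r : ℝ) = ρ / 3 := ⟨⟨ρ / 3, by positivity⟩, rfl⟩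
  have hr0 : (0 : ℝ) < r := by rw [hr]; positivity
  have hderiv : ∀ w ∈ Metric.closedBall z r, ∀ x, ‖deriv (fun z => T z x) w‖ ≤ C * ‖x‖ / r := by
    intro w hw x
    refine Complex.norm_deriv_le_of_forall_mem_sphere_norm_le hr0 ?_ fun v _ =>
      (T v).le_of_opNorm_le (hC v) x
    refine DifferentiableOn.diffContOnCl ((h x).mono ?_)
    refine closure_minimal ?_ Metric.isClosed_closedBall |>.trans (?_ : Metric.closedBall w r ⊆ U)
    · exact Metric.ball_subset_closedBall
    · refine Subset.trans (fun v hv => ?_) hball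
      rw [Metric.mem_closedBall] at hv hw
      rw [Metric.mem_ball]
      linarith [dist_triangle v w z]
  have hsub : Metric.closedBall z r ⊆ U := by
    refine Subset.trans (fun v hv => ?_) hball
    rw [Metric.mem_closedBall] at hv
    rw [Metric.mem_ball]
    linarith
  -- The Cauchy estimates are linear in ‖x‖, hence give a Lipschitz bound in operator norm.
  have hlip : ∀ v ∈ Metric.closedBall z r, ∀ w ∈ Metric.closedBall z r,
      ‖T w - T v‖ ≤ C / r * ‖w - v‖ := by
    intro v hv w hw
    refine ContinuousLinearMap.opNorm_le_bound _ (by positivity) fun x => ?_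
    have := Convex.norm_image_sub_le_of_norm_deriv_le (f := fun z => T z x)
      (fun u hu => (h x).differentiableAt (hU.mem_nhds (hsub hu))) (fun u hu => hderiv u hu x)
      (convex_closedBall z r) hv hw
    calc _ ≤ _ := this
      _ = _ := by ring
  have hcont : ContinuousOn T (Metric.closedBall z r) := by
    have : LipschitzOnWith ⟨C / r, by positivity⟩ T (Metric.closedBall z r) :=
      LipschitzOnWith.of_dist_le_mul fun w hw v hv => by
        rw [dist_eq_norm, dist_eq_norm]; exact hlip v hv w hw
    exact this.continuousOn
  have hci : CircleIntegrable T z r :=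
    (hcont.mono Metric.sphere_subset_closedBall).circleIntegrable hr0.le
  -- The operator-valued Cauchy integral is analytic in norm. Evaluated at any vector, it agrees
  -- with T by the vector-valued Cauchy formula.
  have hps := hasFPowerSeriesOn_cauchy_integral hci hr0
  have hda := hps.hasFPowerSeriesAt.analyticAt.differentiableAt
  refine (hda.congr_of_eventuallyEq ?_).differentiableWithinAt
  filter_upwards [Metric.ball_mem_nhds z hr0] with w hw
  ext x
  have hd : DiffContOnCl ℂ (fun z => T z x) (Metric.ball z r) :=
    DifferentiableOn.diffContOnCl ((h x).mono
      ((closure_minimal Metric.ball_subset_closedBall Metric.isClosed_closedBall).trans hsub))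
  rw [← hd.two_pi_i_inv_smul_circleIntegral_sub_inv_smul hw, FunLike.coe_smul, Pi.smul_apply]
  congr 1
  have hint : IntervalIntegrable (fun θ : ℝ => deriv (circleMap z r) θ •
      ((circleMap z r θ - w)⁻¹ • T (circleMap z r θ))) MeasureTheory.volume 0 (2 * Real.pi) := by
    have hw' : CircleIntegrable (fun v => (v - w)⁻¹ • T v) z r := by
      suffices hinv : ContinuousOn (fun v => (v - w)⁻¹) (Metric.sphere z r) by
        exact ContinuousOn.circleIntegrable hr0.le
          (hinv.smul (hcont.mono Metric.sphere_subset_closedBall))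
      refine ContinuousOn.inv₀ (by fun_prop) fun v hv => ?_
      rw [sub_ne_zero]
      rintro rfl
      rw [Metric.mem_sphere] at hv
      rw [Metric.mem_ball, hv] at hw
      exact lt_irrefl _ hw
    exact hw'.out
  exact ((ContinuousLinearMap.apply ℂ X x).intervalIntegral_comp_comm hint)

end Analytic

/-! ### Analytic semigroups from two commuting contraction semigroups -/

section ConstructAnalytic

variable {X : Type*} [NormedAddCommGroup X] [NormedSpace ℂ X]

/-- The coordinate of `z` along `e^{-iα}` in the real basis `e^{-iα}, e^{iα}`. -/
noncomputable def coordLower (α : ℝ) : ℂ →L[ℝ] ℝ :=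
  (2 * Real.sin α * Real.cos α)⁻¹ • (Real.sin α • Complex.reCLM - Real.cos α • Complex.imCLM)

/-- The coordinate of `z` along `e^{iα}` in the real basis `e^{-iα}, e^{iα}`. -/
noncomputable def coordUpper (α : ℝ) : ℂ →L[ℝ] ℝ :=
  (2 * Real.sin α * Real.cos α)⁻¹ • (Real.sin α • Complex.reCLM + Real.cos α • Complex.imCLM)

theorem coordLower_apply (α : ℝ) (z : ℂ) : coordLower α z =
    (2 * Real.sin α * Real.cos α)⁻¹ * (Real.sin α * z.re - Real.cos α * z.im) := rfl

theorem coordUpper_apply (α : ℝ) (z : ℂ) : coordUpper α z =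
    (2 * Real.sin α * Real.cos α)⁻¹ * (Real.sin α * z.re + Real.cos α * z.im) := rfl

theorem coord_add_coord {α : ℝ} (h0 : 0 < α) (h1 : α < Real.pi / 2) (z : ℂ) :
    (coordLower α z : ℂ) * Complex.exp (-(Complex.I * α)) +
      (coordUpper α z : ℂ) * Complex.exp (Complex.I * α) = z := by
  have hs : Real.sin α ≠ 0 := (Real.sin_pos_of_pos_of_lt_pi h0 (by linarith)).ne'
  have hc : Real.cos α ≠ 0 := (Real.cos_pos_of_mem_Ioo ⟨by linarith, h1⟩).ne'
  rw [coordLower_apply, coordUpper_apply]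
  apply Complex.ext <;>
  · simp only [Complex.add_re, Complex.add_im, Complex.re_ofReal_mul, Complex.im_ofReal_mul,
      Complex.exp_re, Complex.exp_im, Complex.neg_re, Complex.neg_im, Complex.I_mul_re,
      Complex.I_mul_im, Complex.ofReal_re, Complex.ofReal_im, neg_zero, Real.exp_zero, one_mul,
      Real.cos_neg, Real.sin_neg]
    field_simp
    ring

/-- Up to a common positive factor the coordinates are ‖z‖ sin(α ∓ arg z), and both angles lie in
(0, π). -/
theorem coord_pos {α : ℝ} (h0 : 0 < α) (h1 : α < Real.pi / 2) {z : ℂ} (hz : z ∈ openSector α) :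
    0 < coordLower α z ∧ 0 < coordUpper α z := by
  obtain ⟨hz0, hz⟩ := hz
  have hr : 0 < ‖z‖ := norm_pos_iff.2 hz0
  have h := abs_lt.1 hz
  have hs : 0 < Real.sin α := Real.sin_pos_of_pos_of_lt_pi h0 (by linarith)
  have hc : 0 < Real.cos α := Real.cos_pos_of_mem_Ioo ⟨by linarith, h1⟩
  have e1 : Real.sin α * z.re - Real.cos α * z.im = ‖z‖ * Real.sin (α - z.arg) := by
    rw [← Complex.norm_mul_cos_arg, ← Complex.norm_mul_sin_arg, Real.sin_sub]; ring
  have e2 : Real.sin α * z.re + Real.cos α * z.im = ‖z‖ * Real.sin (α + z.arg) := by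
    rw [← Complex.norm_mul_cos_arg, ← Complex.norm_mul_sin_arg, Real.sin_add]; ring
  have p1 : 0 < Real.sin (α - z.arg) :=
    Real.sin_pos_of_pos_of_lt_pi (by linarith) (by linarith)
  have p2 : 0 < Real.sin (α + z.arg) :=
    Real.sin_pos_of_pos_of_lt_pi (by linarith) (by linarith)
  rw [coordLower_apply, coordUpper_apply, e1, e2]
  exact ⟨by positivity, by positivity⟩

theorem norm_mul_cos_le_re {α : ℝ} (h1 : α ≤ Real.pi / 2) {z : ℂ} (hz : z ∈ openSector α) :
    ‖z‖ * Real.cos α ≤ z.re := by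
  rw [← Complex.norm_mul_cos_arg, ← Real.cos_abs z.arg]
  gcongr
  exact Real.cos_le_cos_of_nonneg_of_le_pi (abs_nonneg _) (by linarith [Real.pi_pos]) hz.2.le

theorem rot_shift (w : ℂ) (φ : ℝ) (B : X →ₗ.[ℂ] X) :
    rot φ (shift w B) = shift (Complex.exp (-(Complex.I * φ)) * w) (rot φ B) := by
  refine LinearPMap.ext rfl fun x hx hx' => ?_
  change Complex.exp (-(Complex.I * φ)) • (B ⟨x, hx⟩ - w • x) =
    Complex.exp (-(Complex.I * φ)) • B ⟨x, hx⟩ - (Complex.exp (-(Complex.I * φ)) * w) • x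
  rw [smul_sub, smul_smul]

variable [CompleteSpace X]

/-- If `e^{±iα} C` are m-dissipative, then `C` gives rise to an analytic contraction semigroup. -/
theorem exists_analytic_contraction {C : X →ₗ.[ℂ] X} (hd : Dense (C.domain : Set X)) {α : ℝ}
    (h0 : 0 < α) (h1 : α < Real.pi / 2) (hC₁ : MDissipative (rot α C) 0)
    (hC₂ : MDissipative (rot (-α) C) 0) :
    ∃ T : ℂ → X →L[ℂ] X, IsAnalyticSemigroup α T ∧ (∀ z, ‖T z‖ ≤ 1) ∧
      ∀ x y, (x, y) ∈ C.graph → HasDerivWithinAt (fun t : ℝ => T t x) y (Ioi 0) 0 := by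
  obtain ⟨S₁, S₂, hS₁, hS₂, hG₁, hG₂, hb₁, hb₂, hcomm⟩ := exists_commuting_semigroups hd
    (Complex.exp_ne_zero _) (Complex.exp_ne_zero _) hC₁ hC₂
  rw [isGenerator_iff hS₁.map_zero] at hG₁
  rw [isGenerator_iff hS₂.map_zero] at hG₂
  have hα : Complex.exp (-(Complex.I * (-α : ℝ))) = Complex.exp (Complex.I * α) := by
    congr 1; push_cast; ring
  -- For z = a e^{-iα} + b e^{iα} the formal e^{zC} factors as S₁(a)S₂(b), since S₁ and S₂ are
  -- generated by e^{-iα}C and e^{iα}C.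
  let T : ℂ → X →L[ℂ] X := fun z =>
    (S₁ (coordLower α z).toNNReal).comp (S₂ (coordUpper α z).toNNReal)
  have hT : ∀ z x, T z x = S₁ (coordLower α z).toNNReal (S₂ (coordUpper α z).toNNReal x) :=
    fun _ _ => rfl
  have hT0 : T 0 = ContinuousLinearMap.id ℂ X := by
    simp [T, hS₁.map_zero, hS₂.map_zero]
  have hTb : ∀ z, ‖T z‖ ≤ 1 := fun z =>
    (T z).opNorm_le_bound zero_le_one fun x => by
      have := (S₁ (coordLower α z).toNNReal).le_of_opNorm_le_of_le (hb₁ _)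
        ((S₂ (coordUpper α z).toNNReal).le_of_opNorm_le (hb₂ _) x)
      rw [one_mul] at this
      exact this
  have hcoord : Continuous fun z : ℂ => (coordLower α z, coordUpper α z) :=
    (coordLower α).continuous.prodMk (coordUpper α).continuous
  have hTcont : ∀ x, Continuous fun z => T z x := fun x =>
    (continuous_apply_pair hS₁ hb₁ hS₂ x).comp hcoord
  have hderiv : ∀ x y, (x, y) ∈ C.graph → ∀ z ∈ openSector α,
      HasDerivAt (fun z => T z x) (T z y) z := by
    intro x y hxy z hz
    obtain ⟨p1, p2⟩ := coord_pos h0 h1 hz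
    have g1 := (hG₁ x (Complex.exp (-(Complex.I * α)) • y)).1 (mem_graph_rot_of_mem hxy)
    have g2 := (hG₂ x (Complex.exp (-(Complex.I * (-α : ℝ))) • y)).1 (mem_graph_rot_of_mem hxy)
    rw [hα] at g2
    have h2 := (hasFDerivAt_apply_pair hS₁ hS₂ hb₁ hcomm g1 g2 p1 p2).comp z
      (f := fun z => (coordLower α z, coordUpper α z))
      ((coordLower α).hasFDerivAt.prodMk (coordUpper α).hasFDerivAt)
    have h3 : HasFDerivAt (fun z => T z x)
        (ContinuousLinearMap.toSpanSingleton ℂ (T z y)) z := by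
      -- The real derivative sends h, with coordinates (a, b), to (a e^{-iα} + b e^{iα}) T(z)y = h
      -- T(z)y. It is complex linear, which is the Cauchy-Riemann condition.
      refine hasFDerivAt_of_restrictScalars ℝ h2 ?_
      ext h
      simp only [ContinuousLinearMap.coe_restrictScalars', ContinuousLinearMap.comp_apply,
        ContinuousLinearMap.coprod_apply, ContinuousLinearMap.prod_apply,
        ContinuousLinearMap.toSpanSingleton_apply, map_smul]
      rw [← hT, ← Complex.coe_smul, ← Complex.coe_smul, smul_smul, smul_smul, ← add_smul,
        coord_add_coord h0 h1]
    simpa using h3.hasDerivAt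
  refine ⟨T, ⟨hT0, fun z hz w hw => ?_, ?_, fun δ' _ _ x => ?_⟩, hTb, fun x y hxy => ?_⟩
  · obtain ⟨p1, p2⟩ := coord_pos h0 h1 hz
    obtain ⟨q1, q2⟩ := coord_pos h0 h1 hw
    ext x
    change T (z + w) x = T z (T w x)
    rw [hT (z + w), hT z, hT w, map_add, map_add, Real.toNNReal_add p1.le q1.le,
      Real.toNNReal_add p2.le q2.le, hS₁.apply_add, hS₂.apply_add, hcomm (coordLower α w).toNNReal
        (coordUpper α z).toNNReal]
  -- Orbits of domain vectors are holomorphic. Contractivity makes the approximation of any other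
  -- orbit uniform in z.
  · refine differentiableOn_of_strong (isOpen_openSector h1.le) hTb fun x => ?_
    obtain ⟨u, hu, hux⟩ := mem_closure_iff_seq_limit.1 (hd x)
    have hlu : TendstoLocallyUniformlyOn (fun n z => T z (u n)) (fun z => T z x) atTop
        (openSector α) := by
      refine TendstoUniformlyOn.tendstoLocallyUniformlyOn ?_
      rw [Metric.tendstoUniformlyOn_iff]
      intro ε hε
      filter_upwards [Metric.tendsto_nhds.1 hux ε hε] with n hn z _
      rw [dist_comm, dist_eq_norm, ← map_sub]
      rw [dist_eq_norm] at hn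
      refine lt_of_le_of_lt ?_ hn
      simpa using (T z).le_of_opNorm_le (hTb z) (u n - x)
    refine hlu.differentiableOn (Eventually.of_forall fun n z hz => ?_) (isOpen_openSector h1.le)
    obtain ⟨y, hy⟩ := LinearPMap.mem_domain_iff.1 (hu n)
    exact (hderiv _ y hy z hz).differentiableAt.differentiableWithinAt
  · have := (hTcont x).tendsto 0
    simp only [hT0, ContinuousLinearMap.id_apply] at this
    exact this.mono_left nhdsWithin_le_nhds
  · have hmem : ∀ t : ℝ, 0 < t → (t : ℂ) ∈ openSector α := fun t ht => by
      simpa using mul_mem_openSector (φ := 0) (by simpa using h0) h1.le ht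
    have hlim : ∀ v, Tendsto (fun t : ℝ => T (1 * (t : ℂ)) v) (𝓝[>] 0) (𝓝 v) := fun v => by
      have := (((hTcont v).comp Complex.continuous_ofReal).tendsto 0).mono_left
        (nhdsWithin_le_nhds (s := Ioi 0))
      simpa [hT0, Function.comp_def] using this
    have := hasDerivWithinAt_ray hT0 (c := 1) (x := x) (y := y)
      (fun t ht => hderiv x y hxy _ (by simpa using hmem t ht)) (hlim x) (hlim y)
    simpa using this

/-- The three half planes have w on their boundary, so B − w falls under the contractive case and B
receives e^{wz}T(z). On the sector Re(wz) ≤ |w||z| and |z| cos α ≤ Re z, whence the bound ω =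
|w|/cos α. -/
theorem generatesAnalyticContractive_of_mDissipative {B : X →ₗ.[ℂ] X}
    (hd : Dense (B.domain : Set X)) {α : ℝ} (h0 : 0 < α) (h1 : α < Real.pi / 2) {w : ℂ}
    (h : ∀ φ ∈ ({α, -α, 0} : Set ℝ),
      MDissipative (rot φ B) (Complex.exp (-(Complex.I * φ)) * w).re) :
    ∃ ω, GeneratesAnalyticContractive B ω := by
  have hs : ∀ φ ∈ ({α, -α, 0} : Set ℝ), MDissipative (rot φ (shift w B)) 0 := fun φ hφ => by
    have := mDissipative_shift (w := Complex.exp (-(Complex.I * φ)) * w) (h φ hφ)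
    rwa [sub_self, ← rot_shift] at this
  obtain ⟨T, hT, hb, hG⟩ := exists_analytic_contraction (C := shift w B) hd h0 h1
    (hs α (by simp)) (hs (-α) (by simp))
  have hc : 0 < Real.cos α := Real.cos_pos_of_mem_Ioo ⟨by linarith, h1⟩
  have hre : ∀ z ∈ openSector α, (w * z).re ≤ ‖w‖ / Real.cos α * z.re := fun z hz => by
    have h2 := norm_mul_cos_le_re h1.le hz
    rw [div_mul_eq_mul_div, le_div_iff₀ hc]
    have h3 : (w * z).re ≤ ‖w‖ * ‖z‖ := (Complex.re_le_norm _).trans (norm_mul _ _).le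
    nlinarith [norm_nonneg w]
  have hbound : ∀ z ∈ openSector α,
      ‖Complex.exp (w * z) • T z‖ ≤ Real.exp (‖w‖ / Real.cos α * z.re) := fun z hz => by
    rw [norm_smul, Complex.norm_exp]
    exact (mul_le_of_le_one_right (Real.exp_pos _).le (hb z)).trans
      (Real.exp_le_exp.2 (hre z hz))
  have hT0 : Complex.exp (w * 0) • T 0 = ContinuousLinearMap.id ℂ X := by simp [hT.map_zero]
  refine ⟨‖w‖ / Real.cos α, α, h0, h1.le, fun z => Complex.exp (w * z) • T z,
    ⟨hT0, fun z hz v hv => ?_, ?_, fun δ' hδ' hδ'' x => ?_⟩, ?_, hbound⟩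
  · ext x
    rw [hT.map_add z hz v hv, mul_add, Complex.exp_add]
    simp [smul_smul, mul_comm]
  · exact (by fun_prop : Differentiable ℂ fun z => Complex.exp (w * z)).differentiableOn.smul
      hT.differentiableOn
  · have h2 : Tendsto (fun z => Complex.exp (w * z)) (𝓝[openSector δ'] 0) (𝓝 1) := by
      have := ((by fun_prop : Continuous fun z => Complex.exp (w * z)).tendsto 0).mono_left
        (nhdsWithin_le_nhds (s := openSector δ'))
      simpa using this
    have := h2.smul (hT.tendsto_zero δ' hδ' hδ'' x)
    simpa using this
  · have hω : w.re ≤ ‖w‖ / Real.cos α := by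
      rw [le_div_iff₀ hc]
      nlinarith [Complex.re_le_norm w, norm_nonneg w, Real.cos_le_one α, Complex.abs_re_le_norm w,
        abs_nonneg w.re]
    -- The unrotated condition φ = 0 supplies a resolvent point of B beyond the growth bound, so
    -- that the generator is exactly B.
    obtain ⟨R, hR⟩ := (h 0 (by simp)).2 ((‖w‖ / Real.cos α + 1 : ℝ) : ℂ) (by
      rw [Complex.ofReal_re]
      simp
      linarith)
    rw [rot_zero] at hR
    refine isGenerator_of_forall_mem_graph (ω := ‖w‖ / Real.cos α) (by simp [hT.map_zero])
      (fun t => ?_) (fun x y hxy => ?_) (by rw [Complex.ofReal_re]; linarith) hR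
    · rcases eq_or_lt_of_le (zero_le : 0 ≤ t) with rfl | ht
      · simpa [hT.map_zero] using ContinuousLinearMap.norm_id_le (𝕜 := ℂ) (E := X)
      · have h2 : ((t : ℝ) : ℂ) ∈ openSector α := by
          simpa using mul_mem_openSector (φ := 0) (by simpa using h0) h1.le (NNReal.coe_pos.2 ht)
        exact hbound _ h2
    · have h2 := hG x (y - w • x) (mem_graph_shift.2 (by simpa using hxy))
      have h3 := hasDerivWithinAt_exp_smul h2 w
      simp only [Complex.ofReal_zero, hT.map_zero, ContinuousLinearMap.id_apply,
        sub_add_cancel] at h3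
      refine h3.congr (fun t ht => ?_) (by simp [hT.map_zero])
      rw [Real.coe_toNNReal _ (le_of_lt ht)]
      rfl

end ConstructAnalytic

/-! ### Compact numerical spectrum and bounded generators -/

section Bounded

variable {X : Type*} [NormedAddCommGroup X] [NormedSpace ℂ X]

/-- A point w is tested against the half plane of angle arg w, where the relevant real part is |w|
itself. -/
theorem subset_closedBall_of_mDissipative {A : X →ₗ.[ℂ] X} (hd : Dense (A.domain : Set X)) {r : ℝ}
    (h : ∀ θ, MDissipative (rot θ A) r) : numericalSpectrum A ⊆ Metric.closedBall 0 r := by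
  intro w hw
  have h1 := (numericalSpectrum_subset_compl_halfPlane_iff hd).2 (h w.arg) hw
  rw [mem_compl_iff, mem_halfPlane, not_lt] at h1
  have e : Complex.exp (-(Complex.I * w.arg)) * w = (‖w‖ : ℂ) := by
    nth_rw 2 [← Complex.norm_mul_exp_arg_mul_I w]
    rw [mul_left_comm, ← Complex.exp_add, mul_comm Complex.I, neg_add_cancel, Complex.exp_zero,
      mul_one]
  rw [e, Complex.ofReal_re] at h1
  simpa using h1

theorem mDissipative_of_subset_closedBall {A : X →ₗ.[ℂ] X} (hd : Dense (A.domain : Set X)) {r : ℝ}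
    (h : numericalSpectrum A ⊆ Metric.closedBall 0 r) (θ : ℝ) : MDissipative (rot θ A) r := by
  rw [← numericalSpectrum_subset_compl_halfPlane_iff hd]
  intro w hw
  have h1 := h hw
  rw [mem_closedBall_zero_iff] at h1
  rw [mem_compl_iff, mem_halfPlane, not_lt]
  refine (Complex.re_le_norm _).trans ?_
  rwa [norm_mul, norm_exp_neg_I, one_mul]

variable [CompleteSpace X]

theorem mDissipative_rot_of_bounded {A : X →ₗ.[ℂ] X} {B : X →L[ℂ] X}
    (hB : ∀ x y, (x, y) ∈ A.graph ↔ y = B x) (θ : ℝ) : MDissipative (rot θ A) ‖B‖ := by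
  set c := Complex.exp (-(Complex.I * θ)) with hc
  have hcn : ‖c‖ = 1 := norm_exp_neg_I θ
  have hB' : ∀ x y, (x, y) ∈ (rot θ A).graph ↔ y = (c • B) x := fun x y => by
    rw [mem_graph_rot, hB, FunLike.coe_smul, Pi.smul_apply, ← exp_neg_I_inv,
      inv_smul_eq_iff₀ (exp_neg_I_ne_zero θ)]
  have hn : ‖c • B‖ = ‖B‖ := by rw [norm_smul, hcn, one_mul]
  refine ⟨fun x y hxy f hf1 hf2 => ?_, fun μ hμ => ?_⟩
  · rw [(hB' x y).1 hxy]
    refine (Complex.re_le_norm _).trans ?_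
    have := f.le_of_opNorm_le_of_le hf1 ((c • B).le_of_opNorm_le hn.le x)
    rwa [one_mul] at this
  · have hu : μ ∈ _root_.resolventSet ℂ (c • B) := by
      refine spectrum.mem_resolventSet_of_norm_lt_mul ?_
      refine lt_of_le_of_lt ?_ (hμ.trans_le (Complex.re_le_norm μ))
      rw [hn]
      exact mul_le_of_le_one_right (norm_nonneg _) ContinuousLinearMap.norm_id_le
    obtain ⟨u, hu⟩ := spectrum.mem_resolventSet_iff.1 hu
    have hux : ∀ x, (u : X →L[ℂ] X) x = μ • x - (c • B) x := fun x => by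
      rw [hu, Algebra.algebraMap_eq_smul_one]; rfl
    refine ⟨((u⁻¹ : (X →L[ℂ] X)ˣ) : X →L[ℂ] X), isResolvent_iff.2 ⟨fun x => ?_, fun x y hxy => ?_⟩⟩
    · rw [hB']
      have : (u : X →L[ℂ] X) (((u⁻¹ : (X →L[ℂ] X)ˣ) : X →L[ℂ] X) x) = x :=
        congrArg (fun L : X →L[ℂ] X => L x) u.mul_inv
      rw [hux] at this
      rw [sub_eq_iff_eq_add', ← sub_eq_iff_eq_add]
      exact this
    · rw [(hB' x y).1 hxy, ← hux]
      exact congrArg (fun L : X →L[ℂ] X => L x) u.inv_mul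

/-- The generator of a norm continuous semigroup is bounded. -/
theorem GeneratesNormContinuous.exists_bounded {A : X →ₗ.[ℂ] X} (h : GeneratesNormContinuous A) :
    ∃ B : X →L[ℂ] X, ∀ x y, (x, y) ∈ A.graph ↔ y = B x := by
  obtain ⟨T, hT, hG, hcont⟩ := h
  rw [isGenerator_iff hT.map_zero] at hG
  have hc : Continuous fun t : ℝ => T t.toNNReal := hcont.comp continuous_real_toNNReal
  let V : ℝ → X →L[ℂ] X := fun t => ∫ s in (0 : ℝ)..t, T s.toNNReal
  have hV : ∀ t, HasDerivAt V (T t.toNNReal) t := fun t => (hc.integral_hasStrictDerivAt 0 t).hasDerivAt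
  have hV0 : V 0 = 0 := intervalIntegral.integral_same
  have hT0 : T (0 : ℝ).toNNReal = 1 := by rw [Real.toNNReal_zero, hT.map_zero]; rfl
  -- The means V(t)/t tend to 1 in operator norm and the units are open.
  obtain ⟨t, ht, hu⟩ : ∃ t : ℝ, 0 < t ∧ IsUnit (V t) := by
    have h1 := (hV 0).hasDerivWithinAt (s := Ioi 0)
    rw [hasDerivWithinAt_iff_tendsto_slope' self_notMem_Ioi, hT0] at h1
    have h2 := h1.eventually (Units.isOpen.mem_nhds (isUnit_one : IsUnit (1 : X →L[ℂ] X)))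
    obtain ⟨t, ht1, ht2⟩ := (h2.and self_mem_nhdsWithin).exists
    have ht : (0 : ℝ) < t := ht2
    refine ⟨t, ht, ?_⟩
    have h3 : IsUnit (slope V 0 t) := ht1
    rw [slope_def_module, hV0, sub_zero, sub_zero] at h3
    have h4 := h3.smul (Units.mk0 t ht.ne')
    rwa [Units.smul_mk0, smul_inv_smul₀ ht.ne'] at h4
  obtain ⟨u, hu⟩ := hu
  -- Dividing by the invertible V(t) expresses T(h) through the norm differentiable function V.
  have hmul : ∀ h : ℝ, 0 ≤ h → T h.toNNReal * V t = V (t + h) - V h := by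
    intro h hh
    have hi : ∀ a b, IntervalIntegrable (fun s : ℝ => T s.toNNReal) MeasureTheory.volume a b :=
      fun a b => hc.intervalIntegrable a b
    rw [show V (t + h) - V h = ∫ s in h..(t + h), T s.toNNReal from
      intervalIntegral.integral_interval_sub_left (hi _ _) (hi _ _)]
    have e1 : ∫ s in h..(t + h), T s.toNNReal = ∫ s in (0 : ℝ)..t, T (s + h).toNNReal := by
      rw [intervalIntegral.integral_comp_add_right (fun s => T s.toNNReal), zero_add]
    rw [e1]
    have e2 := (ContinuousLinearMap.mul ℝ (X →L[ℂ] X) (T h.toNNReal)).intervalIntegral_comp_comm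
      (hi 0 t)
    refine Eq.trans e2.symm (intervalIntegral.integral_congr fun s hs => ?_)
    rw [uIcc_of_le ht.le] at hs
    change T h.toNNReal * T s.toNNReal = _
    rw [Real.toNNReal_add hs.1 hh, add_comm, hT.map_add]
    rfl
  have hTh : ∀ h : ℝ, 0 ≤ h → T h.toNNReal = (V (t + h) - V h) * ((u⁻¹ : (X →L[ℂ] X)ˣ) : X →L[ℂ] X) :=
    fun h hh => by rw [← hmul h hh, ← hu, mul_assoc, u.mul_inv, mul_one]
  set B : X →L[ℂ] X := (T t.toNNReal - 1) * ((u⁻¹ : (X →L[ℂ] X)ˣ) : X →L[ℂ] X) with hB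
  have hder : HasDerivWithinAt (fun h : ℝ => T h.toNNReal) B (Ioi 0) 0 := by
    have h1 : HasDerivAt (fun h : ℝ => V (t + h)) (T t.toNNReal) 0 := by
      have := HasDerivAt.comp_const_add t 0 (f := V) (by simpa using hV (t + 0))
      simpa using this
    have h2 := ((h1.sub (hV 0)).mul_const ((u⁻¹ : (X →L[ℂ] X)ˣ) : X →L[ℂ] X)).hasDerivWithinAt
      (s := Ioi 0)
    rw [hT0] at h2
    exact h2.congr (fun h hh => hTh h (le_of_lt hh)) (hTh 0 le_rfl)
  have hderx : ∀ x, HasDerivWithinAt (fun h : ℝ => T h.toNNReal x) (B x) (Ioi 0) 0 := fun x =>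
    ((ContinuousLinearMap.apply ℂ X x).restrictScalars ℝ).hasFDerivAt.comp_hasDerivWithinAt 0 hder
  refine ⟨B, fun x y => ?_⟩
  rw [hG]
  constructor
  · exact fun h => (uniqueDiffWithinAt_Ioi (0 : ℝ)).eq_deriv _ h (hderx x)
  · rintro rfl
    exact hderx x

theorem generatesNormContinuous_of_bounded {A : X →ₗ.[ℂ] X} {B : X →L[ℂ] X}
    (hB : ∀ x y, (x, y) ∈ A.graph ↔ y = B x) : GeneratesNormContinuous A := by
  have hcont : Continuous fun t : ℝ≥0 => NormedSpace.exp ((t : ℝ) • B) := by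
    have : Continuous fun t : ℝ => NormedSpace.exp (t • B) :=
      continuous_iff_continuousAt.2 fun t => (hasDerivAt_exp_smul_const (𝕂 := ℝ) B t).continuousAt
    exact this.comp NNReal.continuous_coe
  have h0 : NormedSpace.exp (((0 : ℝ≥0) : ℝ) • B) = ContinuousLinearMap.id ℂ X := by
    rw [NNReal.coe_zero, zero_smul, NormedSpace.exp_zero]; rfl
  refine ⟨fun t => NormedSpace.exp ((t : ℝ) • B), ⟨h0, fun s t => ?_, fun x => ?_⟩, ?_, hcont⟩
  · simp only [NNReal.coe_add, add_smul]
    rw [clm_exp_add (((Commute.refl B).smul_left _).smul_right _)]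
    rfl
  · exact hcont.clm_apply continuous_const
  · rw [isGenerator_iff h0]
    intro x y
    have h1 : HasDerivWithinAt (fun t : ℝ => NormedSpace.exp ((t.toNNReal : ℝ) • B) x) (B x)
        (Ioi 0) 0 := by
      have h2 := (hasDerivAt_exp_smul_apply B x 0).hasDerivWithinAt (s := Ioi 0)
      rw [zero_smul, NormedSpace.exp_zero, one_apply_eq_self] at h2
      refine h2.congr (fun t ht => ?_) (by simp)
      rw [Real.coe_toNNReal _ (le_of_lt ht)]
    rw [hB]
    constructor
    · rintro rfl
      exact h1
    · exact fun h => (uniqueDiffWithinAt_Ioi (0 : ℝ)).eq_deriv _ h h1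

/-- A closed, densely defined operator that is bounded on its domain is everywhere defined. -/
theorem exists_bounded_of_norm_le {A : X →ₗ.[ℂ] X} (hA : A.IsClosed)
    (hd : Dense (A.domain : Set X)) {C : ℝ} (hC : ∀ x y, (x, y) ∈ A.graph → ‖y‖ ≤ C * ‖x‖) :
    ∃ B : X →L[ℂ] X, ∀ x y, (x, y) ∈ A.graph ↔ y = B x := by
  have hdom : ∀ x, x ∈ A.domain := by
    intro x
    obtain ⟨u, hu, hux⟩ := mem_closure_iff_seq_limit.1 (hd x)
    choose v hv using fun n => LinearPMap.mem_domain_iff.1 (hu n)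
    have hcau : CauchySeq v := by
      rw [Metric.cauchySeq_iff]
      intro ε hε
      obtain ⟨N, hN⟩ := Metric.cauchySeq_iff.1 hux.cauchySeq (ε / (|C| + 1)) (by positivity)
      refine ⟨N, fun m hm n hn => ?_⟩
      have h1 := hN m hm n hn
      have h2 := hC _ _ (A.graph.sub_mem (hv m) (hv n))
      rw [dist_eq_norm] at h1 ⊢
      rw [lt_div_iff₀ (by positivity)] at h1
      change ‖v m - v n‖ ≤ C * ‖u m - u n‖ at h2
      nlinarith [le_abs_self C, norm_nonneg (u m - u n)]
    obtain ⟨y, hy⟩ := cauchySeq_tendsto_of_complete hcau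
    have : (x, y) ∈ (A.graph : Set (X × X)) :=
      IsClosed.mem_of_tendsto hA (hux.prodMk_nhds hy) (Eventually.of_forall hv)
    exact LinearPMap.mem_domain_iff.2 ⟨y, this⟩
  let L : X →ₗ[ℂ] X := A.toFun.comp (LinearMap.id.codRestrict A.domain hdom)
  have hL : ∀ x, (x, L x) ∈ A.graph := fun x => A.mem_graph ⟨x, hdom x⟩
  refine ⟨L.mkContinuous C fun x => hC _ _ (hL x), fun x y => ⟨fun h => ?_, ?_⟩⟩
  · exact LinearPMap.mem_graph_snd_inj A h (hL x) rfl
  · rintro rfl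
    exact hL x

/-- An operator all of whose rotations are m-dissipative with a common bound is bounded. -/
theorem exists_bounded_of_mDissipative {A : X →ₗ.[ℂ] X} (hA : A.IsClosed)
    (hd : Dense (A.domain : Set X)) {r : ℝ} (hr : 0 < r) (h : ∀ θ, MDissipative (rot θ A) r) :
    ∃ B : X →L[ℂ] X, ∀ x y, (x, y) ∈ A.graph ↔ y = B x := by
  have hres : ∀ μ : ℂ, ∃ R : X →L[ℂ] X, r < ‖μ‖ →
      IsResolvent A μ R ∧ ‖R‖ ≤ 1 / (‖μ‖ - r) := by
    intro μ
    by_cases hμ : r < ‖μ‖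
    · have e : Complex.exp (Complex.I * μ.arg) * (‖μ‖ : ℂ) = μ := by
        nth_rw 3 [← Complex.norm_mul_exp_arg_mul_I μ]
        rw [mul_comm, mul_comm Complex.I]
      obtain ⟨R, hR⟩ := (h μ.arg).2 (‖μ‖ : ℂ) (by rwa [Complex.ofReal_re])
      have h1 := (h μ.arg).norm_le (by rwa [Complex.ofReal_re]) hR
      have h2 := isResolvent_of_rot _ hR
      rw [e] at h2
      refine ⟨_, fun _ => ⟨h2, ?_⟩⟩
      rwa [norm_smul, norm_exp_neg_I, one_mul, ← Complex.ofReal_re ‖μ‖]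
    · exact ⟨0, fun h => absurd h hμ⟩
  choose R hR using hres
  have hcont : ∀ μ : ℂ, r < ‖μ‖ → ∀ v, ContinuousAt (fun l => R l v) μ := by
    intro μ hμ v
    obtain ⟨s, hs1, hs2⟩ := exists_between hμ
    have hev : ∀ᶠ l : ℂ in 𝓝 μ, s < ‖l‖ := continuous_norm.continuousAt.eventually_const_lt hs2
    rw [ContinuousAt, tendsto_iff_norm_sub_tendsto_zero]
    have hlim : Tendsto (fun l : ℂ => ‖μ - l‖ * (1 / (s - r) * ‖R μ v‖)) (𝓝 μ) (𝓝 0) := by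
      have : Continuous fun l : ℂ => ‖μ - l‖ * (1 / (s - r) * ‖R μ v‖) := by fun_prop
      simpa using this.tendsto μ
    refine squeeze_zero' (Eventually.of_forall fun _ => norm_nonneg _) ?_ hlim
    filter_upwards [hev] with l hl
    rw [(hR l (hs1.trans hl)).1.sub_eq (hR μ hμ).1, norm_smul]
    gcongr
    refine (R l).le_of_opNorm_le ((hR l (hs1.trans hl)).2.trans ?_) _
    have : 0 < s - r := sub_pos.2 hs1
    gcongr
  have hdiff : ∀ μ : ℂ, r < ‖μ‖ → ∀ v, DifferentiableAt ℂ (fun l => R l v) μ := by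
    intro μ hμ v
    have hev : ∀ᶠ l : ℂ in 𝓝 μ, r < ‖l‖ := continuous_norm.continuousAt.eventually_const_lt hμ
    refine HasDerivAt.differentiableAt (f' := -(R μ (R μ v))) ?_
    rw [hasDerivAt_iff_tendsto_slope]
    refine ((hcont μ hμ (R μ v)).neg.tendsto.mono_left nhdsWithin_le_nhds).congr' ?_
    filter_upwards [hev.filter_mono nhdsWithin_le_nhds, self_mem_nhdsWithin] with l hl hne
    rw [slope_def_module, (hR l hl).1.sub_eq (hR μ hμ).1, smul_smul, ← neg_sub l μ, mul_neg,
      inv_mul_cancel₀ (sub_ne_zero.2 hne), neg_one_smul]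
    rfl
  -- The constant comes from the Schwarz lemma: a bound 3‖x‖ on a disc of radius 1/(2r).
  refine exists_bounded_of_norm_le hA hd (C := 6 * r) fun x y hxy => ?_
  have hRy : ∀ μ : ℂ, r < ‖μ‖ → R μ y = μ • R μ x - x := fun μ hμ => by
    have := (isResolvent_iff.1 (hR μ hμ).1).2 _ _ hxy
    rw [map_sub, map_smul, sub_eq_iff_eq_add', ← sub_eq_iff_eq_add] at this
    exact this.symm
  -- The resolvent near infinity in the variable z = 1/μ. As R(μ)y = μR(μ)x − x, it is bounded by
  -- 3‖x‖ for |μ| > 2r, although y itself is not yet controlled; the decay of R(μ) makes the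
  -- singularity at 0 removable.
  let g : ℂ → X := fun z => if z = 0 then 0 else R z⁻¹ y
  have hg : ∀ z ≠ 0, g z = R z⁻¹ y := fun z hz => if_neg hz
  have hg0 : g 0 = 0 := if_pos rfl
  have hnorm : ∀ z ∈ Metric.ball (0 : ℂ) (1 / (2 * r)), z ≠ 0 → 2 * r < ‖z⁻¹‖ := by
    intro z hz hz0
    rw [mem_ball_zero_iff, lt_one_div (norm_pos_iff.2 hz0) (by positivity)] at hz
    rwa [norm_inv, ← one_div]
  have hgle : ∀ z ∈ Metric.ball (0 : ℂ) (1 / (2 * r)), ‖g z‖ ≤ 3 * ‖x‖ := by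
    intro z hz
    by_cases hz0 : z = 0
    · rw [hz0, hg0, norm_zero]; positivity
    have h1 := hnorm z hz hz0
    have h2 : r < ‖z⁻¹‖ := by linarith
    rw [hg z hz0, hRy _ h2]
    have h3 : ‖z⁻¹ • R z⁻¹ x‖ ≤ 2 * ‖x‖ := by
      rw [norm_smul]
      have h4 := (R z⁻¹).le_of_opNorm_le (hR _ h2).2 x
      have h5 : ‖z⁻¹‖ * (1 / (‖z⁻¹‖ - r)) ≤ 2 := by
        rw [mul_one_div, div_le_iff₀ (by linarith)]
        linarith
      calc ‖z⁻¹‖ * ‖R z⁻¹ x‖ ≤ ‖z⁻¹‖ * (1 / (‖z⁻¹‖ - r) * ‖x‖) := by gcongr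
        _ = ‖z⁻¹‖ * (1 / (‖z⁻¹‖ - r)) * ‖x‖ := by ring
        _ ≤ _ := by gcongr
    calc _ ≤ ‖z⁻¹ • R z⁻¹ x‖ + ‖x‖ := norm_sub_le _ _
      _ ≤ _ := by linarith
  have hgcont : ContinuousAt g 0 := by
    rw [ContinuousAt, hg0, tendsto_zero_iff_norm_tendsto_zero]
    have hlim : Tendsto (fun z : ℂ => ‖z‖ * (2 * ‖y‖)) (𝓝 0) (𝓝 0) := by
      have : Continuous fun z : ℂ => ‖z‖ * (2 * ‖y‖) := by fun_prop
      simpa using this.tendsto 0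
    refine squeeze_zero' (Eventually.of_forall fun _ => norm_nonneg _) ?_ hlim
    filter_upwards [Metric.ball_mem_nhds (0 : ℂ) (by positivity : 0 < 1 / (2 * r))] with z hz
    by_cases hz0 : z = 0
    · rw [hz0, hg0]; simp
    have h1 := hnorm z hz hz0
    have h2 : r < ‖z⁻¹‖ := by linarith
    rw [hg z hz0]
    have h4 := (R z⁻¹).le_of_opNorm_le (hR _ h2).2 y
    have h5 : 1 / (‖z⁻¹‖ - r) ≤ ‖z‖ * 2 := by
      have h6 : ‖z‖ * ‖z⁻¹‖ = 1 := by
        rw [← norm_mul, mul_inv_cancel₀ hz0, norm_one]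
      have h7 := norm_pos_iff.2 hz0
      rw [div_le_iff₀ (by linarith)]
      nlinarith
    calc _ ≤ _ := h4
      _ ≤ ‖z‖ * 2 * ‖y‖ := by gcongr
      _ = _ := by ring
  have hgdiff : DifferentiableOn ℂ g (Metric.ball 0 (1 / (2 * r))) := by
    rw [← Complex.differentiableOn_compl_singleton_and_continuousAt_iff
      (Metric.ball_mem_nhds (0 : ℂ) (by positivity : 0 < 1 / (2 * r)))]
    refine ⟨fun z hz => ?_, hgcont⟩
    have hz0 : z ≠ 0 := hz.2
    have h1 := hnorm z hz.1 hz0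
    have h2 : DifferentiableAt ℂ (fun z : ℂ => R z⁻¹ y) z :=
      DifferentiableAt.comp z (hdiff z⁻¹ (by linarith) y) (differentiableAt_inv hz0)
    refine (h2.congr_of_eventuallyEq ?_).differentiableWithinAt
    filter_upwards [isOpen_ne.mem_nhds hz0] with v hv using hg v hv
  have hschwarz : ∀ z ∈ Metric.ball (0 : ℂ) (1 / (2 * r)), z ≠ 0 →
      ‖z⁻¹ • R z⁻¹ y‖ ≤ 6 * r * ‖x‖ := by
    intro z hz hz0
    have h1 := Complex.dist_le_div_mul_dist_of_mapsTo_ball (R₂ := 3 * ‖x‖) hgdiff (fun v hv => by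
      rw [hg0, mem_closedBall_zero_iff]; exact hgle v hv) hz
    rw [hg0, dist_zero_right, dist_zero_right, hg z hz0] at h1
    rw [norm_smul, norm_inv, inv_mul_eq_div, div_le_iff₀ (norm_pos_iff.2 hz0)]
    refine h1.trans (le_of_eq ?_)
    field_simp
    ring
  have hl : ∀ n : ℕ, 2 * r < ‖((2 * r + (n + 1) : ℝ) : ℂ)‖ := fun n => by
    rw [Complex.norm_of_nonneg (by positivity)]
    linarith [n.cast_nonneg (α := ℝ)]
  have hl' : ∀ n : ℕ, r < ‖((2 * r + (n + 1) : ℝ) : ℂ)‖ := fun n => by linarith [hl n]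
  have hle : ∀ n : ℕ, ‖R ((2 * r + (n + 1) : ℝ) : ℂ)‖ ≤ 1 / (n + 1) := fun n => by
    refine (hR _ (hl' n)).2.trans ?_
    rw [Complex.norm_of_nonneg (by positivity)]
    gcongr
    linarith
  -- Along real μ → ∞ the vectors μR(μ)y, all bounded by 6r‖x‖, converge to y.
  have hlim := tendsto_smul_resolvent hd (fun n => (hR _ (hl' n)).1) (C := 2) (fun n => by
    rw [norm_smul]
    calc _ ≤ ‖((2 * r + (n + 1) : ℝ) : ℂ)‖ * (1 / (‖((2 * r + (n + 1) : ℝ) : ℂ)‖ - r)) := by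
          gcongr; exact (hR _ (hl' n)).2
      _ ≤ 2 := by
          rw [mul_one_div, div_le_iff₀ (by linarith [hl' n])]
          linarith [hl n])
    (squeeze_zero (fun _ => norm_nonneg _) hle tendsto_one_div_add_atTop_nhds_zero_nat) y
  refine le_of_tendsto' hlim.norm fun n => ?_
  have hne : ((2 * r + (n + 1) : ℝ) : ℂ) ≠ 0 := by
    rw [← norm_pos_iff]; linarith [hl n]
  have := hschwarz (((2 * r + (n + 1) : ℝ) : ℂ)⁻¹) (by
    rw [mem_ball_zero_iff, norm_inv, one_div]
    gcongr
    exact hl n) (inv_ne_zero hne)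
  rwa [inv_inv] at this

/-- The numerical spectrum is bounded iff the operator generates a norm continuous semigroup. -/
theorem subset_isCompact_iff {A : X →ₗ.[ℂ] X} (hA : A.IsClosed) (hd : Dense (A.domain : Set X)) :
    (∃ K : Set ℂ, IsCompact K ∧ numericalSpectrum A ⊆ K) ↔ GeneratesNormContinuous A := by
  constructor
  · rintro ⟨K, hK, hAK⟩
    obtain ⟨r, hr, hKr⟩ := hK.isBounded.subset_closedBall_lt 0 0
    obtain ⟨B, hB⟩ := exists_bounded_of_mDissipative hA hd hr
      (mDissipative_of_subset_closedBall hd (hAK.trans hKr))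
    exact generatesNormContinuous_of_bounded hB
  · intro h
    obtain ⟨B, hB⟩ := h.exists_bounded
    exact ⟨_, isCompact_closedBall _ _,
      subset_closedBall_of_mDissipative hd (mDissipative_rot_of_bounded hB)⟩

theorem isCompact_numericalSpectrum_iff {A : X →ₗ.[ℂ] X} (hA : A.IsClosed)
    (hd : Dense (A.domain : Set X)) :
    IsCompact (numericalSpectrum A) ↔ GeneratesNormContinuous A := by
  rw [← subset_isCompact_iff hA hd]
  exact ⟨fun h => ⟨_, h, Subset.rfl⟩, fun ⟨_, hK, hAK⟩ =>
    hK.of_isClosed_subset (isClosed_numericalSpectrum hd) hAK⟩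

end Bounded

/-! ### Plane geometry of half planes, sectors and strips -/

section Geometry

theorem re_exp_mul (φ : ℝ) (v : ℂ) :
    (Complex.exp (-(Complex.I * φ)) * v).re = ‖v‖ * Real.cos (v.arg - φ) := by
  have h1 := Complex.norm_mul_cos_arg v
  have h2 := Complex.norm_mul_sin_arg v
  rw [Complex.mul_re, Real.cos_sub]
  simp only [Complex.exp_re, Complex.exp_im, Complex.neg_re, Complex.neg_im, Complex.I_mul_re,
    Complex.I_mul_im, Complex.ofReal_re, Complex.ofReal_im, neg_zero, Real.exp_zero, one_mul,
    Real.cos_neg, Real.sin_neg]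
  linear_combination -Real.cos φ * h1 - Real.sin φ * h2

theorem re_exp_mul_nonneg {α φ : ℝ} (hφ : |φ| ≤ α) {v : ℂ}
    (hv : |v.arg| ≤ Real.pi / 2 - α) : 0 ≤ (Complex.exp (-(Complex.I * φ)) * v).re := by
  rw [re_exp_mul]
  have h1 := abs_le.1 hφ
  have h2 := abs_le.1 hv
  exact mul_nonneg (norm_nonneg _) (Real.cos_nonneg_of_mem_Icc ⟨by linarith, by linarith⟩)

/-- Adding the two inequalities gives cos(arg v) ≥ 0, which confines arg v to [−π/2, π/2]. There
cos(arg v ∓ α) ≥ 0 excludes the remaining angles without wrap-around. -/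
theorem abs_arg_le_of_re_nonneg {α : ℝ} (h0 : 0 < α) (h1 : α < Real.pi / 2) {v : ℂ}
    (hv₁ : 0 ≤ (Complex.exp (-(Complex.I * α)) * v).re)
    (hv₂ : 0 ≤ (Complex.exp (-(Complex.I * (-α : ℝ))) * v).re) : |v.arg| ≤ Real.pi / 2 - α := by
  rw [re_exp_mul] at hv₁ hv₂
  rcases eq_or_ne v 0 with rfl | hv
  · simp only [Complex.arg_zero, abs_zero]
    linarith
  have hn : 0 < ‖v‖ := norm_pos_iff.2 hv
  have c1 : 0 ≤ Real.cos (v.arg - α) := by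
    by_contra! h; nlinarith
  have c2 : 0 ≤ Real.cos (v.arg - -α) := by
    by_contra! h; nlinarith
  have hre : |v.arg| ≤ Real.pi / 2 := by
    rw [Complex.abs_arg_le_pi_div_two_iff, ← Complex.norm_mul_cos_arg]
    have hc : 0 < Real.cos α := Real.cos_pos_of_mem_Ioo ⟨by linarith, h1⟩
    have h3 : Real.cos (v.arg - α) + Real.cos (v.arg - -α) = 2 * Real.cos v.arg * Real.cos α := by
      rw [Real.cos_sub, Real.cos_sub, Real.cos_neg, Real.sin_neg]; ring
    have : 0 ≤ Real.cos v.arg := by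
      by_contra! h; nlinarith
    positivity
  rw [abs_le] at hre ⊢
  constructor
  · by_contra! h
    have := Real.cos_neg_of_pi_div_two_lt_of_lt (x := -(v.arg - α)) (by linarith) (by linarith)
    rw [Real.cos_neg] at this
    linarith
  · by_contra! h
    have := Real.cos_neg_of_pi_div_two_lt_of_lt (x := v.arg - -α) (by linarith) (by linarith)
    linarith

/-- The sector of angle θ opens along e^{-iθ}, so the half planes avoiding it point around the
opposite direction e^{i(π−θ)}. -/
theorem exp_rotate (φ θ : ℝ) (w : ℂ) : Complex.exp (-(Complex.I * (φ + (Real.pi - θ) : ℝ))) * w =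
    -(Complex.exp (-(Complex.I * φ)) * (Complex.exp (Complex.I * θ) * w)) := by
  rw [← mul_assoc, ← Complex.exp_add]
  have : -(Complex.I * (φ + (Real.pi - θ) : ℝ)) =
      (-(Complex.I * φ) + Complex.I * θ) + -(Real.pi * Complex.I) := by push_cast; ring
  rw [this, Complex.exp_add, Complex.exp_neg (Real.pi * Complex.I), Complex.exp_pi_mul_I]
  norm_num

theorem sector_subset_compl_halfPlane {θ α φ : ℝ} {z : ℂ} (hφ : |φ| ≤ α) :
    sector θ (Real.pi / 2 - α) z ⊆ (halfPlane (φ + (Real.pi - θ))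
      (Complex.exp (-(Complex.I * (φ + (Real.pi - θ) : ℝ))) * z).re)ᶜ := by
  intro w hw
  have h1 := re_exp_mul_nonneg hφ hw
  rw [mem_compl_iff, mem_halfPlane, not_lt, exp_rotate, exp_rotate]
  simp only [mul_sub, Complex.sub_re, Complex.neg_re] at h1 ⊢
  linarith

theorem inter_compl_halfPlane_subset_sector {θ α : ℝ} (h0 : 0 < α) (h1 : α < Real.pi / 2)
    {z : ℂ} :
    (halfPlane (α + (Real.pi - θ))
        (Complex.exp (-(Complex.I * (α + (Real.pi - θ) : ℝ))) * z).re)ᶜ ∩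
      (halfPlane (-α + (Real.pi - θ))
        (Complex.exp (-(Complex.I * (-α + (Real.pi - θ) : ℝ))) * z).re)ᶜ ⊆
      sector θ (Real.pi / 2 - α) z := by
  rintro w ⟨hw1, hw2⟩
  rw [mem_compl_iff, mem_halfPlane, not_lt, exp_rotate, exp_rotate] at hw1 hw2
  refine abs_arg_le_of_re_nonneg h0 h1 ?_ ?_ <;>
  · simp only [mul_sub, Complex.sub_re, Complex.neg_re] at hw1 hw2 ⊢
    linarith

/-- Any two half planes whose boundaries are not parallel have a common vertex. -/
theorem exists_vertex {α φ ω₁ ω₂ : ℝ} (h0 : 0 < α) (h1 : α < Real.pi / 2) :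
    ∃ z : ℂ, (Complex.exp (-(Complex.I * (α + φ : ℝ))) * z).re = ω₁ ∧
      (Complex.exp (-(Complex.I * (-α + φ : ℝ))) * z).re = ω₂ := by
  have hs : Real.sin α ≠ 0 := (Real.sin_pos_of_pos_of_lt_pi h0 (by linarith)).ne'
  have hc : Real.cos α ≠ 0 := (Real.cos_pos_of_mem_Ioo ⟨by linarith, h1⟩).ne'
  have e : ∀ (β : ℝ) (u : ℂ), Complex.exp (-(Complex.I * (β + φ : ℝ))) *
      (Complex.exp (Complex.I * φ) * u) = Complex.exp (-(Complex.I * β)) * u := by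
    intro β u
    rw [← mul_assoc, ← Complex.exp_add]
    congr 2
    push_cast
    ring
  -- In coordinates rotated by φ the conditions read a cos α ± b sin α = ω₁, ω₂; the witness is a +
  -- ib.
  refine ⟨Complex.exp (Complex.I * φ) *
    ⟨(ω₁ + ω₂) / (2 * Real.cos α), (ω₁ - ω₂) / (2 * Real.sin α)⟩, ?_, ?_⟩ <;>
  · rw [e, Complex.mul_re]
    simp only [Complex.exp_re, Complex.exp_im, Complex.neg_re, Complex.neg_im, Complex.I_mul_re,
      Complex.I_mul_im, Complex.ofReal_re, Complex.ofReal_im, neg_zero, Real.exp_zero, one_mul,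
      Real.cos_neg, Real.sin_neg, neg_neg]
    field_simp
    ring

theorem halfPlane_pi_add (θ ω : ℝ) :
    halfPlane (Real.pi + θ) ω = {w | ω < -(Complex.exp (-(Complex.I * θ)) * w).re} := by
  ext w
  rw [mem_halfPlane, mem_ofPred_eq, ← Complex.neg_re, ← neg_mul (Complex.exp _)]
  have : -(Complex.I * (Real.pi + θ : ℝ)) = -(Complex.I * θ) + -(Real.pi * Complex.I) := by
    push_cast; ring
  rw [this, Complex.exp_add, Complex.exp_neg (Real.pi * Complex.I), Complex.exp_pi_mul_I]
  norm_num

/-- The sign of the angle changes because strips are defined with e^{iθ}w and half planes with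
e^{-iθ}w. -/
theorem strip_eq (θ ω₁ ω₂ : ℝ) :
    strip θ ω₁ ω₂ = (halfPlane (-θ) ω₂)ᶜ ∩ (halfPlane (Real.pi + -θ) (-ω₁))ᶜ := by
  ext w
  rw [halfPlane_pi_add]
  simp only [strip, mem_ofPred_eq, mem_inter_iff, mem_compl_iff, mem_halfPlane, not_lt,
    Complex.ofReal_neg, mul_neg, neg_neg, neg_le_neg_iff]
  exact and_comm

end Geometry

/-! ### Classification and correspondence with generators -/

section Main

variable {X : Type*} [NormedAddCommGroup X] [NormedSpace ℂ X]

theorem rot_pi_add (θ : ℝ) (A : X →ₗ.[ℂ] X) : rot (Real.pi + θ) A = -(rot θ A) := by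
  rw [← rot_rot, rot_pi]

theorem rot_congr {θ θ' : ℝ} (h : Complex.exp (-(Complex.I * θ)) = Complex.exp (-(Complex.I * θ')))
    (A : X →ₗ.[ℂ] X) : rot θ A = rot θ' A := by
  rw [rot, rot, h]

theorem halfPlane_congr {θ θ' : ℝ}
    (h : Complex.exp (-(Complex.I * θ)) = Complex.exp (-(Complex.I * θ'))) (ω : ℝ) :
    halfPlane θ ω = halfPlane θ' ω := by
  rw [halfPlane, halfPlane, h]

/-- Two non-parallel admissible half planes confine the numerical spectrum to a sector. -/
theorem exists_sector_of_two_halfPlanes {A : X →ₗ.[ℂ] X} (hd : Dense (A.domain : Set X))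
    {θ d ω₁ ω₂ : ℝ} (hd0 : 0 < d) (hd1 : d < Real.pi) (h1 : MDissipative (rot θ A) ω₁)
    (h2 : MDissipative (rot (θ + d) A) ω₂) :
    ∃ θ ∈ Ico (0 : ℝ) (2 * Real.pi), ∃ δ ∈ Ioo (0 : ℝ) (Real.pi / 2), ∃ z : ℂ,
      numericalSpectrum A ⊆ sector θ δ z := by
  rw [← numericalSpectrum_subset_compl_halfPlane_iff hd] at h1 h2
  have ha0 : 0 < d / 2 := by linarith
  have ha1 : d / 2 < Real.pi / 2 := by linarith
  obtain ⟨z, hz1, hz2⟩ := exists_vertex (α := d / 2) (φ := θ + d / 2) (ω₁ := ω₂) (ω₂ := ω₁) ha0 ha1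
  refine ⟨_, toIcoMod_mem (Real.pi - (θ + d / 2)), Real.pi / 2 - d / 2,
    ⟨by linarith, by linarith⟩, z, ?_⟩
  rw [sector_toIcoMod]
  refine Subset.trans ?_ (inter_compl_halfPlane_subset_sector ha0 ha1)
  rw [sub_sub_cancel, hz1, hz2]
  refine subset_inter ?_ ?_
  · rwa [show d / 2 + (θ + d / 2) = θ + d by ring]
  · rwa [show -(d / 2) + (θ + d / 2) = θ by ring]

/-- The cases are the directions of admissible half planes. None gives the plane. A single direction
gives nested half planes, whose union is a half plane or everything. Two opposite directions give a
strip and two that are not parallel give a sector. -/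
theorem numericalSpectrum_classification {A : X →ₗ.[ℂ] X} (hd : Dense (A.domain : Set X)) :
    numericalSpectrum A = Set.univ ∨
      (∃ θ ∈ Set.Ico (0 : ℝ) (2 * Real.pi), ∃ ω : ℝ, numericalSpectrum A = (halfPlane θ ω)ᶜ) ∨
      (∃ θ ∈ Set.Ico (0 : ℝ) (2 * Real.pi), ∃ δ ∈ Set.Ioo (0 : ℝ) (Real.pi / 2), ∃ z : ℂ,
        numericalSpectrum A ⊆ sector θ δ z) ∨
      (∃ θ ∈ Set.Ico (0 : ℝ) (2 * Real.pi), ∃ ω₁ ω₂ : ℝ, ω₁ < ω₂ ∧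
        numericalSpectrum A ⊆ strip θ ω₁ ω₂) ∨
      IsCompact (numericalSpectrum A) := by
  by_cases hex : ∃ θ₀ ω₀, MDissipative (rot θ₀ A) ω₀
  swap
  · left
    rw [numericalSpectrum, compl_univ_iff, eq_empty_iff_forall_notMem]
    intro w hw
    obtain ⟨θ, ω, -, h⟩ := (mem_numericalResolventSet_iff hd).1 hw
    exact hex ⟨θ, ω, h⟩
  right
  obtain ⟨θ₀, ω₀, h₀⟩ := hex
  by_cases hsame : ∀ θ ω, MDissipative (rot θ A) ω →
      Complex.exp (-(Complex.I * θ)) = Complex.exp (-(Complex.I * θ₀))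
  · let S : Set ℝ := {ω | MDissipative (rot θ₀ A) ω}
    have hmem : ∀ w, w ∈ numericalResolventSet A ↔ ∃ ω ∈ S, w ∈ halfPlane θ₀ ω := by
      intro w
      rw [mem_numericalResolventSet_iff hd]
      constructor
      · rintro ⟨θ, ω, hw, h⟩
        have e := hsame θ ω h
        rw [rot_congr e] at h
        rw [halfPlane_congr e] at hw
        exact ⟨ω, h, hw⟩
      · rintro ⟨ω, h, hw⟩
        exact ⟨θ₀, ω, hw, h⟩
    -- The union of the nested half planes is the open half plane at the infimum. If there is none,
    -- the numerical spectrum is empty, hence compact.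
    by_cases hb : BddBelow S
    · left
      refine ⟨_, toIcoMod_mem θ₀, sInf S, ?_⟩
      rw [halfPlane_toIcoMod, numericalSpectrum, compl_inj_iff]
      ext w
      rw [hmem, mem_halfPlane, csInf_lt_iff hb ⟨ω₀, h₀⟩]
      rfl
    · right; right; right
      have : numericalSpectrum A = ∅ := by
        rw [numericalSpectrum, compl_empty_iff, eq_univ_iff_forall]
        intro w
        rw [hmem]
        exact not_bddBelow_iff.1 hb _
      rw [this]
      exact isCompact_empty
  · right
    push Not at hsame
    obtain ⟨θ₁, ω₁, h₁, hne⟩ := hsame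
    -- The angle difference reduced to (−π, π]. It is nonzero; π means opposite directions, and a
    -- negative value is handled by exchanging the two half planes.
    set ψ := (Complex.exp (Complex.I * (θ₁ - θ₀ : ℝ))).arg with hψ
    have e1 : Complex.exp (ψ * Complex.I) = Complex.exp (Complex.I * (θ₁ - θ₀ : ℝ)) := by
      have := Complex.norm_mul_exp_arg_mul_I (Complex.exp (Complex.I * (θ₁ - θ₀ : ℝ)))
      rwa [Complex.norm_exp, Complex.I_mul_re, Complex.ofReal_im, neg_zero, Real.exp_zero,
        Complex.ofReal_one, one_mul] at this
    have e2 : Complex.exp (-(Complex.I * θ₁)) = Complex.exp (-(Complex.I * (θ₀ + ψ : ℝ))) := by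
      have h3 : -(Complex.I * (θ₀ + ψ : ℝ)) = -(Complex.I * θ₀) + -(ψ * Complex.I) := by
        push_cast; ring
      rw [h3, Complex.exp_add, Complex.exp_neg (ψ * Complex.I), e1, ← Complex.exp_neg,
        ← Complex.exp_add]
      congr 1
      push_cast
      ring
    have e3 : Complex.exp (-(Complex.I * θ₀)) = Complex.exp (-(Complex.I * (θ₁ + -ψ : ℝ))) := by
      have h3 : -(Complex.I * (θ₁ + -ψ : ℝ)) = -(Complex.I * θ₁) + ψ * Complex.I := by
        push_cast; ring
      rw [h3, Complex.exp_add, e1, ← Complex.exp_add]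
      congr 1
      push_cast
      ring
    have hψ0 : ψ ≠ 0 := fun h => hne (by rw [e2, h, add_zero])
    have hψ1 := Complex.arg_le_pi (Complex.exp (Complex.I * (θ₁ - θ₀ : ℝ)))
    have hψ2 := Complex.neg_pi_lt_arg (Complex.exp (Complex.I * (θ₁ - θ₀ : ℝ)))
    rw [← hψ] at hψ1 hψ2
    rcases lt_or_gt_of_ne hψ0 with hneg | hpos
    · left
      have h₀' := h₀
      rw [rot_congr e3] at h₀'
      exact exists_sector_of_two_halfPlanes hd (neg_pos.2 hneg) (by linarith) h₁ h₀'
    rcases hψ1.lt_or_eq with hlt | heq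
    · left
      rw [rot_congr e2] at h₁
      exact exists_sector_of_two_halfPlanes hd hpos hlt h₀ h₁
    · right; left
      rw [rot_congr e2, heq, add_comm] at h₁
      -- Raising the upper bound to at least −ω₁ + 1 guarantees a strip of positive width.
      have k0 := (numericalSpectrum_subset_compl_halfPlane_iff hd).2
        (h₀.mono (le_max_left ω₀ (-ω₁ + 1)))
      have k1 := (numericalSpectrum_subset_compl_halfPlane_iff hd).2 h₁
      refine ⟨_, toIcoMod_mem (-θ₀), -ω₁, max ω₀ (-ω₁ + 1),
        lt_of_lt_of_le (by linarith) (le_max_right _ _), ?_⟩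
      rw [strip_toIcoMod, strip_eq, neg_neg, neg_neg]
      exact subset_inter k0 k1

variable [CompleteSpace X]

theorem subset_compl_halfPlane_iff_generates {A : X →ₗ.[ℂ] X} (hA : A.IsClosed)
    (hd : Dense (A.domain : Set X)) (θ ω : ℝ) :
    numericalSpectrum A ⊆ (halfPlane θ ω)ᶜ ↔ GeneratesContractive (rot θ A) ω := by
  rw [numericalSpectrum_subset_compl_halfPlane_iff hd,
    generatesContractive_iff_mDissipative (isClosed_rot hA θ) (dense_domain_rot hd θ)]

theorem subset_strip_iff_generates {A : X →ₗ.[ℂ] X} (hA : A.IsClosed)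
    (hd : Dense (A.domain : Set X)) (θ ω₁ ω₂ : ℝ) :
    numericalSpectrum A ⊆ strip θ ω₁ ω₂ ↔
      GeneratesContractive (rot (-θ) A) ω₂ ∧ GeneratesContractive (-(rot (-θ) A)) (-ω₁) := by
  rw [strip_eq, subset_inter_iff, subset_compl_halfPlane_iff_generates hA hd,
    subset_compl_halfPlane_iff_generates hA hd, rot_pi_add]

/-- A sector of half-angle δ is avoided by every half plane through its vertex tilted by at most π/2
− δ from the opposite axis. These tilts are the rays of the analytic semigroup. -/
theorem subset_sector_iff_generates {A : X →ₗ.[ℂ] X} (hA : A.IsClosed)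
    (hd : Dense (A.domain : Set X)) (θ : ℝ) :
    (∃ δ ∈ Set.Ioo (0 : ℝ) (Real.pi / 2), ∃ z : ℂ, numericalSpectrum A ⊆ sector θ δ z) ↔
      ∃ ω : ℝ, GeneratesAnalyticContractive (rot (Real.pi - θ) A) ω := by
  constructor
  · rintro ⟨δ, ⟨hδ0, hδ1⟩, z, h⟩
    have hα0 : 0 < Real.pi / 2 - δ := by linarith
    refine generatesAnalyticContractive_of_mDissipative (dense_domain_rot hd _) hα0 (by linarith)
      (w := Complex.exp (-(Complex.I * (Real.pi - θ : ℝ))) * z) fun φ hφ => ?_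
    have hφ' : |φ| ≤ Real.pi / 2 - δ := by
      rcases hφ with rfl | rfl | rfl
      · rw [abs_of_pos hα0]
      · rw [abs_neg, abs_of_pos hα0]
      · rw [abs_zero]; exact hα0.le
    have h1 := sector_subset_compl_halfPlane (θ := θ) (z := z) hφ'
    rw [sub_sub_cancel] at h1
    have h2 := (numericalSpectrum_subset_compl_halfPlane_iff hd).1 (h.trans h1)
    rw [rot_rot, ← mul_assoc, ← Complex.exp_add]
    convert h2 using 4
    push_cast
    ring
  · rintro ⟨ω, h⟩
    obtain ⟨δ, hδ0, hδ1, h⟩ := h.exists_rot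
    have hα0 : 0 < δ / 2 := by linarith
    have hα1 : δ / 2 < Real.pi / 2 := by linarith
    have hgood : ∀ φ : ℝ, |φ| < δ →
        numericalSpectrum A ⊆ (halfPlane (φ + (Real.pi - θ)) (ω * Real.cos φ))ᶜ := fun φ hφ => by
      rw [subset_compl_halfPlane_iff_generates hA hd, ← rot_rot]
      exact h φ hφ
    -- Halving δ makes the tilts ±δ/2 strictly admissible and smaller than π/2. The bounds ω cos φ
    -- are those of half planes whose boundaries all pass through e^{i(π−θ)}ω, which is therefore
    -- the vertex.
    refine ⟨Real.pi / 2 - δ / 2, ⟨by linarith, by linarith⟩,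
      Complex.exp (Complex.I * (Real.pi - θ : ℝ)) * ω, ?_⟩
    have e : ∀ φ : ℝ, (Complex.exp (-(Complex.I * (φ + (Real.pi - θ) : ℝ))) *
        (Complex.exp (Complex.I * (Real.pi - θ : ℝ)) * ω)).re = ω * Real.cos φ := by
      intro φ
      rw [← mul_assoc, ← Complex.exp_add]
      have : -(Complex.I * (φ + (Real.pi - θ) : ℝ)) + Complex.I * (Real.pi - θ : ℝ) =
          -(Complex.I * φ) := by push_cast; ring
      rw [this, mul_comm, Complex.re_ofReal_mul, Complex.exp_re]
      simp
    refine Subset.trans ?_ (inter_compl_halfPlane_subset_sector hα0 hα1)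
    rw [e, e]
    refine subset_inter (hgood _ ?_) (hgood _ ?_)
    · rw [abs_of_pos hα0]; linarith
    · rw [abs_neg, abs_of_pos hα0]; linarith

/-- The line is the intersection of two opposite closed half planes, so the condition says that both
A_θ and −A_θ are m-dissipative with bound 0. -/
theorem generatesIsometricGroup_rot_iff {A : X →ₗ.[ℂ] X} (hA : A.IsClosed)
    (hd : Dense (A.domain : Set X)) (θ : ℝ) : GeneratesIsometricGroup (rot θ A) ↔
      numericalSpectrum A ⊆ {w | (Complex.exp (-(Complex.I * θ)) * w).re = 0} := by
  have e : {w : ℂ | (Complex.exp (-(Complex.I * θ)) * w).re = 0} =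
      (halfPlane θ 0)ᶜ ∩ (halfPlane (Real.pi + θ) 0)ᶜ := by
    ext w
    rw [halfPlane_pi_add]
    simp only [mem_ofPred_eq, mem_inter_iff, mem_compl_iff, mem_halfPlane, not_lt,
      Left.neg_nonpos_iff]
    exact le_antisymm_iff
  rw [e, subset_inter_iff]
  constructor
  · intro h
    rw [subset_compl_halfPlane_iff_generates hA hd, subset_compl_halfPlane_iff_generates hA hd,
      rot_pi_add]
    exact ⟨h.generatesContractive, h.neg.generatesContractive⟩
  · rw [numericalSpectrum_subset_compl_halfPlane_iff hd,
      numericalSpectrum_subset_compl_halfPlane_iff hd, rot_pi_add]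
    exact fun h => generatesIsometricGroup_of_mDissipative (dense_domain_rot hd θ) h.1 h.2

end Main

end NumericalSpectrum

/-! ### The full statement -/

open NumericalSpectrum in
theorem proposition2p11 {X : Type*} [NormedAddCommGroup X] [NormedSpace ℂ X] [CompleteSpace X]
    (A : X →ₗ.[ℂ] X) (hclosed : A.IsClosed) (hdense : Dense (A.domain : Set X)) :
    -- at least one of the five classes
    (numericalSpectrum A = Set.univ ∨
      (∃ θ ∈ Set.Ico (0 : ℝ) (2 * Real.pi), ∃ ω : ℝ, numericalSpectrum A = (halfPlane θ ω)ᶜ) ∨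
      (∃ θ ∈ Set.Ico (0 : ℝ) (2 * Real.pi), ∃ δ ∈ Set.Ioo (0 : ℝ) (Real.pi / 2), ∃ z : ℂ,
        numericalSpectrum A ⊆ sector θ δ z) ∨
      (∃ θ ∈ Set.Ico (0 : ℝ) (2 * Real.pi), ∃ ω₁ ω₂ : ℝ, ω₁ < ω₂ ∧
        numericalSpectrum A ⊆ strip θ ω₁ ω₂) ∨
      IsCompact (numericalSpectrum A)) ∧
    -- (1) the whole plane
    (numericalSpectrum A = Set.univ ↔
      ¬ ∃ θ ∈ Set.Ico (0 : ℝ) (2 * Real.pi), ∃ ω : ℝ, GeneratesContractive (rot θ A) ω) ∧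
    -- (2) contained in a half plane
    ((∃ θ ∈ Set.Ico (0 : ℝ) (2 * Real.pi), ∃ ω : ℝ, numericalSpectrum A ⊆ (halfPlane θ ω)ᶜ) ↔
      ∃ θ ∈ Set.Ico (0 : ℝ) (2 * Real.pi), ∃ ω : ℝ, GeneratesContractive (rot θ A) ω) ∧
    -- (3) contained in a sector
    ((∃ θ ∈ Set.Ico (0 : ℝ) (2 * Real.pi), ∃ δ ∈ Set.Ioo (0 : ℝ) (Real.pi / 2), ∃ z : ℂ,
        numericalSpectrum A ⊆ sector θ δ z) ↔
      ∃ θ ∈ Set.Ico (0 : ℝ) (2 * Real.pi), ∃ ω : ℝ, GeneratesAnalyticContractive (rot θ A) ω) ∧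
    -- (4) contained in a strip
    ((∃ θ ∈ Set.Ico (0 : ℝ) (2 * Real.pi), ∃ ω₁ ω₂ : ℝ, ω₁ < ω₂ ∧
        numericalSpectrum A ⊆ strip θ ω₁ ω₂) ↔
      ∃ θ ∈ Set.Ico (0 : ℝ) (2 * Real.pi), ∃ ω₁ ω₂ : ℝ, ω₁ < ω₂ ∧
        GeneratesContractive (rot θ A) ω₂ ∧ GeneratesContractive (-(rot θ A)) (-ω₁)) ∧
    -- (5) compact
    (IsCompact (numericalSpectrum A) ↔ GeneratesNormContinuous A) ∧
    ((∃ K : Set ℂ, IsCompact K ∧ numericalSpectrum A ⊆ K) ↔ GeneratesNormContinuous A) ∧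
    -- the angles and bounds in (2), (3), (4) correspond to each other
    (∀ θ ω : ℝ, numericalSpectrum A ⊆ (halfPlane θ ω)ᶜ ↔ GeneratesContractive (rot θ A) ω) ∧
    (∀ θ : ℝ, (∃ δ ∈ Set.Ioo (0 : ℝ) (Real.pi / 2), ∃ z : ℂ,
        numericalSpectrum A ⊆ sector θ δ z) ↔
      ∃ ω : ℝ, GeneratesAnalyticContractive (rot (Real.pi - θ) A) ω) ∧
    (∀ θ ω₁ ω₂ : ℝ, ω₁ < ω₂ → (numericalSpectrum A ⊆ strip θ ω₁ ω₂ ↔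
      GeneratesContractive (rot (-θ) A) ω₂ ∧ GeneratesContractive (-(rot (-θ) A)) (-ω₁))) ∧
    -- isometric groups
    (GeneratesIsometricGroup A ↔ numericalSpectrum A ⊆ {w | w.re = 0}) ∧
    (∀ θ : ℝ, GeneratesIsometricGroup (rot θ A) ↔
      numericalSpectrum A ⊆ {w | (Complex.exp (-(Complex.I * θ)) * w).re = 0}) := by
  have hI := subset_compl_halfPlane_iff_generates hclosed hdense
  have hS := subset_sector_iff_generates hclosed hdense
  have hT := subset_strip_iff_generates hclosed hdense
  have h2 : (∃ θ ∈ Set.Ico (0 : ℝ) (2 * Real.pi), ∃ ω : ℝ,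
      numericalSpectrum A ⊆ (halfPlane θ ω)ᶜ) ↔
      ∃ θ ∈ Set.Ico (0 : ℝ) (2 * Real.pi), ∃ ω : ℝ, GeneratesContractive (rot θ A) ω := by
    simp only [hI]
  refine ⟨numericalSpectrum_classification hdense, ?_, h2, ?_, ?_,
    isCompact_numericalSpectrum_iff hclosed hdense, subset_isCompact_iff hclosed hdense, hI, hS,
    fun θ ω₁ ω₂ _ => hT θ ω₁ ω₂, ?_, generatesIsometricGroup_rot_iff hclosed hdense⟩
  · constructor
    · rintro h ⟨θ, -, ω, hg⟩
      rw [← hI, h, Set.univ_subset_iff, Set.compl_univ_iff] at hg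
      -- An admissible half plane is nonempty, so it removes a point from the numerical spectrum.
      have : Complex.exp (Complex.I * θ) * ((ω + 1 : ℝ) : ℂ) ∈ halfPlane θ ω := by
        rw [mem_halfPlane, exp_neg_I_mul_cancel, Complex.ofReal_re]
        linarith
      rw [hg] at this
      exact this
    · intro h
      rw [numericalSpectrum, Set.compl_univ_iff, Set.eq_empty_iff_forall_notMem]
      intro w hw
      obtain ⟨θ, ω, -, hm⟩ := (mem_numericalResolventSet_iff hdense).1 hw
      rw [← rot_toIcoMod] at hm
      exact h ⟨_, toIcoMod_mem θ, ω,
        generatesContractive_of_mDissipative (dense_domain_rot hdense _) hm⟩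
  · constructor
    · rintro ⟨θ, -, hθ⟩
      obtain ⟨ω, h⟩ := (hS θ).1 hθ
      exact ⟨_, toIcoMod_mem (Real.pi - θ), ω, by rwa [rot_toIcoMod]⟩
    · rintro ⟨θ, -, ω, h⟩
      -- The correspondence θ ↦ π − θ is an involution, so the same formula serves in both
      -- directions.
      obtain ⟨δ, hδ, z, hz⟩ := (hS (Real.pi - θ)).2 ⟨ω, by rwa [sub_sub_cancel]⟩
      exact ⟨_, toIcoMod_mem (Real.pi - θ), δ, hδ, z, by rwa [sector_toIcoMod]⟩
  · constructor
    · rintro ⟨θ, -, ω₁, ω₂, hω, h⟩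
      refine ⟨_, toIcoMod_mem (-θ), ω₁, ω₂, hω, ?_⟩
      rw [rot_toIcoMod]
      exact (hT θ ω₁ ω₂).1 h
    · rintro ⟨θ, -, ω₁, ω₂, hω, h⟩
      refine ⟨_, toIcoMod_mem (-θ), ω₁, ω₂, hω, ?_⟩
      rw [strip_toIcoMod, hT, neg_neg]
      exact h
  · have := generatesIsometricGroup_rot_iff hclosed hdense 0
    simpa [rot_zero] using this
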